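/- Let $\mathbb{B}^2=\{z\in\mathbb{C}^2 : |z_1|^2+|z_2|^2<1\}$, let $\mathrm{SU}((2,1),\mathbb{C})=\{A\in \mathrm{SL}(3,\mathbb{C}) : A^*HA=H\}$ with $H=\mathrm{diag}(1,1,-1)$, acting on $\mathbb{B}^2$ by fractional linear transformations, and let $\Gamma\subset\mathrm{SU}((2,1),\mathbb{C})$ be a discrete, torsion-free, cocompact subgroup, with compact quotient surface $X_\Gamma=\Gamma\backslash\mathbb{B}^2$. Let $\mu_{\mathrm{hyp}}(z)=-\frac{i}{2}\partial\overline{\partial}\log(1-|z|^2)$ be the hyperbolic metric, and for a metric $\mu$ (a real $(1,1)$-form) let $\mu^{\mathrm{vol}}=\frac{1}{2!}\,\mu\wedge\mu$ be its volume form, so that $\mu^{\mathrm{vol}}_{\mathrm{hyp}}=(i/2)^2(1-|z|^2)^{-3}dz_1\wedge d\overline{z_1}\wedge dz_2\wedge d\overline{z_2}$. Let $\Lambda=\Omega^2_{X_\Gamma}$ be the bundle of holomorphic $(2,0)$-forms. For $k\ge 1$, give $\Lambda^{\otimes k}$ the pointwise metric with $|f(z)(dz_1\wedge dz_2)^{\otimes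 k}|^2_{\mathrm{hyp}}=(1-|z|^2)^{3k}|f(z)|^2$, and $H^0(X_\Gamma,\Lambda^{\otimes k})$ the inner product $\langle\omega,\eta\rangle_{\mathrm{hyp}}=\int_{X_\Gamma}\langle\omega(z),\eta(z)\rangle_{\mathrm{hyp}}\,\mu^{\mathrm{vol}}_{\mathrm{hyp}}(z)$. Let $\mathcal{B}^k_\Lambda(z,w)=\sum_{j}\omega_j(z)\overline{\omega_j(w)}$ be the Bergman kernel, where $(\omega_j)_j$ is any finite orthonormal basis of $H^0(X_\Gamma,\Lambda^{\otimes k})$; thus $|\mathcal{B}^k_\Lambda(z,z)|_{\mathrm{hyp}}=\sum_j|\omega_j(z)|^2_{\mathrm{hyp}}$. Let $$\mu_{\mathrm{ber}}(z)=-\frac{i}{2\pi}\,\partial\overline{\partial}\log|\mathcal{B}^k_\Lambda(z,z)|_{\mathrm{hyp}}$$ be the Bergman metric of $\Lambda^{\otimes k}$. Then there is an integer $k_0$, depending only on $\Gamma$, such that for all $k\ge k_0$ a finite orthonormal basis exists and $|\mathcal{B}^k_\Lambda(z,z)|_{\mathrm{hyp}}>0$ for all $z\in X_\Gamma$ (so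 that $\mu_{\mathrm{ber}}$ is defined everywhere), and for every $\epsilon>0$ there is a constant $C$, depending only on $\Gamma$ and $\epsilon$, such that for all $k\geq k_0$ $$\sup_{z\in X_\Gamma}\left|\frac{\mu^{\mathrm{vol}}_{\mathrm{ber}}(z)}{\mu^{\mathrm{vol}}_{\mathrm{hyp}}(z)}\right|\le C\,k^{4+\epsilon}.$$ -/

import Mathlib

open scoped TensorProduct ComplexConjugate

noncomputable section

namespace PicardBergman

/-! ### The ball and the group `SU((2,1), ℂ)` -/

/-- The open unit ball `𝔹² = {z : |z₁|² + |z₂|² < 1}` in `ℂ²`. -/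
def Ball : Set (Fin 2 → ℂ) := {z | ‖z 0‖ ^ 2 + ‖z 1‖ ^ 2 < 1}

/-- The Hermitian matrix `H = diag(1, 1, -1)`. -/
def hermH : Matrix (Fin 3) (Fin 3) ℂ := Matrix.diagonal ![1, 1, -1]

/-- `SU((2,1), ℂ) = {A ∈ SL(3, ℂ) : A* H A = H}`. -/
def SU21 : Subgroup (Matrix.SpecialLinearGroup (Fin 3) ℂ) where
  carrier := {A | A.1.conjTranspose * hermH * A.1 = hermH}
  one_mem' := by simp
  mul_mem' := by
    intro A B hA hB
    simp only [Set.mem_ofPred_eq] at hA hB ⊢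
    rw [Matrix.SpecialLinearGroup.coe_mul, Matrix.conjTranspose_mul]
    calc _ = B.1.conjTranspose * (A.1.conjTranspose * hermH * A.1) * B.1 := by
          simp only [Matrix.mul_assoc]
      _ = hermH := by rw [hA, hB]
  inv_mem' := by
    intro A hA
    simp only [Set.mem_ofPred_eq] at hA ⊢
    have h1 : A.1 * (A⁻¹).1 = 1 := by
      rw [← Matrix.SpecialLinearGroup.coe_mul, mul_inv_cancel]; rfl
    have h2 : (A⁻¹).1.conjTranspose * A.1.conjTranspose = 1 := by
      rw [← Matrix.conjTranspose_mul, h1, Matrix.conjTranspose_one]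
    calc _ = (A⁻¹).1.conjTranspose * (A.1.conjTranspose * hermH * A.1) * (A⁻¹).1 := by rw [hA]
      _ = ((A⁻¹).1.conjTranspose * A.1.conjTranspose) * hermH * (A.1 * (A⁻¹).1) := by
          simp only [Matrix.mul_assoc]
      _ = hermH := by rw [h1, h2]; simp

/-- The lift `z̃ = (z₁, z₂, 1)` of a point of `ℂ²`. -/
def lift (z : Fin 2 → ℂ) : Fin 3 → ℂ := ![z 0, z 1, 1]

/-- The fractional linear map `z ↦ (Az + B) / (Cz + D)` of a matrix in block form `(A B; C D)`. -/
def moebius (g : Matrix (Fin 3) (Fin 3) ℂ) (z : Fin 2 → ℂ) : Fin 2 → ℂ :=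
  ![(g.mulVec (lift z)) 0 / (g.mulVec (lift z)) 2, (g.mulVec (lift z)) 1 / (g.mulVec (lift z)) 2]

/-- The underlying matrix of an element of `SU((2,1), ℂ)`. -/
def mat (g : SU21) : Matrix (Fin 3) (Fin 3) ℂ := (g : Matrix.SpecialLinearGroup (Fin 3) ℂ)

lemma mat_mul (g h : SU21) : mat (g * h) = mat g * mat h := by
  simp [mat]

lemma mat_one : mat 1 = 1 := by
  simp [mat]

lemma mat_mem (g : SU21) : (mat g).conjTranspose * hermH * mat g = hermH := g.2

lemma form_preserved (g : SU21) (v : Fin 3 → ℂ) :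
    ‖((mat g).mulVec v) 0‖ ^ 2 + ‖((mat g).mulVec v) 1‖ ^ 2 - ‖((mat g).mulVec v) 2‖ ^ 2
      = ‖v 0‖ ^ 2 + ‖v 1‖ ^ 2 - ‖v 2‖ ^ 2 := by
  have key : ∀ u : Fin 3 → ℂ, dotProduct (star u) (hermH.mulVec u)
      = ((‖u 0‖ ^ 2 + ‖u 1‖ ^ 2 - ‖u 2‖ ^ 2 : ℝ) : ℂ) := by
    intro u
    simp only [hermH, dotProduct, Fin.sum_univ_three, Matrix.mulVec_diagonal, Pi.star_apply]
    push_cast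
    simp only [← Complex.conj_mul']
    simp
    ring
  have h : dotProduct (star ((mat g).mulVec v)) (hermH.mulVec ((mat g).mulVec v))
      = dotProduct (star v) (hermH.mulVec v) := by
    rw [Matrix.star_mulVec, ← Matrix.dotProduct_mulVec, Matrix.mulVec_mulVec, Matrix.mulVec_mulVec,
      mat_mem]
  rw [key, key] at h
  exact_mod_cast h

lemma denom_ne_zero (g : SU21) {z : Fin 2 → ℂ} (hz : z ∈ Ball) :
    ((mat g).mulVec (lift z)) 2 ≠ 0 := by
  intro h0
  have h := form_preserved g (lift z)
  have hz' : ‖z 0‖ ^ 2 + ‖z 1‖ ^ 2 < 1 := hz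
  have h2 : ‖lift z 0‖ ^ 2 + ‖lift z 1‖ ^ 2 - ‖lift z 2‖ ^ 2 = ‖z 0‖ ^ 2 + ‖z 1‖ ^ 2 - 1 := by
    simp [lift]
  rw [h2, h0, norm_zero] at h
  nlinarith [sq_nonneg ‖((mat g).mulVec (lift z)) 0‖, sq_nonneg ‖((mat g).mulVec (lift z)) 1‖]

lemma moebius_mem (g : SU21) {z : Fin 2 → ℂ} (hz : z ∈ Ball) : moebius (mat g) z ∈ Ball := by
  have h := form_preserved g (lift z)
  have hz' : ‖z 0‖ ^ 2 + ‖z 1‖ ^ 2 < 1 := hz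
  have hd : 0 < ‖((mat g).mulVec (lift z)) 2‖ ^ 2 :=
    pow_pos (norm_pos_iff.mpr (denom_ne_zero g hz)) 2
  have h2 : ‖lift z 0‖ ^ 2 + ‖lift z 1‖ ^ 2 - ‖lift z 2‖ ^ 2 = ‖z 0‖ ^ 2 + ‖z 1‖ ^ 2 - 1 := by
    simp [lift]
  rw [h2] at h
  change ‖moebius (mat g) z 0‖ ^ 2 + ‖moebius (mat g) z 1‖ ^ 2 < 1
  simp only [moebius, Matrix.cons_val_zero, Matrix.cons_val_one, norm_div, div_pow]
  rw [← add_div, div_lt_one hd]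
  linarith

lemma lift_moebius (g : SU21) {z : Fin 2 → ℂ} (hz : z ∈ Ball) :
    lift (moebius (mat g) z) = (((mat g).mulVec (lift z)) 2)⁻¹ • (mat g).mulVec (lift z) := by
  have hd := denom_ne_zero g hz
  ext i
  fin_cases i
  · simp [lift, moebius, div_eq_inv_mul]
  · simp [lift, moebius, div_eq_inv_mul]
  · change (1 : ℂ) = (((mat g).mulVec (lift z)) 2)⁻¹ * ((mat g).mulVec (lift z)) 2
    rw [inv_mul_cancel₀ hd]

/-- `SU((2,1), ℂ)` acts on the ball by fractional linear transformations. -/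
instance : MulAction SU21 Ball where
  smul g z := ⟨moebius (mat g) z.1, moebius_mem g z.2⟩
  one_smul z := by
    apply Subtype.ext
    change moebius (mat 1) z.1 = z.1
    rw [mat_one]
    ext i
    fin_cases i <;> simp [moebius, lift]
  mul_smul g h z := by
    apply Subtype.ext
    change moebius (mat (g * h)) z.1 = moebius (mat g) (moebius (mat h) z.1)
    have hd := inv_ne_zero (denom_ne_zero h z.2)
    unfold moebius
    have e := lift_moebius h z.2
    unfold moebius at e
    rw [e, mat_mul, Matrix.mulVec_smul, Matrix.mulVec_mulVec]
    simp only [Pi.smul_apply, smul_eq_mul, mul_div_mul_left _ _ hd]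

/-- The quotient surface `X_Γ = Γ \ 𝔹²`, with the quotient topology. -/
abbrev Surface (Γ : Subgroup SU21) : Type := Quotient (MulAction.orbitRel Γ Ball)

/-- `Γ` is a discrete, torsion-free subgroup of `SU((2,1), ℂ)` with compact quotient `Γ \ 𝔹²`. -/
structure IsPicardGroup (Γ : Subgroup SU21) : Prop where
  discrete : DiscreteTopology Γ
  torsionFree : ∀ g ∈ Γ, IsOfFinOrder g → g = 1
  cocompact : CompactSpace (Surface Γ)

/-! ### Sections of `Λ^{⊗ k}`, where `Λ` is the bundle of holomorphic `(2,0)`-forms -/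

/-- The fibre of `Λ`: complex-bilinear alternating forms on the tangent space `ℂ²`. -/
abbrev CanFiber : Type := (Fin 2 → ℂ) [⋀^Fin 2]→ₗ[ℂ] ℂ

/-- The fibre of `Λ^{⊗ k}`. -/
abbrev CanPow (k : ℕ) : Type := ⨂[ℂ]^k CanFiber

/-- The value of a `(2,0)`-form on the frame `(∂/∂z₁, ∂/∂z₂)`. -/
def frameEval : CanFiber →ₗ[ℂ] ℂ where
  toFun η := η ![Pi.single 0 1, Pi.single 1 1]
  map_add' _ _ := rfl
  map_smul' _ _ := rfl

/-- The coefficient `f` of `η = f (dz₁ ∧ dz₂)^{⊗ k}`. -/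
def coeff (k : ℕ) : CanPow k →ₗ[ℂ] ℂ :=
  PiTensorProduct.lift ((MultilinearMap.mkPiAlgebra ℂ (Fin k) ℂ).compLinearMap fun _ => frameEval)

/-- Pull-back of `(2,0)`-forms along a complex-linear map `L` of tangent spaces. -/
def pullForm (L : (Fin 2 → ℂ) →ₗ[ℂ] (Fin 2 → ℂ)) : CanFiber →ₗ[ℂ] CanFiber where
  toFun η := η.compLinearMap L
  map_add' _ _ := rfl
  map_smul' _ _ := rfl

/-- Pull-back of elements of the fibre of `Λ^{⊗ k}` along `L`. -/
def pullPow (k : ℕ) (L : (Fin 2 → ℂ) →ₗ[ℂ] (Fin 2 → ℂ)) : CanPow k →ₗ[ℂ] CanPow k :=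
  PiTensorProduct.map fun _ => pullForm L

/-- Extension by zero of a function on the ball to `ℂ²`. It only serves to differentiate at points
of the ball, which is open, so that the values outside the ball play no role. -/
def ext0 (f : Ball → ℂ) : (Fin 2 → ℂ) → ℂ := Function.extend Subtype.val f 0

lemma ext0_apply (f : Ball → ℂ) {z : Fin 2 → ℂ} (hz : z ∈ Ball) : ext0 f z = f ⟨z, hz⟩ :=
  Subtype.val_injective.extend_apply f 0 ⟨z, hz⟩

/-- `H⁰(X_Γ, Λ^{⊗ k})`. A global section of `Λ^{⊗ k}` over `X_Γ = Γ \ 𝔹²` is given by a holomorphic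
section `ω` of `Λ^{⊗ k}` over the ball with `γ^* ω = ω` for all `γ ∈ Γ`, where `(γ^* ω)(z)` is the
pull-back of `ω(γ z)` along the complex derivative of `γ` at `z`. -/
def globalSections (Γ : Subgroup SU21) (k : ℕ) : Submodule ℂ (Ball → CanPow k) where
  carrier := {ω | DifferentiableOn ℂ (ext0 fun z => coeff k (ω z)) Ball ∧
    ∀ γ : Γ, ∀ z : Ball,
      pullPow k (fderiv ℂ (moebius (mat γ)) z.1 : (Fin 2 → ℂ) →ₗ[ℂ] (Fin 2 → ℂ)) (ω (γ • z)) = ω z}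
  zero_mem' := by
    refine ⟨(differentiableOn_const (0 : ℂ)).congr fun z hz => ?_, fun γ z => ?_⟩
    · rw [ext0_apply _ hz]; simp
    · simp
  add_mem' := by
    rintro ω η ⟨h1, h2⟩ ⟨h3, h4⟩
    refine ⟨(h1.add h3).congr fun z hz => ?_, fun γ z => ?_⟩
    · simp [ext0_apply _ hz]
    · simp only [Pi.add_apply, map_add, h2, h4]
  smul_mem' := by
    rintro c ω ⟨h1, h2⟩
    refine ⟨(h1.const_smul c).congr fun z hz => ?_, fun γ z => ?_⟩
    · simp [ext0_apply _ hz]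
    · simp only [Pi.smul_apply, map_smul, h2]

/-! ### The metrics induced by the hyperbolic metric -/

/-- `1 - |z|²`. -/
def defect (z : Fin 2 → ℂ) : ℝ := 1 - (‖z 0‖ ^ 2 + ‖z 1‖ ^ 2)

/-- The volume measure of the hyperbolic metric on the ball: `(1 - |z|²)⁻³` times the
Lebesgue measure. -/
def hypMeasure : MeasureTheory.Measure Ball :=
  (MeasureTheory.Measure.comap Subtype.val MeasureTheory.volume).withDensity fun z : Ball =>
    ENNReal.ofReal ((defect z.1 ^ 3)⁻¹)

open Classical in
/-- A fixed fundamental domain of `Γ` (the integral below does not depend on the choice). -/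
def fundDomain (Γ : Subgroup SU21) : Set Ball :=
  if h : ∃ F : Set Ball, MeasureTheory.IsFundamentalDomain Γ F hypMeasure then h.choose else ∅

/-- The hermitian inner product on the fibre of `Λ^{⊗ k}` at `z` that is induced by the hyperbolic
metric: `|dz₁ ∧ dz₂|²_hyp = (1 - |z|²)³`. -/
def fiberInner (k : ℕ) (z : Fin 2 → ℂ) (η θ : CanPow k) : ℂ :=
  (defect z : ℂ) ^ (3 * k) * (coeff k η * conj (coeff k θ))

/-- The `L²` inner product `⟨ω, η⟩_hyp = ∫_{X_Γ} ⟨ω(z), η(z)⟩ dμ_hyp^vol(z)`. -/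
def hypInner (Γ : Subgroup SU21) (k : ℕ) (ω η : Ball → CanPow k) : ℂ :=
  ∫ z in fundDomain Γ, fiberInner k z.1 (ω z) (η z) ∂hypMeasure

/-- `ω₁, …, ω_d` is an orthonormal basis of `H⁰(X_Γ, Λ^{⊗ k})`. -/
structure IsOrthonormalBasis (Γ : Subgroup SU21) (k : ℕ) {d : ℕ} (ω : Fin d → Ball → CanPow k) :
    Prop where
  span_eq : Submodule.span ℂ (Set.range ω) = globalSections Γ k
  orthonormal : ∀ i j, hypInner Γ k (ω i) (ω j) = if i = j then 1 else 0

/-- The Bergman kernel `B(z, w) = ∑ ωⱼ(z) ⊗ conj ωⱼ(w)`, written in the frame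
`(dz₁ ∧ dz₂)^{⊗ k} ⊗ conj (dw₁ ∧ dw₂)^{⊗ k}`. -/
def bergmanKernel (k : ℕ) {d : ℕ} (ω : Fin d → Ball → CanPow k) (z w : Ball) : ℂ :=
  ∑ j, coeff k (ω j z) * conj (coeff k (ω j w))

/-- The pointwise norm `|B(z, z)|_hyp = (1 - |z|²)^{3k} |∑ⱼ fⱼ(z) conj fⱼ(z)|` on the diagonal, where
`ωⱼ = fⱼ (dz₁ ∧ dz₂)^{⊗ k}`. -/
def bergmanNorm (k : ℕ) {d : ℕ} (ω : Fin d → Ball → CanPow k) (z : Ball) : ℝ :=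
  defect z.1 ^ (3 * k) * ‖bergmanKernel k ω z z‖

/-! ### Differential forms and volume forms -/

/-- Complex-valued real-alternating `n`-forms at a point of `ℂ² = ℝ⁴`. -/
abbrev Form (n : ℕ) : Type := (Fin 2 → ℂ) [⋀^Fin n]→ₗ[ℝ] ℂ

/-- The wedge product of forms. -/
def wedge {m n : ℕ} (α : Form m) (β : Form n) : Form (m + n) :=
  ((LinearMap.mul' ℝ ℂ).compAlternatingMap (α.domCoprod β)).domDomCongr finSumFinEquiv

/-- The one-form `dz_i`. -/
def dz (i : Fin 2) : Form 1 :=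
  AlternatingMap.ofSubsingleton ℝ (Fin 2 → ℂ) ℂ 0 (LinearMap.proj i)

/-- The one-form `d\bar z_i`. -/
def dzbar (i : Fin 2) : Form 1 :=
  AlternatingMap.ofSubsingleton ℝ (Fin 2 → ℂ) ℂ 0 (Complex.conjLIE.toLinearMap ∘ₗ LinearMap.proj i)

/-- The Wirtinger derivative `∂φ/∂z_i = (∂φ/∂x_i - √-1 ∂φ/∂y_i) / 2`. -/
def wirt (i : Fin 2) (φ : (Fin 2 → ℂ) → ℂ) (z : Fin 2 → ℂ) : ℂ :=
  (fderiv ℝ φ z (Pi.single i 1) - Complex.I * fderiv ℝ φ z (Pi.single i Complex.I)) / 2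

/-- The Wirtinger derivative `∂φ/∂\bar z_i = (∂φ/∂x_i + √-1 ∂φ/∂y_i) / 2`. -/
def wirtBar (i : Fin 2) (φ : (Fin 2 → ℂ) → ℂ) (z : Fin 2 → ℂ) : ℂ :=
  (fderiv ℝ φ z (Pi.single i 1) + Complex.I * fderiv ℝ φ z (Pi.single i Complex.I)) / 2

/-- `∂\bar∂ φ = ∑ᵢⱼ ∂²φ/∂z_i∂\bar z_j dz_i ∧ d\bar z_j` at `z`. -/
def ddbar (φ : (Fin 2 → ℂ) → ℂ) (z : Fin 2 → ℂ) : Form 2 :=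
  ∑ i, ∑ j, wirt i (wirtBar j φ) z • wedge (dz i) (dzbar j)

/-- The volume form `(1/2!) μ ∧ μ` of a `(1,1)`-form `μ`. -/
def volForm (μ : Form 2) : Form 4 := (1 / 2 : ℂ) • wedge μ μ

/-- The hyperbolic metric `μ_hyp = -(i/2) ∂\bar∂ log(1 - |z|²)`. -/
def hypMetric (z : Ball) : Form 2 :=
  (-(Complex.I / 2)) • ddbar (fun w => ((Real.log (defect w) : ℝ) : ℂ)) z.1

/-- The Bergman metric `μ_ber = -(i/2π) ∂\bar∂ log |B(z, z)|_hyp`. -/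
def bergmanMetric (k : ℕ) {d : ℕ} (ω : Fin d → Ball → CanPow k) (z : Ball) : Form 2 :=
  (-(Complex.I / (2 * Real.pi))) •
    ddbar (ext0 fun w => ((Real.log (bergmanNorm k ω w) : ℝ) : ℂ)) z.1

end PicardBergman

end

/-
The Bergman kernel on the diagonal lies between two multiples of `k ^ 2`, and such bounds control
the complex Hessian of its logarithm.

Upper bound: on a hyperbolic cell of squared radius about `1 / k`, moved to the origin by the group,
the weight is bounded below, so the mean value inequality bounds the squared norm of a section at
the centre by a multiple of `k ^ 2` times its squared `L²` norm. Lower bound: the Poincaré series of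
the reproducing kernel of the ball at a point is, for large `k`, concentrated there, and its squared
`L²` norm is at most a multiple of `1 / k ^ 2` times its squared norm at that point.

Moving `z` to the origin by the group changes the Hessian only through the Jacobian, which cancels
in the quotient of the volume forms. At the origin the Hessian is a Fubini–Study form in the first
derivatives of the coefficients, minus `3 * k` times the identity; by Cauchy's estimate on a disc of
squared radius `1 / (2 * k)` its entries are `O(k)`, hence its determinant is `O(k ^ 2)`.
-/

noncomputable section

namespace PicardBergman

open MeasureTheory Topology

/-! ### The Hermitian form and the proximity of two points -/

section DiagHerm

variable {ι : Type*} [Fintype ι] (ε : ι → ℝ)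

/-- The Hermitian form `∑ ε_m x_m \bar{y_m}` with real coefficients `ε`, linear in its first
argument. It serves both as the form preserved by `SU((2,1), ℂ)` and as the sum of squares of a
finite family of sections. -/
def diagHerm (x y : ι → ℂ) : ℂ := ∑ m, (ε m : ℂ) * (x m * conj (y m))

lemma diagHerm_self (x : ι → ℂ) : diagHerm ε x x = ((∑ m, ε m * ‖x m‖ ^ 2 : ℝ) : ℂ) := by
  simp only [diagHerm, Complex.mul_conj', Complex.ofReal_sum, Complex.ofReal_mul,
    Complex.ofReal_pow]

lemma conj_diagHerm (x y : ι → ℂ) : conj (diagHerm ε x y) = diagHerm ε y x := by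
  simp only [diagHerm, map_sum, map_mul, Complex.conj_ofReal, Complex.conj_conj]
  exact Finset.sum_congr rfl fun m _ => by ring

lemma diagHerm_add_left (x y w : ι → ℂ) :
    diagHerm ε (x + y) w = diagHerm ε x w + diagHerm ε y w := by
  simp only [diagHerm, ← Finset.sum_add_distrib, Pi.add_apply]
  exact Finset.sum_congr rfl fun m _ => by ring

lemma diagHerm_smul_left (c : ℂ) (x w : ι → ℂ) : diagHerm ε (c • x) w = c * diagHerm ε x w := by
  simp only [diagHerm, Finset.mul_sum, Pi.smul_apply, smul_eq_mul]
  exact Finset.sum_congr rfl fun m _ => by ring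

lemma diagHerm_add_right (x y w : ι → ℂ) :
    diagHerm ε w (x + y) = diagHerm ε w x + diagHerm ε w y := by
  rw [← conj_diagHerm, diagHerm_add_left, map_add, conj_diagHerm, conj_diagHerm]

lemma diagHerm_smul_right (c : ℂ) (x w : ι → ℂ) :
    diagHerm ε w (c • x) = conj c * diagHerm ε w x := by
  rw [← conj_diagHerm, diagHerm_smul_left, map_mul, conj_diagHerm]

end DiagHerm

/-- The signs of the form `-H`, which is positive on the cone over the ball. -/
def hermSign : Fin 3 → ℝ := ![-1, -1, 1]

/-- The Hermitian form of signature `(1, 2)` on `ℂ³` given by `-H`; on lifts it polarizes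
`1 - |z|²`. -/
def herm : (Fin 3 → ℂ) → (Fin 3 → ℂ) → ℂ := diagHerm hermSign

lemma herm_apply (u v : Fin 3 → ℂ) :
    herm u v = u 2 * conj (v 2) - u 0 * conj (v 0) - u 1 * conj (v 1) := by
  simp only [herm, diagHerm, hermSign, Fin.sum_univ_three, Matrix.cons_val, Complex.ofReal_neg,
    Complex.ofReal_one]
  ring

lemma herm_mulVec (g : SU21) (u v : Fin 3 → ℂ) :
    herm ((mat g).mulVec u) ((mat g).mulVec v) = herm u v := by
  have herm_eq (u v : Fin 3 → ℂ) : herm u v = - dotProduct (star v) (hermH.mulVec u) := by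
    simp [herm_apply, hermH, dotProduct, Fin.sum_univ_three, Matrix.mulVec_diagonal]
    ring
  rw [herm_eq, herm_eq, Matrix.star_mulVec, ← Matrix.dotProduct_mulVec, Matrix.mulVec_mulVec,
    Matrix.mulVec_mulVec, mat_mem]

lemma herm_smul (a b : ℂ) (u v : Fin 3 → ℂ) : herm (a • u) (b • v) = a * conj b * herm u v := by
  rw [herm, diagHerm_smul_left, diagHerm_smul_right, mul_assoc]

lemma herm_lift_self (z : Fin 2 → ℂ) : herm (lift z) (lift z) = (defect z : ℂ) := by
  simp [herm_apply, lift, defect, Complex.mul_conj']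
  ring

lemma mem_ball_iff {z : Fin 2 → ℂ} : z ∈ Ball ↔ 0 < defect z := by
  rw [defect, sub_pos]
  rfl

lemma defect_pos (z : Ball) : 0 < defect z.1 := mem_ball_iff.1 z.2

lemma defect_le_one (z : Fin 2 → ℂ) : defect z ≤ 1 := sub_le_self _ (by positivity)

lemma defect_eq_one_iff {z : Fin 2 → ℂ} : defect z = 1 ↔ z = 0 := by
  rw [defect, sub_eq_self, add_eq_zero_iff_of_nonneg (sq_nonneg _) (sq_nonneg _), funext_iff,
    Fin.forall_fin_two]
  simp

lemma coe_smul (g : SU21) (z : Ball) : (g • z).1 = moebius (mat g) z.1 := rfl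

/-- The automorphy factor `Cz + D` of `g` at `z`. -/
def autFactor (g : SU21) (z : Fin 2 → ℂ) : ℂ := ((mat g).mulVec (lift z)) 2

lemma autFactor_ne_zero (g : SU21) (z : Ball) : autFactor g z.1 ≠ 0 := denom_ne_zero g z.2

lemma mulVec_lift (g : SU21) (z : Ball) :
    (mat g).mulVec (lift z.1) = autFactor g z.1 • lift (g • z).1 := by
  rw [coe_smul, lift_moebius g z.2, ← autFactor, smul_inv_smul₀ (autFactor_ne_zero g z)]

lemma autFactor_mul (g h : SU21) (z : Ball) :
    autFactor (g * h) z.1 = autFactor g (h • z).1 * autFactor h z.1 := by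
  rw [autFactor, mat_mul, ← Matrix.mulVec_mulVec, mulVec_lift h z, Matrix.mulVec_smul,
    Pi.smul_apply, smul_eq_mul, mul_comm, ← autFactor]

lemma herm_smul_smul (g : SU21) (z w : Ball) :
    autFactor g z.1 * conj (autFactor g w.1) * herm (lift (g • z).1) (lift (g • w).1)
      = herm (lift z.1) (lift w.1) := by
  rw [← herm_smul, ← mulVec_lift, ← mulVec_lift, herm_mulVec]

lemma defect_smul (g : SU21) (z : Ball) :
    ‖autFactor g z.1‖ ^ 2 * defect (g • z).1 = defect z.1 := by
  have h := herm_smul_smul g z z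
  rw [herm_lift_self, herm_lift_self, Complex.mul_conj'] at h
  exact_mod_cast h

lemma sqrt_defect_smul (g : SU21) (z : Ball) :
    ‖autFactor g z.1‖ * √(defect (g • z).1) = √(defect z.1) := by
  rw [← defect_smul g z, Real.sqrt_mul (sq_nonneg _), Real.sqrt_sq (norm_nonneg _)]

/-- The centre of the ball. -/
def origin : Ball := ⟨0, by simp [Ball]⟩

lemma lift_origin : lift origin.1 = ![0, 0, 1] := by simp [lift, origin]

lemma defect_origin : defect origin.1 = 1 := defect_eq_one_iff.2 rfl

lemma herm_lift_origin (z : Fin 2 → ℂ) : herm (lift z) (lift origin.1) = 1 := by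
  simp [herm_apply, lift, origin]

/-- The block matrix `(1 + t w w^*, u w; u w^*, u)`. With `u = (1 - |w|²)^{-1/2}` and
`t = u² / (1 + u)` it is the boost in `SU((2,1), ℂ)` that carries the origin to `w`. -/
def boost (u t : ℝ) (w : Fin 2 → ℂ) : Matrix (Fin 3) (Fin 3) ℂ :=
  !![1 + t * (w 0 * conj (w 0)), t * (w 0 * conj (w 1)), u * w 0;
     t * (w 1 * conj (w 0)), 1 + t * (w 1 * conj (w 1)), u * w 1;
     u * conj (w 0), u * conj (w 1), u]

section Boost

variable {u t : ℝ} {w : Fin 2 → ℂ}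

lemma ofReal_defect (w : Fin 2 → ℂ) :
    (defect w : ℂ) = 1 - (w 0 * conj (w 0) + w 1 * conj (w 1)) := by
  simp only [defect, Complex.mul_conj', Complex.ofReal_sub, Complex.ofReal_add, Complex.ofReal_pow,
    Complex.ofReal_one]

lemma det_boost (hu : (u : ℂ) ^ 2 * defect w = 1) (ht : (t : ℂ) * (1 - defect w) = u - 1) :
    (boost u t w).det = 1 := by
  rw [ofReal_defect] at hu ht
  rw [Matrix.det_fin_three]
  simp only [boost, Matrix.of_apply, Matrix.cons_val]
  linear_combination (u : ℂ) * ht + hu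

lemma conjTranspose_boost_mul (hu : (u : ℂ) ^ 2 * defect w = 1)
    (ht : (t : ℂ) * (1 - defect w) = u - 1) (htu : (t : ℂ) * (1 + u) = u ^ 2) :
    (boost u t w).conjTranspose * hermH * boost u t w = hermH := by
  rw [ofReal_defect] at hu ht
  ext i j
  fin_cases i <;> fin_cases j <;>
    simp [boost, hermH, Matrix.mul_apply, Fin.sum_univ_three]
  · linear_combination (w 0 * conj (w 0)) * (t * ht + htu)
  · linear_combination (w 0 * conj (w 1)) * (t * ht + htu)
  · linear_combination w 0 * u * ht
  · linear_combination (w 1 * conj (w 0)) * (t * ht + htu)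
  · linear_combination (w 1 * conj (w 1)) * (t * ht + htu)
  · linear_combination w 1 * u * ht
  · linear_combination conj (w 0) * u * ht
  · linear_combination conj (w 1) * u * ht
  · linear_combination -hu

lemma moebius_boost_origin (hu : u ≠ 0) : moebius (boost u t w) origin.1 = w := by
  have hu' : (u : ℂ) ≠ 0 := Complex.ofReal_ne_zero.2 hu
  rw [moebius, lift_origin]
  ext i
  fin_cases i <;> simp [boost, Matrix.mulVec, dotProduct, Fin.sum_univ_three, hu']

end Boost

lemma exists_boost_coeffs {s : ℝ} (hs : 0 < s) :
    ∃ u t : ℝ, u ≠ 0 ∧ u ^ 2 * s = 1 ∧ t * (1 - s) = u - 1 ∧ t * (1 + u) = u ^ 2 := by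
  have hu : 0 < (√s)⁻¹ := by positivity
  have hus : (√s)⁻¹ ^ 2 * s = 1 := by rw [inv_pow, Real.sq_sqrt hs.le, inv_mul_cancel₀ hs.ne']
  refine ⟨(√s)⁻¹, (√s)⁻¹ ^ 2 / (1 + (√s)⁻¹), hu.ne', hus, ?_, div_mul_cancel₀ _ (by positivity)⟩
  rw [div_mul_eq_mul_div, div_eq_iff (by positivity)]
  linear_combination -hus

lemma exists_smul_origin (w : Ball) : ∃ g : SU21, g • origin = w := by
  obtain ⟨u, t, hu0, hu, ht, htu⟩ := exists_boost_coeffs (defect_pos w)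
  have hu' : (u : ℂ) ^ 2 * defect w.1 = 1 := by exact_mod_cast hu
  have ht' : (t : ℂ) * (1 - defect w.1) = u - 1 := by exact_mod_cast ht
  have htu' : (t : ℂ) * (1 + u) = u ^ 2 := by exact_mod_cast htu
  exact ⟨⟨⟨boost u t w.1, det_boost hu' ht'⟩, conjTranspose_boost_mul hu' ht' htu'⟩,
    Subtype.ext (moebius_boost_origin hu0)⟩

lemma exists_smul_eq (z w : Ball) : ∃ g : SU21, g • z = w := by
  obtain ⟨g, hg⟩ := exists_smul_origin z
  obtain ⟨h, hh⟩ := exists_smul_origin w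
  exact ⟨h * g⁻¹, by rw [mul_smul, ← hg, inv_smul_smul, hh]⟩

/-- The invariant `1 / cosh d(z, w)` of a pair of points of the ball, where `d` is the hyperbolic
distance. It replaces the distance throughout. -/
def prox (z w : Ball) : ℝ := √(defect z.1) * √(defect w.1) / ‖herm (lift z.1) (lift w.1)‖

lemma prox_comm (z w : Ball) : prox z w = prox w z := by
  rw [prox, prox, mul_comm, herm, ← conj_diagHerm, Complex.norm_conj]

@[simp] lemma prox_smul (g : SU21) (z w : Ball) : prox (g • z) (g • w) = prox z w := by
  have hz := norm_ne_zero_iff.2 (autFactor_ne_zero g z)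
  have hw := norm_ne_zero_iff.2 (autFactor_ne_zero g w)
  rw [prox, prox, ← herm_smul_smul g z w, ← sqrt_defect_smul g z, ← sqrt_defect_smul g w,
    mul_mul_mul_comm, norm_mul, norm_mul, Complex.norm_conj,
    mul_div_mul_left _ _ (mul_ne_zero hz hw)]

lemma prox_origin (z : Ball) : prox z origin = √(defect z.1) := by
  rw [prox, herm_lift_origin, defect_origin, Real.sqrt_one, norm_one, mul_one, div_one]

lemma exists_prox_eq_sqrt_defect (w : Ball) :
    ∃ g : SU21, g • w = origin ∧ ∀ z, prox z w = √(defect (g • z).1) := by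
  obtain ⟨g, hg⟩ := exists_smul_eq w origin
  exact ⟨g, hg, fun z => by rw [← prox_smul g, hg, prox_origin]⟩

lemma prox_pos (z w : Ball) : 0 < prox z w := by
  obtain ⟨g, -, hg⟩ := exists_prox_eq_sqrt_defect w
  exact hg z ▸ Real.sqrt_pos.2 (defect_pos _)

lemma prox_le_one (z w : Ball) : prox z w ≤ 1 := by
  obtain ⟨g, -, hg⟩ := exists_prox_eq_sqrt_defect w
  exact hg z ▸ Real.sqrt_le_one.2 (defect_le_one _)

lemma prox_eq_one_iff {z w : Ball} : prox z w = 1 ↔ z = w := by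
  obtain ⟨g, hgw, hg⟩ := exists_prox_eq_sqrt_defect w
  rw [hg, Real.sqrt_eq_one, defect_eq_one_iff, ← smul_left_cancel_iff g (x := z), hgw,
    Subtype.ext_iff]
  rfl

@[simp] lemma prox_self (z : Ball) : prox z z = 1 := prox_eq_one_iff.2 rfl

lemma herm_lift_ne_zero (z w : Ball) : herm (lift z.1) (lift w.1) ≠ 0 := fun h =>
  (prox_pos z w).ne' (by rw [prox, h, norm_zero, div_zero])

lemma norm_one_sub_herm_lift_sq_le (z w : Fin 2 → ℂ) :
    ‖1 - herm (lift z) (lift w)‖ ^ 2 ≤ (1 - defect z) * (1 - defect w) := by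
  have h_eq : 1 - herm (lift z) (lift w) = z 0 * conj (w 0) + z 1 * conj (w 1) := by
    simp [herm_apply, lift]
    ring
  have h_norm : ‖1 - herm (lift z) (lift w)‖ ≤ ‖z 0‖ * ‖w 0‖ + ‖z 1‖ * ‖w 1‖ := by
    rw [h_eq]
    exact (norm_add_le _ _).trans (by simp)
  calc ‖1 - herm (lift z) (lift w)‖ ^ 2 ≤ (‖z 0‖ * ‖w 0‖ + ‖z 1‖ * ‖w 1‖) ^ 2 := by gcongr
    _ ≤ (1 - defect z) * (1 - defect w) := by
      unfold defect
      nlinarith [sq_nonneg (‖z 0‖ * ‖w 1‖ - ‖z 1‖ * ‖w 0‖)]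

lemma norm_herm_lift_le {z w : Fin 2 → ℂ} {δ : ℝ} (hz : 1 - δ ≤ defect z)
    (hw : 1 - δ ≤ defect w) : ‖herm (lift z) (lift w)‖ ≤ 1 + δ := by
  have hδ : 0 ≤ δ := by linarith [defect_le_one z]
  have h_sub : ‖1 - herm (lift z) (lift w)‖ ≤ δ := by
    refine abs_le_of_sq_le_sq' ((norm_one_sub_herm_lift_sq_le z w).trans ?_) hδ |>.2
    nlinarith [defect_le_one z, defect_le_one w]
  calc ‖herm (lift z) (lift w)‖ = ‖1 - (1 - herm (lift z) (lift w))‖ := by rw [sub_sub_cancel]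
    _ ≤ ‖(1 : ℂ)‖ + ‖1 - herm (lift z) (lift w)‖ := norm_sub_le _ _
    _ ≤ 1 + δ := by rw [norm_one]; gcongr

-- A Harnack inequality.
lemma prox_mul_prox_le (z w ζ : Ball) : prox ζ z * prox z w ≤ 2 * prox ζ w := by
  obtain ⟨g, -, hg⟩ := exists_prox_eq_sqrt_defect z
  have h_herm : ‖herm (lift (g • ζ).1) (lift (g • w).1)‖ ≤ 1 + 1 :=
    norm_herm_lift_le (by linarith [defect_pos (g • ζ)]) (by linarith [defect_pos (g • w)])
  rw [prox_comm z w, hg, hg, ← prox_smul g ζ w, prox, mul_div_assoc',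
    le_div_iff₀ (norm_pos_iff.2 (herm_lift_ne_zero _ _)), mul_comm]
  gcongr
  linarith

/- A substitute for the triangle inequality. -/
lemma one_sub_le_one_add_mul_prox {δ : ℝ} (hδ : δ ≤ 1) {z w ζ : Ball} (hz : 1 - δ ≤ prox ζ z ^ 2)
    (hw : 1 - δ ≤ prox ζ w ^ 2) : 1 - δ ≤ (1 + δ) * prox z w := by
  obtain ⟨g, -, hg⟩ := exists_prox_eq_sqrt_defect ζ
  rw [prox_comm, hg, Real.sq_sqrt (defect_pos _).le] at hz hw
  have h_sqrt : √(1 - δ) * √(1 - δ) = 1 - δ := Real.mul_self_sqrt (by linarith)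
  rw [← prox_smul g z w, prox, mul_div_assoc',
    le_div_iff₀ (norm_pos_iff.2 (herm_lift_ne_zero _ _)), mul_comm, ← h_sqrt]
  exact mul_le_mul (norm_herm_lift_le hz hw) (by gcongr) (by positivity)
    (by linarith [defect_le_one (g • z).1])

/-! ### The complex derivative of the action -/

lemma det_mat (g : SU21) : (mat g).det = 1 := (g : Matrix.SpecialLinearGroup (Fin 3) ℂ).2

/-- The linear part of the `i`-th homogeneous coordinate of `g • z`, as an affine function of
`z`. -/
def rowForm (g : SU21) (i : Fin 3) : (Fin 2 → ℂ) →L[ℂ] ℂ :=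
  mat g i 0 • ContinuousLinearMap.proj 0 + mat g i 1 • ContinuousLinearMap.proj 1

lemma rowForm_apply (g : SU21) (i : Fin 3) (v : Fin 2 → ℂ) :
    rowForm g i v = mat g i 0 * v 0 + mat g i 1 * v 1 := rfl

lemma mulVec_lift_apply (g : SU21) (i : Fin 3) (z : Fin 2 → ℂ) :
    ((mat g).mulVec (lift z)) i = rowForm g i z + mat g i 2 := by
  simp [Matrix.mulVec, dotProduct, Fin.sum_univ_three, lift, rowForm_apply]

lemma hasFDerivAt_mulVec_lift (g : SU21) (i : Fin 3) (z : Fin 2 → ℂ) :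
    HasFDerivAt (fun z => ((mat g).mulVec (lift z)) i) (rowForm g i) z := by
  simp_rw [mulVec_lift_apply]
  exact (rowForm g i).hasFDerivAt.add_const _

lemma hasFDerivAt_autFactor (g : SU21) (z : Fin 2 → ℂ) :
    HasFDerivAt (autFactor g) (rowForm g 2) z :=
  hasFDerivAt_mulVec_lift g 2 z

/-- The derivative at `z` of the quotient `i`-th homogeneous coordinate of `g • z` by the last
one. -/
def coordDeriv (g : SU21) (z : Fin 2 → ℂ) (i : Fin 3) : (Fin 2 → ℂ) →L[ℂ] ℂ :=
  (autFactor g z)⁻¹ • rowForm g i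
    - (((mat g).mulVec (lift z)) i * (autFactor g z ^ 2)⁻¹) • rowForm g 2

/-- The complex derivative of `moebius (mat g)` at `z`. -/
def moebiusDeriv (g : SU21) (z : Fin 2 → ℂ) : (Fin 2 → ℂ) →L[ℂ] (Fin 2 → ℂ) :=
  ContinuousLinearMap.pi ![coordDeriv g z 0, coordDeriv g z 1]

lemma hasFDerivAt_div_autFactor (g : SU21) (i : Fin 3) {z : Fin 2 → ℂ} (hz : z ∈ Ball) :
    HasFDerivAt (fun z => ((mat g).mulVec (lift z)) i / autFactor g z) (coordDeriv g z i) z := by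
  have h := (hasFDerivAt_mulVec_lift g i z).mul
    ((hasDerivAt_inv (autFactor_ne_zero g ⟨z, hz⟩)).comp_hasFDerivAt z (hasFDerivAt_autFactor g z))
  refine (h.congr_of_eventuallyEq (.of_forall fun w => div_eq_mul_inv _ _)).congr_fderiv ?_
  ext v
  simp [coordDeriv]
  ring

lemma hasFDerivAt_moebius (g : SU21) {z : Fin 2 → ℂ} (hz : z ∈ Ball) :
    HasFDerivAt (moebius (mat g)) (moebiusDeriv g z) z := by
  refine hasFDerivAt_pi'.2 fun i => ?_
  fin_cases i
  · exact hasFDerivAt_div_autFactor g 0 hz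
  · exact hasFDerivAt_div_autFactor g 1 hz

lemma det_moebiusDeriv (g : SU21) {z : Fin 2 → ℂ} (hz : z ∈ Ball) :
    LinearMap.det (moebiusDeriv g z : (Fin 2 → ℂ) →ₗ[ℂ] (Fin 2 → ℂ)) = (autFactor g z ^ 3)⁻¹ := by
  have h_ne : autFactor g z ≠ 0 := autFactor_ne_zero g ⟨z, hz⟩
  have h_aut : mat g 2 2 = autFactor g z - (mat g 2 0 * z 0 + mat g 2 1 * z 1) := by
    rw [autFactor, mulVec_lift_apply, rowForm_apply, add_sub_cancel_left]
  have h_det := det_mat g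
  rw [Matrix.det_fin_three, h_aut] at h_det
  rw [← LinearMap.det_toMatrix', Matrix.det_fin_two]
  simp [LinearMap.toMatrix'_apply, moebiusDeriv, coordDeriv, rowForm_apply, mulVec_lift_apply]
  field_simp
  linear_combination autFactor g z * h_det

/-! ### The fibres of the powers of the canonical bundle -/

/-- The standard generator `dz₁ ∧ dz₂` of the fibre of the canonical bundle. -/
def stdForm : CanFiber := (Pi.basisFun ℂ (Fin 2)).det

lemma coe_basisFun : ⇑(Pi.basisFun ℂ (Fin 2)) = ![Pi.single 0 1, Pi.single 1 1] := by
  ext i j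
  fin_cases i <;> simp [Pi.basisFun_apply]

lemma frameEval_apply (η : CanFiber) : frameEval η = η (Pi.basisFun ℂ (Fin 2)) := by
  rw [coe_basisFun]
  rfl

lemma frameEval_stdForm : frameEval stdForm = 1 := by
  rw [frameEval_apply, stdForm, Module.Basis.det_self]

lemma eq_frameEval_smul (η : CanFiber) : η = frameEval η • stdForm := by
  rw [frameEval_apply]
  exact AlternatingMap.eq_smul_basis_det (Pi.basisFun ℂ (Fin 2)) η

lemma pullForm_eq (L : (Fin 2 → ℂ) →ₗ[ℂ] (Fin 2 → ℂ)) (η : CanFiber) :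
    pullForm L η = LinearMap.det L • η := by
  have h_std : pullForm L stdForm = LinearMap.det L • stdForm :=
    AlternatingMap.ext fun v => (Pi.basisFun ℂ (Fin 2)).det_comp L v
  rw [eq_frameEval_smul η, map_smul, h_std, smul_comm]

lemma pullPow_tprod (k : ℕ) (L : (Fin 2 → ℂ) →ₗ[ℂ] (Fin 2 → ℂ)) (f : Fin k → CanFiber) :
    pullPow k L (PiTensorProduct.tprod ℂ f)
      = LinearMap.det L ^ k • PiTensorProduct.tprod ℂ f := by
  have h_smul := (PiTensorProduct.tprod ℂ (s := fun _ : Fin k => CanFiber)).map_smul_univ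
    (fun _ => LinearMap.det L) f
  rw [Finset.prod_const, Finset.card_univ, Fintype.card_fin] at h_smul
  simp only [← h_smul, ← pullForm_eq]
  exact PiTensorProduct.map_tprod _ _

lemma pullPow_eq (k : ℕ) (L : (Fin 2 → ℂ) →ₗ[ℂ] (Fin 2 → ℂ)) (η : CanPow k) :
    pullPow k L η = LinearMap.det L ^ k • η := by
  have h : pullPow k L = LinearMap.det L ^ k • LinearMap.id :=
    PiTensorProduct.ext (MultilinearMap.ext fun f => pullPow_tprod k L f)
  rw [h]
  rfl

/-- The generator `(dz₁ ∧ dz₂)^{⊗ k}` of the fibre of `Λ^{⊗ k}`. -/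
def stdPow (k : ℕ) : CanPow k := PiTensorProduct.tprod ℂ fun _ => stdForm

lemma coeff_stdPow (k : ℕ) : coeff k (stdPow k) = 1 := by
  simp [coeff, stdPow, frameEval_stdForm]

lemma eq_coeff_smul (k : ℕ) (η : CanPow k) : η = coeff k η • stdPow k := by
  induction η using PiTensorProduct.induction_on with
  | smul_tprod r f =>
    have h_f : f = fun i => frameEval (f i) • stdForm := funext fun i => eq_frameEval_smul (f i)
    rw [map_smul, smul_assoc]
    congr 1
    conv_lhs => rw [h_f]
    rw [MultilinearMap.map_smul_univ]
    simp [coeff, stdPow]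
  | add x y hx hy => rw [map_add, add_smul, ← hx, ← hy]

lemma coeff_injective (k : ℕ) : Function.Injective (coeff k) := fun η θ h => by
  rw [eq_coeff_smul k η, eq_coeff_smul k θ, h]

/-- The coefficient function of a section of `Λ^{⊗ k}` over the ball. -/
def coefFun (k : ℕ) (ω : Ball → CanPow k) (z : Ball) : ℂ := coeff k (ω z)

lemma mem_globalSections {Γ : Subgroup SU21} {k : ℕ} {ω : Ball → CanPow k} :
    ω ∈ globalSections Γ k ↔ DifferentiableOn ℂ (ext0 (coefFun k ω)) Ball ∧
      ∀ γ : Γ, ∀ z : Ball, coefFun k ω (γ • z) = autFactor γ z.1 ^ (3 * k) * coefFun k ω z := by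
  refine and_congr Iff.rfl (forall_congr' fun γ => forall_congr' fun z => ?_)
  rw [pullPow_eq, (hasFDerivAt_moebius γ z.2).fderiv, det_moebiusDeriv γ z.2,
    ← (coeff_injective k).eq_iff, map_smul, smul_eq_mul, inv_pow, ← pow_mul,
    inv_mul_eq_iff_eq_mul₀ (pow_ne_zero _ (autFactor_ne_zero γ.1 z))]
  rfl

/-! ### Continuity of the action and invariance of the hyperbolic measure -/

lemma isOpen_ball : IsOpen Ball :=
  isOpen_lt (f := fun z : Fin 2 → ℂ => ‖z 0‖ ^ 2 + ‖z 1‖ ^ 2) (by fun_prop) continuous_const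

lemma measurableSet_ball : MeasurableSet Ball := isOpen_ball.measurableSet

@[fun_prop]
lemma continuous_defect : Continuous defect := by
  unfold defect
  fun_prop

@[fun_prop]
lemma continuous_lift : Continuous lift := by
  refine continuous_pi fun i => ?_
  fin_cases i
  · exact continuous_apply 0
  · exact continuous_apply 1
  · exact continuous_const

lemma continuous_herm {X : Type*} [TopologicalSpace X] {f g : X → Fin 3 → ℂ} (hf : Continuous f)
    (hg : Continuous g) : Continuous fun x => herm (f x) (g x) := by
  unfold herm diagHerm
  fun_prop

lemma continuous_prox {X : Type*} [TopologicalSpace X] {f g : X → Ball} (hf : Continuous f)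
    (hg : Continuous g) : Continuous fun x => prox (f x) (g x) := by
  have h_herm : Continuous fun x => herm (lift (f x).1) (lift (g x).1) :=
    continuous_herm (by fun_prop) (by fun_prop)
  exact Continuous.div (by fun_prop) h_herm.norm fun x => norm_ne_zero_iff.2 (herm_lift_ne_zero _ _)

instance : ContinuousConstSMul SU21 Ball where
  continuous_const_smul g := by
    rw [Topology.IsInducing.subtypeVal.continuous_iff, continuous_iff_continuousAt]
    intro z
    exact (hasFDerivAt_moebius g z.2).continuousAt.comp continuous_subtype_val.continuousAt

instance (Γ : Subgroup SU21) : ContinuousConstSMul Γ Ball where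
  continuous_const_smul g := continuous_const_smul (g : SU21)

instance : MeasurableConstSMul SU21 Ball where
  measurable_const_smul g := (continuous_const_smul g).measurable

lemma hypMeasure_apply {s : Set Ball} (hs : MeasurableSet s) :
    hypMeasure s = ∫⁻ z in Subtype.val '' s, ENNReal.ofReal ((defect z ^ 3)⁻¹) := by
  rw [hypMeasure, withDensity_apply _ hs,
    (MeasurableEmbedding.subtype_coe measurableSet_ball).restrict_comap,
    lintegral_subtype_comap measurableSet_ball (fun z => ENNReal.ofReal ((defect z ^ 3)⁻¹)),
    Measure.restrict_restrict measurableSet_ball,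
    Set.inter_eq_self_of_subset_right (Subtype.coe_image_subset _ _)]

lemma lintegral_hypMeasure (f : (Fin 2 → ℂ) → ENNReal) :
    ∫⁻ z : Ball, f z.1 ∂hypMeasure = ∫⁻ z in Ball, ENNReal.ofReal ((defect z ^ 3)⁻¹) * f z := by
  rw [hypMeasure, lintegral_withDensity_eq_lintegral_mul_non_measurable _ (by fun_prop)
    (by filter_upwards with z using ENNReal.ofReal_lt_top)]
  exact lintegral_subtype_comap measurableSet_ball
    (fun z => ENNReal.ofReal ((defect z ^ 3)⁻¹) * f z)

lemma abs_det_restrictScalars {E : Type*} [NormedAddCommGroup E] [NormedSpace ℂ E]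
    [NormedSpace ℝ E] [IsScalarTower ℝ ℂ E] (L : E →L[ℂ] E) :
    |(L.restrictScalars ℝ).det| = ‖LinearMap.det (L : E →ₗ[ℂ] E)‖ ^ 2 := by
  have h_coe : ((L.restrictScalars ℝ : E →L[ℝ] E) : E →ₗ[ℝ] E)
    = (L : E →ₗ[ℂ] E).restrictScalars ℝ := rfl
  rw [ContinuousLinearMap.det, h_coe, LinearMap.det_restrictScalars, Algebra.norm_complex_apply,
    Complex.normSq_eq_norm_sq, abs_of_nonneg (by positivity)]

lemma abs_det_moebiusDeriv_mul (g : SU21) (z : Ball) :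
    |((moebiusDeriv g z.1).restrictScalars ℝ).det| * (defect (g • z).1 ^ 3)⁻¹
      = (defect z.1 ^ 3)⁻¹ := by
  rw [abs_det_restrictScalars, det_moebiusDeriv g z.2, ← defect_smul g z, norm_inv, norm_pow,
    mul_pow, mul_inv]
  ring

lemma hypMeasure_image_smul (g : SU21) {s : Set Ball} (hs : MeasurableSet s) :
    hypMeasure ((g • ·) '' s) = hypMeasure s := by
  have h_image : Subtype.val '' ((g • ·) '' s) = moebius (mat g) '' (Subtype.val '' s) := by
    simp_rw [Set.image_image, coe_smul]
  have hs_val : MeasurableSet (Subtype.val '' s) :=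
    (MeasurableEmbedding.subtype_coe measurableSet_ball).measurableSet_image.2 hs
  have hs_image : MeasurableSet ((g • ·) '' s) :=
    (Homeomorph.smul g : Ball ≃ₜ Ball).measurableEmbedding.measurableSet_image.2 hs
  rw [hypMeasure_apply hs, hypMeasure_apply hs_image, h_image,
    lintegral_image_eq_lintegral_abs_det_fderiv_mul
      (f' := fun z => (moebiusDeriv g z).restrictScalars ℝ) _ hs_val]
  · refine setLIntegral_congr_fun hs_val ?_
    rintro _ ⟨z, -, rfl⟩
    simp only
    rw [← ENNReal.ofReal_mul (abs_nonneg _), ← coe_smul, abs_det_moebiusDeriv_mul]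
  · rintro _ ⟨z, -, rfl⟩
    exact ((hasFDerivAt_moebius g z.2).restrictScalars ℝ).hasFDerivWithinAt
  · rintro _ ⟨z, -, rfl⟩ _ ⟨w, -, rfl⟩ h
    rw [← coe_smul, ← coe_smul] at h
    exact congrArg Subtype.val (smul_left_cancel g (Subtype.ext h))

instance : SMulInvariantMeasure SU21 Ball hypMeasure where
  measure_preimage_smul g s hs := by
    rw [Set.preimage_smul]
    exact hypMeasure_image_smul g⁻¹ hs

lemma lintegral_smul (g : SU21) (f : Ball → ENNReal) :
    ∫⁻ z, f (g • z) ∂hypMeasure = ∫⁻ z, f z ∂hypMeasure :=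
  (measurePreserving_smul g hypMeasure).lintegral_comp_emb
    (Homeomorph.smul g : Ball ≃ₜ Ball).measurableEmbedding f

/-! ### Discreteness, cells and fundamental domains -/

lemma mat_mul_adjoint (g : SU21) : mat g * (hermH * (mat g).conjTranspose * hermH) = 1 := by
  have h_sq : hermH * hermH = 1 := by
    ext i j
    fin_cases i <;> fin_cases j <;> simp [hermH]
  rw [mul_eq_one_comm, Matrix.mul_assoc, Matrix.mul_assoc, ← Matrix.mul_assoc _ hermH,
    mat_mem, h_sq]

lemma norm_sq_last_row (g : SU21) : ‖mat g 2 0‖ ^ 2 + ‖mat g 2 1‖ ^ 2 = ‖mat g 2 2‖ ^ 2 - 1 := by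
  have h : (-‖mat g 2 0‖ ^ 2 + -‖mat g 2 1‖ ^ 2 + ‖mat g 2 2‖ ^ 2 : ℂ) = 1 := by
    simpa [Matrix.mul_apply, Fin.sum_univ_three, hermH, Complex.mul_conj'] using
      congrFun (congrFun (mat_mul_adjoint g) 2) 2
  have h_real : -‖mat g 2 0‖ ^ 2 + -‖mat g 2 1‖ ^ 2 + ‖mat g 2 2‖ ^ 2 = 1 := by exact_mod_cast h
  linarith

lemma norm_sq_col (g : SU21) (j : Fin 3) :
    ‖mat g 0 j‖ ^ 2 + ‖mat g 1 j‖ ^ 2 = ‖mat g 2 j‖ ^ 2 - hermSign j := by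
  have h := form_preserved g (Pi.single j 1)
  simp only [Matrix.mulVec_single_one, Matrix.col_apply] at h
  have h_sign : ‖(Pi.single j 1 : Fin 3 → ℂ) 0‖ ^ 2 + ‖(Pi.single j 1 : Fin 3 → ℂ) 1‖ ^ 2
      - ‖(Pi.single j 1 : Fin 3 → ℂ) 2‖ ^ 2 = -hermSign j := by
    fin_cases j <;> simp [hermSign]
  linarith

lemma norm_entry_le (g : SU21) (i j : Fin 3) : ‖mat g i j‖ ≤ ‖mat g 2 2‖ := by
  have h_row := norm_sq_last_row g
  have h_last : ‖mat g 2 j‖ ^ 2 ≤ ‖mat g 2 2‖ ^ 2 ∧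
      ‖mat g 2 j‖ ^ 2 - hermSign j ≤ ‖mat g 2 2‖ ^ 2 := by
    fin_cases j <;> simp only [hermSign, Fin.mk_zero, Fin.mk_one, Fin.reduceFinMk, Matrix.cons_val]
      <;> constructor <;> linarith [sq_nonneg ‖mat g 2 0‖, sq_nonneg ‖mat g 2 1‖]
  have h_col := norm_sq_col g j
  refine (sq_le_sq₀ (norm_nonneg _) (norm_nonneg _)).1 ?_
  match i with
  | 0 => exact le_trans (by linarith [sq_nonneg ‖mat g 1 j‖]) h_last.2
  | 1 => exact le_trans (by linarith [sq_nonneg ‖mat g 0 j‖]) h_last.2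
  | 2 => exact h_last.1

lemma isEmbedding_mat : IsEmbedding mat := IsEmbedding.subtypeVal.comp IsEmbedding.subtypeVal

lemma isClosedEmbedding_mat : IsClosedEmbedding mat := by
  refine ⟨isEmbedding_mat, ?_⟩
  have h_range : Set.range mat = {A : Matrix (Fin 3) (Fin 3) ℂ | A.det = 1} ∩
      {A | A.conjTranspose * hermH * A = hermH} := by
    ext A
    constructor
    · rintro ⟨g, rfl⟩
      exact ⟨det_mat g, mat_mem g⟩
    · rintro ⟨h_det, h_herm⟩
      exact ⟨⟨⟨A, h_det⟩, h_herm⟩, rfl⟩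
  rw [h_range]
  exact (isClosed_eq continuous_id.matrix_det continuous_const).inter
    (isClosed_eq (((continuous_id.matrix_conjTranspose).mul continuous_const).mul continuous_id)
      continuous_const)

lemma isCompact_setOf_norm_entry_le {m n E : Type*} [SeminormedAddGroup E] [ProperSpace E]
    (M : ℝ) : IsCompact {A : Matrix m n E | ∀ i j, ‖A i j‖ ≤ M} := by
  have h_pi : {A : Matrix m n E | ∀ i j, ‖A i j‖ ≤ M}
      = Set.univ.pi fun _ => Set.univ.pi fun _ => Metric.closedBall (0 : E) M := by
    ext A
    exact forall_congr' fun i => by simp [Set.mem_pi]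
  rw [h_pi]
  exact isCompact_univ_pi fun _ => isCompact_univ_pi fun _ => isCompact_closedBall _ _

lemma prox_smul_origin (g : SU21) : prox (g • origin) origin = ‖mat g 2 2‖⁻¹ := by
  have h_aut : autFactor g origin.1 = mat g 2 2 := by
    rw [autFactor, mulVec_lift_apply, origin, map_zero, zero_add]
  have h_ne := norm_ne_zero_iff.2 (autFactor_ne_zero g origin)
  have h := sqrt_defect_smul g origin
  rw [defect_origin, Real.sqrt_one, h_aut] at h
  rw [h_aut] at h_ne
  rw [prox_origin]
  exact eq_inv_of_mul_eq_one_right h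

lemma isCompact_setOf_le_prox {r : ℝ} (hr : 0 < r) : IsCompact {z : Ball | r ≤ prox z origin} := by
  have h_image : Subtype.val '' {z : Ball | r ≤ prox z origin} = {z | r ^ 2 ≤ defect z} := by
    ext z
    constructor
    · rintro ⟨z, hz, rfl⟩
      rw [Set.mem_ofPred_eq, prox_origin] at hz
      exact (Real.le_sqrt hr.le (defect_pos z).le).1 hz
    · intro hz
      have h_pos : 0 < defect z := (pow_pos hr 2).trans_le hz
      refine ⟨⟨z, mem_ball_iff.2 h_pos⟩, ?_, rfl⟩
      rw [Set.mem_ofPred_eq, prox_origin]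
      exact (Real.le_sqrt hr.le h_pos.le).2 hz
  rw [IsEmbedding.subtypeVal.isCompact_iff, h_image]
  refine (isCompact_closedBall (0 : Fin 2 → ℂ) 1).of_isClosed_subset
    (isClosed_le continuous_const continuous_defect) fun z hz => ?_
  have h_sum : ‖z 0‖ ^ 2 + ‖z 1‖ ^ 2 ≤ 1 := sub_nonneg.1 ((sq_nonneg r).trans hz)
  rw [mem_closedBall_zero_iff, pi_norm_le_iff_of_nonneg zero_le_one, Fin.forall_fin_two,
    ← sq_le_one_iff₀ (norm_nonneg _), ← sq_le_one_iff₀ (norm_nonneg _)]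
  constructor <;> linarith [sq_nonneg ‖z 0‖, sq_nonneg ‖z 1‖]

lemma hypMeasure_setOf_le_prox_lt_top {r : ℝ} (hr : 0 < r) :
    hypMeasure {z | r ≤ prox z origin} < ⊤ := by
  have h_compact := isCompact_setOf_le_prox hr
  rw [hypMeasure_apply h_compact.measurableSet]
  have h_density : ∀ z ∈ Subtype.val '' {z : Ball | r ≤ prox z origin},
      ENNReal.ofReal ((defect z ^ 3)⁻¹) ≤ ENNReal.ofReal (((r ^ 2) ^ 3)⁻¹) := by
    rintro _ ⟨z, hz, rfl⟩
    rw [Set.mem_ofPred_eq, prox_origin, Real.le_sqrt hr.le (defect_pos z).le] at hz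
    gcongr
  refine (setLIntegral_mono measurable_const h_density).trans_lt ?_
  rw [setLIntegral_const]
  exact ENNReal.mul_lt_top ENNReal.ofReal_lt_top
    (h_compact.image continuous_subtype_val).measure_lt_top

/-- The hyperbolic ball `{ζ : 1 - δ < 1 / cosh² d(ζ, z)}` about `z`. -/
def cell (δ : ℝ) (z : Ball) : Set Ball := {ζ | 1 - δ < prox ζ z ^ 2}

lemma isOpen_cell (δ : ℝ) (z : Ball) : IsOpen (cell δ z) :=
  isOpen_lt continuous_const ((continuous_prox continuous_id continuous_const).pow 2)

lemma mem_cell_comm {δ : ℝ} {z ζ : Ball} : ζ ∈ cell δ z ↔ z ∈ cell δ ζ := by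
  simp only [cell, Set.mem_ofPred_eq, prox_comm ζ z]

lemma smul_mem_cell_smul (g : SU21) {δ : ℝ} {z ζ : Ball} :
    g • ζ ∈ cell δ (g • z) ↔ ζ ∈ cell δ z := by
  simp [cell]

lemma exists_mem_cell_denseSeq [Nonempty Ball] {δ : ℝ} (hδ : 0 < δ) (z : Ball) :
    ∃ n, z ∈ cell δ (TopologicalSpace.denseSeq Ball n) := by
  obtain ⟨_, hw, n, rfl⟩ := (TopologicalSpace.denseRange_denseSeq Ball).inter_open_nonempty _
    (isOpen_cell δ z) ⟨z, by simp [cell, hδ]⟩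
  exact ⟨n, mem_cell_comm.1 hw⟩

/- The domain consists, for each `n`, of the points of `U n` whose orbits avoid `U m` for all
`m < n`. -/
lemma exists_isFundamentalDomain_of_cover {G X : Type*} [Group G] [Countable G] [MulAction G X]
    [MeasurableSpace X] [MeasurableConstSMul G X] (μ : Measure X) {U : ℕ → Set X}
    (hU : ∀ n, MeasurableSet (U n)) (h_cover : ∀ x, ∃ n, x ∈ U n)
    (h_disj : ∀ n (g : G), ∀ x ∈ U n, g • x ∈ U n → g = 1) :
    ∃ F : Set X, IsFundamentalDomain G F μ := by
  classical
  let F : Set X := ⋃ n, (U n ∩ ⋂ m ∈ Set.Iio n, ⋂ g : G, {x | g • x ∉ U m})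
  have mem_F (x : X) : x ∈ F ↔ ∃ n, x ∈ U n ∧ ∀ m < n, ∀ g : G, g • x ∉ U m := by simp [F]
  refine ⟨F, IsFundamentalDomain.mk' (MeasurableSet.nullMeasurableSet ?_) fun x => ?_⟩
  · exact .iUnion fun n => (hU n).inter <| .biInter (Set.to_countable _) fun m _ =>
      .iInter fun g => (measurable_const_smul g (hU m)).compl
  · have h_ex : ∃ n, ∃ g : G, g • x ∈ U n := (h_cover x).imp fun n hn => ⟨1, by rwa [one_smul]⟩
    have h_min : ∀ m < Nat.find h_ex, ∀ g : G, g • x ∉ U m := fun m hm g hg =>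
      Nat.find_min h_ex hm ⟨g, hg⟩
    obtain ⟨g, hg⟩ := Nat.find_spec h_ex
    refine ⟨g, (mem_F _).2 ⟨_, hg, fun m hm h => smul_smul h g x ▸ h_min m hm _⟩, fun h hh => ?_⟩
    obtain ⟨n, hn, hn_min⟩ := (mem_F _).1 hh
    have h_eq : n = Nat.find h_ex := by
      refine le_antisymm (not_lt.1 fun h_lt => hn_min _ h_lt (g * h⁻¹) ?_)
        (Nat.find_min' h_ex ⟨h, hn⟩)
      rwa [smul_smul, inv_mul_cancel_right]
    rw [← mul_inv_eq_one]
    exact h_disj _ _ _ hg (by rwa [smul_smul, inv_mul_cancel_right, ← h_eq])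

section Discrete

variable {Γ : Subgroup SU21}

lemma countable_of_discreteTopology (h : DiscreteTopology Γ) : Countable Γ := by
  have : SecondCountableTopology (Matrix (Fin 3) (Fin 3) ℂ) :=
    inferInstanceAs (SecondCountableTopology (Fin 3 → Fin 3 → ℂ))
  have := (isEmbedding_mat.comp (IsEmbedding.subtypeVal (p := (· ∈ Γ)))).secondCountableTopology
  exact countable_of_Lindelof_of_discrete

lemma finite_setOf_norm_entry_le (h : DiscreteTopology Γ) (M : ℝ) :
    {γ : Γ | ∀ i j, ‖mat γ i j‖ ≤ M}.Finite := by
  have h_compact := (isClosedEmbedding_mat.isCompact_preimage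
    (isCompact_setOf_norm_entry_le M)).inter_right (Subgroup.isClosed_of_discrete (H := Γ))
  have h_discrete : IsDiscrete (Γ : Set SU21) := ⟨h⟩
  have h_finite := h_compact.finite (h_discrete.mono Set.inter_subset_right)
  refine Set.Finite.of_finite_image (h_finite.subset ?_) Subtype.val_injective.injOn
  rintro _ ⟨γ, hγ, rfl⟩
  exact ⟨hγ, γ.2⟩

lemma finite_setOf_le_prox_smul_origin (h : DiscreteTopology Γ) {c : ℝ} (hc : 0 < c) :
    {γ : Γ | c ≤ prox (γ • origin) origin}.Finite := by
  refine (finite_setOf_norm_entry_le h c⁻¹).subset fun γ hγ i j => (norm_entry_le γ.1 i j).trans ?_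
  rw [Set.mem_ofPred_eq, Subgroup.smul_def, prox_smul_origin] at hγ
  exact le_inv_of_le_inv₀ hc hγ

lemma finite_setOf_le_prox_smul (h : DiscreteTopology Γ) {c r : ℝ} (hc : 0 < c) (hr : 0 < r) :
    {γ : Γ | ∃ z w, r ≤ prox z origin ∧ r ≤ prox w origin ∧ c ≤ prox (γ • z) w}.Finite := by
  refine (finite_setOf_le_prox_smul_origin h (c := c * r * r / 4) (by positivity)).subset ?_
  rintro γ ⟨z, w, hz, hw, hγ⟩
  have h_w : c * r ≤ 2 * prox (γ • z) origin :=
    (mul_le_mul hγ hw hr.le (prox_pos _ _).le).trans (prox_mul_prox_le w origin (γ • z))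
  have h_z : prox (γ • origin) (γ • z) * prox (γ • z) origin ≤ 2 * prox (γ • origin) origin :=
    prox_mul_prox_le _ _ _
  rw [Subgroup.smul_def, Subgroup.smul_def, prox_smul, prox_comm] at h_z
  rw [Set.mem_ofPred_eq, Subgroup.smul_def]
  rw [Subgroup.smul_def] at h_w
  nlinarith [mul_le_mul hz h_w (by positivity) (prox_pos _ _).le]

lemma IsPicardGroup.eq_one_of_smul_eq (hΓ : IsPicardGroup Γ) {γ : Γ} {z : Ball}
    (h : γ • z = z) : γ = 1 := by
  have h_finite := finite_setOf_le_prox_smul hΓ.discrete zero_lt_one (prox_pos z origin)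
  have h_order : IsOfFinOrder γ := by
    refine finite_powers.1 (h_finite.subset ?_)
    rintro _ ⟨n, rfl⟩
    have h_pow : γ ^ n ∈ MulAction.stabilizer Γ z := pow_mem (MulAction.mem_stabilizer_iff.2 h) n
    exact ⟨z, z, le_rfl, le_rfl, by rw [MulAction.mem_stabilizer_iff.1 h_pow, prox_self]⟩
  exact Subtype.ext (hΓ.torsionFree γ γ.2 (Γ.subtype.isOfFinOrder h_order))

lemma IsPicardGroup.exists_le_prox_smul_origin (hΓ : IsPicardGroup Γ) :
    ∃ r : ℝ, 0 < r ∧ ∀ z : Ball, ∃ γ : Γ, r ≤ prox (γ • z) origin := by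
  have := hΓ.cocompact
  let U : ℕ → Set (Surface Γ) := fun n =>
    Quotient.mk _ '' {z : Ball | 1 / ((n : ℝ) + 1) < prox z origin}
  have h_open : ∀ n, IsOpen (U n) := fun n =>
    isOpenMap_quotient_mk'_mul _ (isOpen_lt continuous_const
      (continuous_prox continuous_id continuous_const))
  have h_mono : Monotone U := fun m n hmn => by
    refine Set.image_mono fun z (hz : 1 / ((m : ℝ) + 1) < prox z origin) => ?_
    have h_le : 1 / ((n : ℝ) + 1) ≤ 1 / ((m : ℝ) + 1) := by gcongr
    exact h_le.trans_lt hz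
  have h_cover : (Set.univ : Set (Surface Γ)) ⊆ ⋃ n, U n := by
    rintro ⟨z⟩ -
    obtain ⟨n, hn⟩ := exists_nat_one_div_lt (prox_pos z origin)
    exact Set.mem_iUnion.2 ⟨n, z, hn, rfl⟩
  obtain ⟨n, hn⟩ := isCompact_univ.elim_directed_cover U h_open h_cover h_mono.directed_le
  refine ⟨1 / ((n : ℝ) + 1), by positivity, fun z => ?_⟩
  obtain ⟨_, hw, h_orbit⟩ := hn (Set.mem_univ (Quotient.mk _ z))
  obtain ⟨γ, rfl⟩ := MulAction.orbitRel_apply.1 (Quotient.exact h_orbit)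
  exact ⟨γ, hw.le⟩

lemma IsPicardGroup.eventually_prox_smul_le (hΓ : IsPicardGroup Γ) {r : ℝ} (hr : 0 < r) {γ : Γ}
    (hγ : γ ≠ 1) : ∀ᶠ c in 𝓝[<] (1 : ℝ), ∀ z, r ≤ prox z origin → prox (γ • z) z ≤ c := by
  have h_cont : Continuous fun z : Ball => prox (γ • z) z :=
    continuous_prox (continuous_const_smul γ) continuous_id
  rcases Set.eq_empty_or_nonempty {z : Ball | r ≤ prox z origin} with h_empty | h_ne
  · exact .of_forall fun c z hz => (h_empty.subset hz).elim
  · obtain ⟨z₀, -, hz₀⟩ := (isCompact_setOf_le_prox hr).exists_isMaxOn h_ne h_cont.continuousOn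
    have h_lt : prox (γ • z₀) z₀ < 1 :=
      (prox_le_one _ _).lt_of_ne fun h => hγ (hΓ.eq_one_of_smul_eq (prox_eq_one_iff.1 h))
    filter_upwards [Ioo_mem_nhdsLT h_lt] with c hc z hz using (hz₀ hz).trans hc.1.le

lemma IsPicardGroup.eventually_forall_prox_smul_le (hΓ : IsPicardGroup Γ) {r : ℝ} (hr : 0 < r) :
    ∀ᶠ c in 𝓝[<] (1 : ℝ), ∀ γ : Γ, γ ≠ 1 → ∀ z, r ≤ prox z origin → prox (γ • z) z ≤ c := by
  have h_near : ∀ᶠ c in 𝓝[<] (1 : ℝ), ∀ γ ∈ {γ : Γ | ∃ z w, r ≤ prox z origin ∧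
      r ≤ prox w origin ∧ 1 / 2 ≤ prox (γ • z) w}, γ ≠ 1 →
      ∀ z, r ≤ prox z origin → prox (γ • z) z ≤ c := by
    refine (Filter.eventually_all_finite
      (finite_setOf_le_prox_smul hΓ.discrete one_half_pos hr)).2 fun γ _ => ?_
    by_cases hγ : γ = 1
    · exact .of_forall fun c h => (h hγ).elim
    · filter_upwards [hΓ.eventually_prox_smul_le hr hγ] with c hc _ using hc
  filter_upwards [h_near, Ioo_mem_nhdsLT one_half_lt_one] with c hc h_half γ hγ z hz
  by_cases h : 1 / 2 ≤ prox (γ • z) z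
  · exact hc γ ⟨z, z, hz, hz, h⟩ hγ z hz
  · exact (not_le.1 h).le.trans h_half.1.le

lemma IsPicardGroup.exists_prox_smul_le (hΓ : IsPicardGroup Γ) :
    ∃ c : ℝ, 0 < c ∧ c < 1 ∧ ∀ γ : Γ, γ ≠ 1 → ∀ z : Ball, prox (γ • z) z ≤ c := by
  obtain ⟨r, hr, h_orbit⟩ := hΓ.exists_le_prox_smul_origin
  obtain ⟨c, hc, hc0, hc1⟩ :=
    ((hΓ.eventually_forall_prox_smul_le hr).and (Ioo_mem_nhdsLT zero_lt_one)).exists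
  refine ⟨c, hc0, hc1, fun γ hγ z => ?_⟩
  obtain ⟨β, hβ⟩ := h_orbit z
  calc prox (γ • z) z = prox ((β * γ * β⁻¹) • β • z) (β • z) := by
        rw [smul_smul, inv_mul_cancel_right, mul_smul]
        exact (prox_smul β.1 _ _).symm
    _ ≤ c := hc _ (fun h => hγ (by rwa [mul_inv_eq_one, mul_eq_left] at h)) _ hβ

lemma IsPicardGroup.exists_cell_disjoint (hΓ : IsPicardGroup Γ) :
    ∃ δ : ℝ, 0 < δ ∧ δ < 1 ∧ ∀ γ : Γ, ∀ z ζ : Ball, ζ ∈ cell δ z → γ • ζ ∈ cell δ z → γ = 1 := by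
  obtain ⟨c, hc0, hc1, h_gap⟩ := hΓ.exists_prox_smul_le
  refine ⟨(1 - c) / 2, by linarith, by linarith, fun γ z ζ hζ hγζ => by_contra fun hγ => ?_⟩
  have hγζ' : ζ ∈ cell ((1 - c) / 2) (γ⁻¹ • z) := by
    rw [← smul_mem_cell_smul γ.1]
    simpa only [← Subgroup.smul_def, smul_inv_smul] using hγζ
  have h_tri := one_sub_le_one_add_mul_prox (by linarith) (le_of_lt hζ) (le_of_lt hγζ')
  have h_le := h_gap γ⁻¹ (inv_ne_one.2 hγ) z
  rw [prox_comm] at h_le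
  nlinarith

lemma IsPicardGroup.exists_isFundamentalDomain (hΓ : IsPicardGroup Γ) :
    ∃ F : Set Ball, IsFundamentalDomain Γ F hypMeasure := by
  have := countable_of_discreteTopology hΓ.discrete
  have : Nonempty Ball := ⟨origin⟩
  obtain ⟨δ, hδ, -, h_disj⟩ := hΓ.exists_cell_disjoint
  exact exists_isFundamentalDomain_of_cover hypMeasure
    (fun n => (isOpen_cell δ (TopologicalSpace.denseSeq Ball n)).measurableSet)
    (exists_mem_cell_denseSeq hδ) fun n γ x => h_disj γ _ x

lemma IsPicardGroup.isFundamentalDomain (hΓ : IsPicardGroup Γ) :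
    IsFundamentalDomain Γ (fundDomain Γ) hypMeasure := by
  rw [fundDomain, dif_pos hΓ.exists_isFundamentalDomain]
  exact hΓ.exists_isFundamentalDomain.choose_spec

lemma IsPicardGroup.lintegral_unfold (hΓ : IsPicardGroup Γ) {f : Ball → ENNReal}
    (hf : Measurable f) :
    ∫⁻ z, f z ∂hypMeasure = ∫⁻ z in fundDomain Γ, ∑' γ : Γ, f (γ • z) ∂hypMeasure := by
  have := countable_of_discreteTopology hΓ.discrete
  rw [hΓ.isFundamentalDomain.lintegral_eq_tsum'', lintegral_tsum]
  exact fun γ => (hf.comp (continuous_const_smul γ).measurable).aemeasurable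

lemma IsPicardGroup.measure_fundDomain_le (hΓ : IsPicardGroup Γ) {K : Set Ball}
    (hK : MeasurableSet K) (h_orbit : ∀ z, ∃ γ : Γ, γ • z ∈ K) :
    hypMeasure (fundDomain Γ) ≤ hypMeasure K := by
  rw [← lintegral_indicator_one hK, hΓ.lintegral_unfold (measurable_one.indicator hK),
    ← setLIntegral_one]
  refine lintegral_mono fun z => ?_
  obtain ⟨γ, hγ⟩ := h_orbit z
  calc (1 : ENNReal) = K.indicator 1 (γ • z) := by rw [Set.indicator_of_mem hγ, Pi.one_apply]
    _ ≤ ∑' γ : Γ, K.indicator 1 (γ • z) := ENNReal.le_tsum γ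

lemma IsPicardGroup.measure_fundDomain_lt_top (hΓ : IsPicardGroup Γ) :
    hypMeasure (fundDomain Γ) < ⊤ := by
  obtain ⟨r, hr, h_orbit⟩ := hΓ.exists_le_prox_smul_origin
  exact (hΓ.measure_fundDomain_le (isCompact_setOf_le_prox hr).measurableSet h_orbit).trans_lt
    (hypMeasure_setOf_le_prox_lt_top hr)

end Discrete

/-! ### Orbit sums -/

section OrbitSums

variable {Γ : Subgroup SU21}

lemma lintegral_prox_pow (p : ℕ) (w : Ball) :
    ∫⁻ ζ, ENNReal.ofReal (prox ζ w ^ (6 + p)) ∂hypMeasure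
      = ∫⁻ ζ in Ball, ENNReal.ofReal (√(defect ζ) ^ p) := by
  obtain ⟨g, rfl⟩ := exists_smul_eq origin w
  rw [← lintegral_smul g]
  simp_rw [prox_smul, prox_origin]
  rw [lintegral_hypMeasure fun ζ => ENNReal.ofReal (√(defect ζ) ^ (6 + p))]
  refine setLIntegral_congr_fun measurableSet_ball fun ζ hζ => ?_
  have h_pos := mem_ball_iff.1 hζ
  have h_six : √(defect ζ) ^ 6 = defect ζ ^ 3 := by
    rw [show 6 = 2 * 3 from rfl, pow_mul, Real.sq_sqrt h_pos.le]
  rw [← ENNReal.ofReal_mul (by positivity), pow_add, h_six, inv_mul_cancel_left₀ (by positivity)]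

lemma volume_ball_lt_top : volume Ball < ⊤ := by
  have h_subset : Ball ⊆ Metric.closedBall 0 1 := by
    intro z (hz : ‖z 0‖ ^ 2 + ‖z 1‖ ^ 2 < 1)
    rw [mem_closedBall_zero_iff, pi_norm_le_iff_of_nonneg zero_le_one, Fin.forall_fin_two]
    constructor <;> nlinarith [sq_nonneg ‖z 0‖, sq_nonneg ‖z 1‖]
  exact (measure_mono h_subset).trans_lt (isCompact_closedBall 0 1).measure_lt_top

lemma zero_mem_ball : (0 : Fin 2 → ℂ) ∈ Ball := origin.2

lemma volume_ball_pos : 0 < volume Ball := isOpen_ball.measure_pos _ ⟨0, zero_mem_ball⟩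

lemma cell_mono {δ ε : ℝ} (h : δ ≤ ε) (z : Ball) : cell δ z ⊆ cell ε z :=
  fun _ hζ => (sub_le_sub_left h 1).trans_lt hζ

lemma lintegral_cell_smul (g : SU21) (δ : ℝ) (z : Ball) (f : Ball → ENNReal) :
    ∫⁻ ζ in cell δ (g • z), f ζ ∂hypMeasure = ∫⁻ ζ in cell δ z, f (g • ζ) ∂hypMeasure := by
  have h_preimage : cell δ z = (g • ·) ⁻¹' cell δ (g • z) :=
    Set.ext fun _ => (smul_mem_cell_smul g).symm
  rw [← lintegral_indicator (isOpen_cell _ _).measurableSet,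
    ← lintegral_indicator (isOpen_cell _ _).measurableSet, ← lintegral_smul g, h_preimage]
  rfl

lemma IsPicardGroup.lintegral_cell_le (hΓ : IsPicardGroup Γ) {δ : ℝ}
    (h_disj : ∀ γ : Γ, ∀ z ζ : Ball, ζ ∈ cell δ z → γ • ζ ∈ cell δ z → γ = 1) (z : Ball)
    {f : Ball → ENNReal} (hf : Measurable f) (h_inv : ∀ γ : Γ, ∀ ζ, f (γ • ζ) = f ζ) :
    ∫⁻ ζ in cell δ z, f ζ ∂hypMeasure ≤ ∫⁻ ζ in fundDomain Γ, f ζ ∂hypMeasure := by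
  have h_cell := (isOpen_cell δ z).measurableSet
  rw [← lintegral_indicator h_cell, hΓ.lintegral_unfold (hf.indicator h_cell)]
  refine lintegral_mono fun ζ => ?_
  by_cases h_orbit : ∃ β : Γ, β • ζ ∈ cell δ z
  · obtain ⟨β, hβ⟩ := h_orbit
    rw [tsum_eq_single β, Set.indicator_of_mem hβ, h_inv]
    refine fun γ hγ => Set.indicator_of_notMem (fun h_mem => hγ ?_) _
    have h_one := h_disj (γ * β⁻¹) z (β • ζ) hβ (by rwa [smul_smul, inv_mul_cancel_right])
    rwa [mul_inv_eq_one] at h_one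
  · push Not at h_orbit
    simp [Set.indicator_of_notMem (h_orbit _)]

lemma hypMeasure_cell (δ : ℝ) (z : Ball) : hypMeasure (cell δ z) = hypMeasure (cell δ origin) := by
  obtain ⟨g, rfl⟩ := exists_smul_eq origin z
  simpa using lintegral_cell_smul g δ origin 1

lemma hypMeasure_cell_pos {δ : ℝ} (hδ : 0 < δ) : 0 < hypMeasure (cell δ origin) := by
  have h_open : IsOpen (Subtype.val '' cell δ origin) :=
    isOpen_ball.isOpenMap_subtype_val _ (isOpen_cell _ _)
  rw [hypMeasure_apply (isOpen_cell _ _).measurableSet, setLIntegral_pos_iff (by fun_prop)]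
  refine (h_open.measure_pos _ ⟨0, origin, ?_, rfl⟩).trans_le
    (measure_mono (Set.subset_inter ?_ le_rfl))
  · simp [cell, hδ]
  · rintro _ ⟨ζ, -, rfl⟩
    have := defect_pos ζ
    simp only [Function.mem_support, ne_eq, ENNReal.ofReal_eq_zero, not_le]
    positivity

lemma prox_pow_six_le {δ : ℝ} (hδ : δ ≤ 1) {z ζ : Ball} (hζ : ζ ∈ cell δ z) (w : Ball) :
    prox z w ^ 6 * ((1 - δ) ^ 3 / 64) ≤ prox ζ w ^ 6 := by
  have h_le : (prox ζ z * prox z w) ^ 6 ≤ (2 * prox ζ w) ^ 6 :=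
    pow_le_pow_left₀ (mul_pos (prox_pos _ _) (prox_pos _ _)).le (prox_mul_prox_le z w ζ) 6
  have h_cell : (1 - δ) ^ 3 ≤ (prox ζ z ^ 2) ^ 3 := pow_le_pow_left₀ (by linarith) (le_of_lt hζ) 3
  rw [mul_pow, mul_pow] at h_le
  nlinarith [mul_le_mul_of_nonneg_right h_cell (pow_pos (prox_pos z w) 6).le]

lemma prox_pow_six_mul_hypMeasure_cell_le {δ : ℝ} (hδ : δ ≤ 1) (z w : Ball) :
    ENNReal.ofReal (prox z w ^ 6) *
        (ENNReal.ofReal ((1 - δ) ^ 3 / 64) * hypMeasure (cell δ origin))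
      ≤ ∫⁻ ζ in cell δ z, ENNReal.ofReal (prox ζ w ^ 6) ∂hypMeasure := by
  rw [← mul_assoc, ← ENNReal.ofReal_mul (pow_pos (prox_pos z w) 6).le, ← hypMeasure_cell δ z,
    ← setLIntegral_const]
  exact setLIntegral_mono' (isOpen_cell δ z).measurableSet fun ζ hζ =>
    ENNReal.ofReal_le_ofReal (prox_pow_six_le hδ hζ w)

lemma measurable_ofReal_prox_pow (n : ℕ) (w : Ball) :
    Measurable fun ζ : Ball => ENNReal.ofReal (prox ζ w ^ n) :=
  ENNReal.measurable_ofReal.comp ((continuous_prox continuous_id continuous_const).pow n).measurable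

lemma IsPicardGroup.tsum_prox_pow_six_mul_le (hΓ : IsPicardGroup Γ) {δ : ℝ} (hδ : δ ≤ 1)
    (h_disj : ∀ γ : Γ, ∀ z ζ : Ball, ζ ∈ cell δ z → γ • ζ ∈ cell δ z → γ = 1) (z w : Ball) :
    (∑' γ : Γ, ENNReal.ofReal (prox (γ • z) w ^ 6)) *
        (ENNReal.ofReal ((1 - δ) ^ 3 / 64) * hypMeasure (cell δ origin)) ≤ volume Ball := by
  have := countable_of_discreteTopology hΓ.discrete
  have h_meas : ∀ γ : Γ, Measurable fun ζ : Ball => ENNReal.ofReal (prox (γ • ζ) w ^ 6) :=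
    fun γ => (measurable_ofReal_prox_pow 6 w).comp (measurable_const_smul γ)
  have h_inv (γ : Γ) (ζ : Ball) : ∑' β : Γ, ENNReal.ofReal (prox (β • γ • ζ) w ^ 6)
      = ∑' β : Γ, ENNReal.ofReal (prox (β • ζ) w ^ 6) := by
    rw [← (Equiv.mulRight γ).tsum_eq fun β : Γ => ENNReal.ofReal (prox (β • ζ) w ^ 6)]
    simp [mul_smul]
  rw [← ENNReal.tsum_mul_right]
  calc ∑' γ : Γ, ENNReal.ofReal (prox (γ • z) w ^ 6) *
        (ENNReal.ofReal ((1 - δ) ^ 3 / 64) * hypMeasure (cell δ origin))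
      ≤ ∑' γ : Γ, ∫⁻ ζ in cell δ z, ENNReal.ofReal (prox (γ • ζ) w ^ 6) ∂hypMeasure :=
        ENNReal.tsum_le_tsum fun γ =>
          (prox_pow_six_mul_hypMeasure_cell_le hδ (γ • z) w).trans_eq
            (lintegral_cell_smul γ.1 δ z _)
    _ = ∫⁻ ζ in cell δ z, ∑' γ : Γ, ENNReal.ofReal (prox (γ • ζ) w ^ 6) ∂hypMeasure :=
        (lintegral_tsum fun γ => (h_meas γ).aemeasurable).symm
    _ ≤ ∫⁻ ζ in fundDomain Γ, ∑' γ : Γ, ENNReal.ofReal (prox (γ • ζ) w ^ 6) ∂hypMeasure :=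
        hΓ.lintegral_cell_le h_disj z (Measurable.tsum h_meas) h_inv
    _ = ∫⁻ ζ, ENNReal.ofReal (prox ζ w ^ 6) ∂hypMeasure :=
        (hΓ.lintegral_unfold (measurable_ofReal_prox_pow 6 w)).symm
    _ = volume Ball := by simpa using lintegral_prox_pow 0 w

lemma summable_and_tsum_le_of_tsum_ofReal_le {α : Type*} {f : α → ℝ} (hf : ∀ a, 0 ≤ f a)
    {C : ENNReal} (hC : C ≠ ⊤) (h : ∑' a, ENNReal.ofReal (f a) ≤ C) :
    Summable f ∧ ∑' a, f a ≤ C.toReal := by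
  have h_summable : Summable f := by
    refine (ENNReal.summable_toReal (h.trans_lt hC.lt_top).ne).congr fun a => ?_
    rw [ENNReal.toReal_ofReal (hf a)]
  rw [← ENNReal.ofReal_tsum_of_nonneg hf h_summable] at h
  exact ⟨h_summable, (ENNReal.ofReal_le_iff_le_toReal hC).1 h⟩

lemma IsPicardGroup.exists_tsum_prox_pow_six_le (hΓ : IsPicardGroup Γ) :
    ∃ C : ℝ, 0 ≤ C ∧ ∀ z w : Ball, Summable (fun γ : Γ => prox (γ • z) w ^ 6) ∧
      ∑' γ : Γ, prox (γ • z) w ^ 6 ≤ C := by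
  obtain ⟨δ, hδ0, hδ1, h_disj⟩ := hΓ.exists_cell_disjoint
  set c := ENNReal.ofReal ((1 - δ) ^ 3 / 64) * hypMeasure (cell δ origin)
  have hc : c ≠ 0 := by
    refine mul_ne_zero (ENNReal.ofReal_ne_zero_iff.2 ?_) (hypMeasure_cell_pos hδ0).ne'
    have : 0 < 1 - δ := by linarith
    positivity
  refine ⟨(volume Ball / c).toReal, ENNReal.toReal_nonneg, fun z w =>
    summable_and_tsum_le_of_tsum_ofReal_le (fun γ => (pow_pos (prox_pos _ _) 6).le)
      (ENNReal.div_ne_top volume_ball_lt_top.ne hc) ?_⟩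
  rw [ENNReal.le_div_iff_mul_le (.inl hc) (.inr volume_ball_lt_top.ne)]
  exact hΓ.tsum_prox_pow_six_mul_le hδ1.le h_disj z w

end OrbitSums

/-! ### The mean value inequality -/

section MeanValue

lemma enorm_sq_le_lintegral_circle {f : ℂ → ℂ} (hf : DiffContOnCl ℂ f (Metric.ball 0 1)) :
    ENNReal.ofReal (2 * Real.pi) * ‖f 0‖ₑ ^ 2
      ≤ ∫⁻ θ in Set.Ioc 0 (2 * Real.pi), ‖f (Circle.exp θ)‖ₑ ^ 2 := by
  have h_sq : DiffContOnCl ℂ (fun c => f c ^ 2) (Metric.ball 0 |1|) := by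
    simpa only [abs_one, pow_two, smul_eq_mul] using hf.smul hf
  have h_avg := h_sq.circleAverage
  rw [Real.circleAverage_def, inv_smul_eq_iff₀ (by positivity),
    intervalIntegral.integral_of_le (by positivity)] at h_avg
  calc ENNReal.ofReal (2 * Real.pi) * ‖f 0‖ₑ ^ 2
      = ‖∫ θ in Set.Ioc 0 (2 * Real.pi), f (circleMap 0 1 θ) ^ 2‖ₑ := by
        rw [h_avg, enorm_smul, Real.enorm_of_nonneg (by positivity), enorm_pow]
    _ ≤ ∫⁻ θ in Set.Ioc 0 (2 * Real.pi), ‖f (circleMap 0 1 θ) ^ 2‖ₑ :=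
        enorm_integral_le_lintegral_enorm _
    _ = ∫⁻ θ in Set.Ioc 0 (2 * Real.pi), ‖f (Circle.exp θ)‖ₑ ^ 2 := by
        simp only [enorm_pow, circleMap, Circle.coe_exp, zero_add, Complex.ofReal_one, one_mul]

variable {E : Type*} [NormedAddCommGroup E] [NormedSpace ℂ E] {U : Set E} {f : E → ℂ}

lemma enorm_sq_le_lintegral_circle_smul (hU : Balanced ℂ U) (hf : DifferentiableOn ℂ f U) {z : E}
    (hz : z ∈ U) :
    ENNReal.ofReal (2 * Real.pi) * ‖f 0‖ₑ ^ 2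
      ≤ ∫⁻ θ in Set.Ioc 0 (2 * Real.pi), ‖f (Circle.exp θ • z)‖ₑ ^ 2 := by
  have h_disc : DiffContOnCl ℂ (fun c : ℂ => f (c • z)) (Metric.ball 0 1) := by
    refine DifferentiableOn.diffContOnCl ?_
    rw [closure_ball _ one_ne_zero]
    exact hf.comp (f := fun c : ℂ => c • z) (by fun_prop) fun c hc =>
      hU.smul_mem (mem_closedBall_zero_iff.1 hc) hz
  simpa only [zero_smul, Circle.smul_def] using enorm_sq_le_lintegral_circle h_disc

/- Average the inequality on the disc `{c z : ‖c‖ ≤ 1}` over `z`. -/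
lemma enorm_sq_mul_measure_le_lintegral [MeasurableSpace E] [BorelSpace E] {μ : Measure E}
    [SFinite μ] (hμ : ∀ a : Circle, MeasurePreserving (a • · : E → E) μ μ) (hU : Balanced ℂ U)
    (hUo : IsOpen U) (hf : DifferentiableOn ℂ f U) :
    ‖f 0‖ₑ ^ 2 * μ U ≤ ∫⁻ z in U, ‖f z‖ₑ ^ 2 ∂μ := by
  let F : E → ENNReal := U.indicator fun z => ‖f z‖ₑ ^ 2
  have hF : Measurable F := by
    classical
    have h_cont : ContinuousOn (fun z => ‖f z‖ₑ ^ 2) U :=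
      (ENNReal.continuous_pow 2).comp_continuousOn
        (continuous_enorm.comp_continuousOn hf.continuousOn)
    simpa only [Set.piecewise_eq_indicator] using
      h_cont.measurable_piecewise (g := 0) continuousOn_const hUo.measurableSet
  have h_rotate : Continuous fun p : E × ℝ => Circle.exp p.2 • p.1 := by
    simp only [Circle.smul_def, Circle.coe_exp]
    fun_prop
  have h_disc : ENNReal.ofReal (2 * Real.pi) * ‖f 0‖ₑ ^ 2 * μ U
      ≤ ENNReal.ofReal (2 * Real.pi) * ∫⁻ z in U, ‖f z‖ₑ ^ 2 ∂μ := by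
    calc ENNReal.ofReal (2 * Real.pi) * ‖f 0‖ₑ ^ 2 * μ U
        = ∫⁻ _ in U, ENNReal.ofReal (2 * Real.pi) * ‖f 0‖ₑ ^ 2 ∂μ := by rw [setLIntegral_const]
      _ ≤ ∫⁻ z in U, ∫⁻ θ in Set.Ioc 0 (2 * Real.pi), F (Circle.exp θ • z) ∂volume ∂μ := by
          refine setLIntegral_mono' hUo.measurableSet fun z hz =>
            (enorm_sq_le_lintegral_circle_smul hU hf hz).trans_eq ?_
          congr 1 with θ
          exact (Set.indicator_of_mem (hU.smul_mem (Circle.norm_coe (Circle.exp θ)).le hz)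
            fun z => ‖f z‖ₑ ^ 2).symm
      _ ≤ ∫⁻ z, ∫⁻ θ in Set.Ioc 0 (2 * Real.pi), F (Circle.exp θ • z) ∂volume ∂μ :=
          setLIntegral_le_lintegral _ _
      _ = ∫⁻ θ in Set.Ioc 0 (2 * Real.pi), ∫⁻ z, F (Circle.exp θ • z) ∂μ :=
          lintegral_lintegral_swap (hF.comp h_rotate.measurable).aemeasurable
      _ = ENNReal.ofReal (2 * Real.pi) * ∫⁻ z in U, ‖f z‖ₑ ^ 2 ∂μ := by
          simp_rw [(hμ _).lintegral_comp hF]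
          rw [setLIntegral_const, Real.volume_Ioc, sub_zero, lintegral_indicator hUo.measurableSet,
            mul_comm]
  rw [mul_assoc] at h_disc
  exact (ENNReal.mul_le_mul_iff_right (by simp [Real.pi_pos]) ENNReal.ofReal_ne_top).1 h_disc

lemma measurePreserving_circle_smul {ι : Type*} [Fintype ι] (a : Circle) :
    MeasurePreserving (a • · : (ι → ℂ) → ι → ℂ) :=
  volume_preserving_pi fun _ => (rotation a).measurePreserving

/-- The Euclidean ball `{z : |z|² < s}`. -/
def eball (s : ℝ) : Set (Fin 2 → ℂ) := {z | 1 - s < defect z}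

lemma isOpen_eball (s : ℝ) : IsOpen (eball s) := isOpen_lt continuous_const continuous_defect

lemma one_sub_defect_smul (c : ℂ) (z : Fin 2 → ℂ) :
    1 - defect (c • z) = ‖c‖ ^ 2 * (1 - defect z) := by
  simp only [defect, Pi.smul_apply, norm_smul]
  ring

lemma eball_one : eball 1 = Ball := by
  ext z
  rw [mem_ball_iff, eball, Set.mem_ofPred_eq, sub_self]

lemma eball_mono {s t : ℝ} (h : s ≤ t) : eball s ⊆ eball t :=
  fun _ hz => (sub_le_sub_left h 1).trans_lt hz

lemma eball_subset_ball {s : ℝ} (hs : s ≤ 1) : eball s ⊆ Ball := eball_one ▸ eball_mono hs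

lemma balanced_eball (s : ℝ) : Balanced ℂ (eball s) := by
  refine balanced_iff_smul_mem.2 fun c hc z (hz : 1 - s < defect z) => ?_
  have h_smul := one_sub_defect_smul c z
  have h_sq : ‖c‖ ^ 2 ≤ 1 := pow_le_one₀ (norm_nonneg c) hc
  change 1 - s < defect (c • z)
  nlinarith [defect_le_one z]

open scoped Pointwise in
lemma eball_eq_smul_ball {s : ℝ} (hs : 0 < s) : eball s = √s • Ball := by
  ext z
  have h_smul := one_sub_defect_smul (((√s)⁻¹ : ℝ) : ℂ) z
  rw [Complex.coe_smul, Complex.norm_real, Real.norm_eq_abs, sq_abs, inv_pow, Real.sq_sqrt hs.le,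
    inv_mul_eq_div, eq_div_iff hs.ne'] at h_smul
  rw [Set.mem_smul_set_iff_inv_smul_mem₀ (Real.sqrt_pos.2 hs).ne', mem_ball_iff]
  change 1 - s < defect z ↔ _
  constructor <;> intro h <;> nlinarith

lemma volume_eball {s : ℝ} (hs : 0 < s) :
    volume (eball s) = ENNReal.ofReal (s ^ 2) * volume Ball := by
  have h_finrank : Module.finrank ℝ (Fin 2 → ℂ) = 2 * 2 := by
    simp [Module.finrank_pi_fintype, Complex.finrank_real_complex]
  rw [eball_eq_smul_ball hs, Measure.addHaar_smul, h_finrank, pow_mul, Real.sq_sqrt hs.le,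
    abs_of_nonneg (by positivity)]

end MeanValue

/-! ### Norms of sections -/

section Sections

variable {Γ : Subgroup SU21} {k : ℕ} {ω : Ball → CanPow k}

/-- The pointwise squared norm `|ω(z)|²_hyp`. -/
def secNorm (k : ℕ) (ω : Ball → CanPow k) (z : Ball) : ℝ :=
  defect z.1 ^ (3 * k) * ‖coefFun k ω z‖ ^ 2

lemma secNorm_nonneg (k : ℕ) (ω : Ball → CanPow k) (z : Ball) : 0 ≤ secNorm k ω z :=
  mul_nonneg (pow_pos (defect_pos z) _).le (sq_nonneg _)

lemma continuous_coefFun (hω : ω ∈ globalSections Γ k) : Continuous (coefFun k ω) := by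
  have h_cont := (mem_globalSections.1 hω).1.continuousOn
  rw [continuousOn_iff_continuous_domRestrict] at h_cont
  exact h_cont.congr fun z => ext0_apply _ z.2

lemma continuous_secNorm (hω : ω ∈ globalSections Γ k) : Continuous (secNorm k ω) :=
  ((continuous_defect.comp continuous_subtype_val).pow _).mul ((continuous_coefFun hω).norm.pow 2)

lemma secNorm_smul (hω : ω ∈ globalSections Γ k) (γ : Γ) (z : Ball) :
    secNorm k ω (γ • z) = secNorm k ω z := by
  have h_defect : ‖autFactor γ z.1‖ ^ 2 * defect (γ • z).1 = defect z.1 := defect_smul γ.1 z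
  rw [secNorm, secNorm, (mem_globalSections.1 hω).2, norm_mul, norm_pow, ← h_defect, mul_pow,
    mul_pow, ← pow_mul, ← pow_mul, mul_comm 2]
  ring

lemma IsPicardGroup.exists_secNorm_le (hΓ : IsPicardGroup Γ) (hω : ω ∈ globalSections Γ k) :
    ∃ M : ℝ, ∀ z, secNorm k ω z ≤ M := by
  obtain ⟨r, hr, h_orbit⟩ := hΓ.exists_le_prox_smul_origin
  obtain ⟨M, hM⟩ := (isCompact_setOf_le_prox hr).bddAbove_image (continuous_secNorm hω).continuousOn
  refine ⟨M, fun z => ?_⟩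
  obtain ⟨γ, hγ⟩ := h_orbit z
  rw [← secNorm_smul hω γ]
  exact hM ⟨_, hγ, rfl⟩

lemma IsPicardGroup.integrableOn_of_bounded (hΓ : IsPicardGroup Γ) {E : Type*}
    [NormedAddCommGroup E] [SecondCountableTopology E] {f : Ball → E} (hf : Continuous f) {M : ℝ}
    (hM : ∀ z, ‖f z‖ ≤ M) : IntegrableOn f (fundDomain Γ) hypMeasure :=
  IntegrableOn.of_bound hΓ.measure_fundDomain_lt_top hf.aestronglyMeasurable M (.of_forall hM)

lemma IsPicardGroup.integrableOn_secNorm (hΓ : IsPicardGroup Γ) (hω : ω ∈ globalSections Γ k) :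
    IntegrableOn (secNorm k ω) (fundDomain Γ) hypMeasure := by
  obtain ⟨M, hM⟩ := hΓ.exists_secNorm_le hω
  exact hΓ.integrableOn_of_bounded (continuous_secNorm hω) fun z =>
    (Real.norm_of_nonneg (secNorm_nonneg k ω z)).trans_le (hM z)

/-- The squared `L²` norm of a section. -/
def sqNorm (Γ : Subgroup SU21) (k : ℕ) (ω : Ball → CanPow k) : ℝ :=
  ∫ z in fundDomain Γ, secNorm k ω z ∂hypMeasure

lemma sqNorm_nonneg : 0 ≤ sqNorm Γ k ω := integral_nonneg fun z => secNorm_nonneg k ω z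

lemma IsPicardGroup.ofReal_sqNorm (hΓ : IsPicardGroup Γ) (hω : ω ∈ globalSections Γ k) :
    ENNReal.ofReal (sqNorm Γ k ω)
      = ∫⁻ z in fundDomain Γ, ENNReal.ofReal (secNorm k ω z) ∂hypMeasure :=
  ofReal_integral_eq_lintegral_ofReal (hΓ.integrableOn_secNorm hω)
    (.of_forall fun z => secNorm_nonneg k ω z)

section Slash

variable {V : Type*} [NormedAddCommGroup V] [NormedSpace ℂ V]

/-- The slash operator of weight `n`, which translates the coefficient function of a section, or a
vector of such functions, by an automorphism of the ball. -/
def slash (g : SU21) (n : ℕ) (f : (Fin 2 → ℂ) → V) (z : Fin 2 → ℂ) : V :=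
  (autFactor g z ^ n)⁻¹ • f (moebius (mat g) z)

lemma differentiable_autFactor (g : SU21) : Differentiable ℂ (autFactor g) :=
  fun z => (hasFDerivAt_autFactor g z).differentiableAt

lemma differentiableOn_slash (g : SU21) (n : ℕ) {f : (Fin 2 → ℂ) → V}
    (hf : DifferentiableOn ℂ f Ball) : DifferentiableOn ℂ (slash g n f) Ball := by
  have h_moebius : DifferentiableOn ℂ (moebius (mat g)) Ball := fun z hz =>
    (hasFDerivAt_moebius g hz).differentiableAt.differentiableWithinAt
  refine DifferentiableOn.smul ?_ (hf.comp h_moebius fun z hz => moebius_mem g hz)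
  exact ((differentiable_autFactor g).differentiableOn.pow n).inv fun z hz =>
    pow_ne_zero _ (autFactor_ne_zero g ⟨z, hz⟩)

end Slash

lemma secNorm_smul_eq_slash (g : SU21) (ω : Ball → CanPow k) (z : Ball) :
    secNorm k ω (g • z)
      = defect z.1 ^ (3 * k) * ‖slash g (3 * k) (ext0 (coefFun k ω)) z.1‖ ^ 2 := by
  have h_pos := norm_pos_iff.2 (autFactor_ne_zero g z)
  have h_ext : ext0 (coefFun k ω) (moebius (mat g) z.1) = coefFun k ω (g • z) :=
    ext0_apply _ (moebius_mem g z.2)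
  rw [slash, h_ext, ← defect_smul g z, norm_smul, norm_inv, norm_pow, secNorm, mul_pow, mul_pow,
    inv_pow, ← pow_mul, ← pow_mul, mul_comm (3 * k) 2]
  field_simp

lemma cell_origin (s : ℝ) : cell s origin = Subtype.val ⁻¹' eball s := by
  ext ζ
  change 1 - s < prox ζ origin ^ 2 ↔ 1 - s < defect ζ.1
  rw [prox_origin, Real.sq_sqrt (defect_pos ζ).le]

lemma setLIntegral_cell_origin {s : ℝ} (hs : s ≤ 1) (f : (Fin 2 → ℂ) → ENNReal) :
    ∫⁻ ζ in cell s origin, f ζ.1 ∂hypMeasure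
      = ∫⁻ z in eball s, ENNReal.ofReal ((defect z ^ 3)⁻¹) * f z := by
  have h_eball := (isOpen_eball s).measurableSet
  have h_indicator (ζ : Ball) : (Subtype.val ⁻¹' eball s).indicator (fun ζ : Ball => f ζ.1) ζ
      = (eball s).indicator f ζ.1 := Set.indicator_comp_right Subtype.val (g := f)
  rw [cell_origin, ← lintegral_indicator (h_eball.preimage measurable_subtype_coe)]
  simp_rw [h_indicator]
  rw [lintegral_hypMeasure]
  simp_rw [← Set.indicator_mul_right (eball s) fun z => ENNReal.ofReal ((defect z ^ 3)⁻¹)]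
  rw [setLIntegral_indicator h_eball, Set.inter_eq_self_of_subset_left (eball_subset_ball hs)]

lemma le_lintegral_cell_origin {s : ℝ} (hs0 : 0 < s) (hs : s < 1) (n : ℕ) {f : (Fin 2 → ℂ) → ℂ}
    (hf : DifferentiableOn ℂ f Ball) :
    ENNReal.ofReal ((1 - s) ^ n * ‖f 0‖ ^ 2 * s ^ 2) * volume Ball
      ≤ ∫⁻ ζ in cell s origin, ENNReal.ofReal (defect ζ.1 ^ n * ‖f ζ.1‖ ^ 2) ∂hypMeasure := by
  have h_density (z) (hz : 1 - s < defect z) : (1 - s) ^ n * ‖f z‖ ^ 2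
      ≤ (defect z ^ 3)⁻¹ * (defect z ^ n * ‖f z‖ ^ 2) := by
    have h_pos : 0 < defect z := by linarith
    have h_inv : 1 ≤ (defect z ^ 3)⁻¹ :=
      (one_le_inv₀ (by positivity)).2 (pow_le_one₀ h_pos.le (defect_le_one z))
    calc (1 - s) ^ n * ‖f z‖ ^ 2 ≤ defect z ^ n * ‖f z‖ ^ 2 := by
          gcongr
      _ ≤ (defect z ^ 3)⁻¹ * (defect z ^ n * ‖f z‖ ^ 2) :=
          le_mul_of_one_le_left (by positivity) h_inv
  have h_nonneg : 0 ≤ (1 - s) ^ n := pow_nonneg (by linarith) n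
  rw [setLIntegral_cell_origin hs.le fun z => ENNReal.ofReal (defect z ^ n * ‖f z‖ ^ 2)]
  calc ENNReal.ofReal ((1 - s) ^ n * ‖f 0‖ ^ 2 * s ^ 2) * volume Ball
      = ENNReal.ofReal ((1 - s) ^ n) * (‖f 0‖ₑ ^ 2 * volume (eball s)) := by
        rw [volume_eball hs0, ENNReal.ofReal_mul (by positivity), ENNReal.ofReal_mul h_nonneg,
          ENNReal.ofReal_pow (norm_nonneg _), ofReal_norm]
        ring
    _ ≤ ENNReal.ofReal ((1 - s) ^ n) * ∫⁻ z in eball s, ‖f z‖ₑ ^ 2 := by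
        gcongr
        exact enorm_sq_mul_measure_le_lintegral measurePreserving_circle_smul (balanced_eball s)
          (isOpen_eball s) (hf.mono (eball_subset_ball hs.le))
    _ = ∫⁻ z in eball s, ENNReal.ofReal ((1 - s) ^ n) * ‖f z‖ₑ ^ 2 := by
        rw [lintegral_const_mul' _ _ ENNReal.ofReal_ne_top]
    _ ≤ _ := by
        refine setLIntegral_mono' (isOpen_eball s).measurableSet fun z hz => ?_
        rw [← ofReal_norm, ← ENNReal.ofReal_pow (norm_nonneg _), ← ENNReal.ofReal_mul h_nonneg,
          ← ENNReal.ofReal_mul' (by have := defect_pos ⟨z, eball_subset_ball hs.le hz⟩; positivity)]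
        exact ENNReal.ofReal_le_ofReal (h_density z hz)

lemma IsPicardGroup.mul_secNorm_le_sqNorm (hΓ : IsPicardGroup Γ) {δ s : ℝ}
    (h_disj : ∀ γ : Γ, ∀ z ζ : Ball, ζ ∈ cell δ z → γ • ζ ∈ cell δ z → γ = 1) (hs0 : 0 < s)
    (hs1 : s < 1) (hsδ : s ≤ δ) (hω : ω ∈ globalSections Γ k) (z : Ball) :
    (1 - s) ^ (3 * k) * secNorm k ω z * s ^ 2 * (volume Ball).toReal ≤ sqNorm Γ k ω := by
  obtain ⟨g, rfl⟩ := exists_smul_eq origin z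
  have h_origin : secNorm k ω (g • origin) = ‖slash g (3 * k) (ext0 (coefFun k ω)) 0‖ ^ 2 := by
    rw [secNorm_smul_eq_slash, defect_origin, one_pow, one_mul, origin]
  rw [← ENNReal.ofReal_le_ofReal_iff sqNorm_nonneg, hΓ.ofReal_sqNorm hω,
    ENNReal.ofReal_mul' ENNReal.toReal_nonneg, ENNReal.ofReal_toReal volume_ball_lt_top.ne,
    h_origin]
  calc _ ≤ _ := le_lintegral_cell_origin hs0 hs1 _
          (differentiableOn_slash g _ (mem_globalSections.1 hω).1)
    _ = ∫⁻ ζ in cell s (g • origin), ENNReal.ofReal (secNorm k ω ζ) ∂hypMeasure := by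
        rw [lintegral_cell_smul]
        simp_rw [secNorm_smul_eq_slash]
    _ ≤ ∫⁻ ζ in cell δ (g • origin), ENNReal.ofReal (secNorm k ω ζ) ∂hypMeasure :=
        lintegral_mono_set (cell_mono hsδ _)
    _ ≤ ∫⁻ ζ in fundDomain Γ, ENNReal.ofReal (secNorm k ω ζ) ∂hypMeasure :=
        hΓ.lintegral_cell_le h_disj _
          (ENNReal.measurable_ofReal.comp (continuous_secNorm hω).measurable)
          fun γ ζ => by rw [secNorm_smul hω]

lemma one_sub_le_one_sub_div_pow {δ : ℝ} (hδ0 : 0 ≤ δ) (hδ1 : δ ≤ 1) {k : ℕ} (hk : 1 ≤ k) :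
    1 - δ ≤ (1 - δ / k) ^ k := by
  have hk' : (1 : ℝ) ≤ k := by exact_mod_cast hk
  have h_bernoulli := one_add_mul_le_pow (a := -(δ / k)) (by linarith [div_le_self hδ0 hk']) k
  rwa [mul_neg, mul_div_cancel₀ _ (by positivity), ← sub_eq_add_neg, ← sub_eq_add_neg]
    at h_bernoulli

/- The mean value inequality on the cell of size `δ / k`, on which `defect ^ (3 * k)` is bounded
below independently of `k`. -/
lemma IsPicardGroup.exists_secNorm_le_sqNorm (hΓ : IsPicardGroup Γ) :
    ∃ C : ℝ, 0 < C ∧ ∀ k : ℕ, 1 ≤ k → ∀ ω ∈ globalSections Γ k, ∀ z,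
      secNorm k ω z ≤ C * k ^ 2 * sqNorm Γ k ω := by
  obtain ⟨δ, hδ0, hδ1, h_disj⟩ := hΓ.exists_cell_disjoint
  set V := (volume Ball).toReal
  have hV : 0 < V := ENNReal.toReal_pos volume_ball_pos.ne' volume_ball_lt_top.ne
  have hδ : 0 < 1 - δ := by linarith
  refine ⟨((1 - δ) ^ 3 * δ ^ 2 * V)⁻¹, by positivity, fun k hk ω hω z => ?_⟩
  have hk' : (1 : ℝ) ≤ k := by exact_mod_cast hk
  have hs : δ / k ≤ δ := div_le_self hδ0.le hk'
  have h_pow : (1 - δ) ^ 3 ≤ (1 - δ / k) ^ (3 * k) := by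
    rw [mul_comm, pow_mul]
    exact pow_le_pow_left₀ hδ.le (one_sub_le_one_sub_div_pow hδ0.le hδ1.le hk) 3
  have h_nonneg := secNorm_nonneg k ω z
  have h_main : (1 - δ) ^ 3 * secNorm k ω z * (δ / k) ^ 2 * V ≤ sqNorm Γ k ω :=
    le_trans (by gcongr)
      (hΓ.mul_secNorm_le_sqNorm h_disj (by positivity) (hs.trans_lt hδ1) hs hω z)
  rw [mul_assoc, ← div_eq_inv_mul, le_div_iff₀ (by positivity)]
  calc secNorm k ω z * ((1 - δ) ^ 3 * δ ^ 2 * V)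
      = k ^ 2 * ((1 - δ) ^ 3 * secNorm k ω z * (δ / k) ^ 2 * V) := by field_simp
    _ ≤ k ^ 2 * sqNorm Γ k ω := by gcongr

end Sections

/-! ### Holomorphic functions on normed spaces -/

section Holomorphic

variable {E F : Type*} [NormedAddCommGroup E] [NormedSpace ℂ E] [NormedAddCommGroup F]
  [NormedSpace ℂ F] {s U : Set E} {w z : E} {R M : ℝ}

lemma hasDerivAt_comp_line {f : E → F} {v : E} {t : ℂ} (hf : DifferentiableAt ℂ f (w + t • v)) :
    HasDerivAt (fun x : ℂ => f (w + x • v)) (fderiv ℂ f (w + t • v) v) t := by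
  have h_line : HasDerivAt (fun x : ℂ => w + x • v) v t := by
    simpa using ((hasDerivAt_id t).smul_const v).const_add w
  exact hf.hasFDerivAt.comp_hasDerivAt t h_line

lemma norm_fderiv_apply_le {f : E → F} {v : E} (hU : IsOpen U) (hf : DifferentiableOn ℂ f U)
    (hR : 0 < R) (h_mem : ∀ t : ℂ, ‖t‖ ≤ R → w + t • v ∈ U)
    (hM : ∀ t : ℂ, ‖t‖ = R → ‖f (w + t • v)‖ ≤ M) : ‖fderiv ℂ f w v‖ ≤ M / R := by
  have h_deriv (t : ℂ) (ht : ‖t‖ ≤ R) := hasDerivAt_comp_line (f := f) (w := w) (v := v) (t := t)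
    (hf.differentiableAt (hU.mem_nhds (h_mem t ht)))
  have h_zero : deriv (fun t : ℂ => f (w + t • v)) 0 = fderiv ℂ f w v := by
    rw [(h_deriv 0 (by simpa using hR.le)).deriv, zero_smul, add_zero]
  rw [← h_zero]
  refine Complex.norm_deriv_le_of_forall_mem_sphere_norm_le hR (DifferentiableOn.diffContOnCl ?_)
    fun t ht => hM t (by simpa using ht)
  rw [closure_ball _ hR.ne']
  exact fun t ht => (h_deriv t (by simpa using ht)).differentiableAt.differentiableWithinAt

lemma norm_fderiv_le_of_closedBall_subset {f : E → F} (hU : IsOpen U)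
    (hf : DifferentiableOn ℂ f U) (hR : 0 < R) (hRU : Metric.closedBall w R ⊆ U)
    (hM : ∀ x ∈ U, ‖f x‖ ≤ M) : ‖fderiv ℂ f w‖ ≤ M / R := by
  have h_nonneg : 0 ≤ M := (norm_nonneg _).trans (hM w (hRU (Metric.mem_closedBall_self hR.le)))
  refine ContinuousLinearMap.opNorm_le_of_unit_norm (𝕜 := ℂ) (by positivity) fun v hv => ?_
  have h_mem (t : ℂ) (ht : ‖t‖ ≤ R) : w + t • v ∈ U := hRU (by simpa [norm_smul, hv] using ht)
  exact norm_fderiv_apply_le hU hf hR h_mem fun t ht => hM _ (h_mem t ht.le)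

lemma uniformCauchySeqOn_fderiv {ι : Type*} {l : Filter ι} {f : ι → E → F} (hU : IsOpen U)
    (hf : ∀ i, DifferentiableOn ℂ (f i) U) (h : UniformCauchySeqOn f l U) (hR : 0 < R)
    (hRU : ∀ w ∈ s, Metric.closedBall w R ⊆ U) :
    UniformCauchySeqOn (fun i => fderiv ℂ (f i)) l s := by
  rw [SeminormedAddGroup.uniformCauchySeqOn_iff_tendstoUniformlyOn_zero,
    Metric.tendstoUniformlyOn_iff] at *
  intro ε hε
  filter_upwards [h (ε / 2 * R) (by positivity)] with i hi w hw
  have h_nhds : U ∈ 𝓝 w := hU.mem_nhds (hRU w hw (Metric.mem_closedBall_self hR.le))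
  have h_diff (j) := (hf j).differentiableAt h_nhds
  rw [Pi.zero_apply, dist_zero_left, ← fderiv_neg, ← fderiv_add (h_diff _).neg (h_diff _)]
  calc ‖fderiv ℂ (-f i.1 + f i.2) w‖ ≤ ε / 2 * R / R := by
        refine norm_fderiv_le_of_closedBall_subset hU ((hf _).neg.add (hf _)) hR (hRU w hw)
          fun x hx => ?_
        simpa using (hi x hx).le
    _ = ε / 2 := mul_div_cancel_right₀ _ hR.ne'
    _ < ε := half_lt_self hε

variable [CompleteSpace F]

lemma differentiableAt_of_tendstoUniformlyOn {ι : Type*} {l : Filter ι} [l.NeBot]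
    {f : ι → E → F} {g : E → F} (hf : ∀ i, DifferentiableOn ℂ (f i) U)
    (hfg : TendstoUniformlyOn f g l U) (hz : U ∈ 𝓝 z) : DifferentiableAt ℂ g z := by
  obtain ⟨R, hR, hRU⟩ := Metric.mem_nhds_iff.1 hz
  have h_cauchy : UniformCauchySeqOn (fun i => fderiv ℂ (f i)) l (Metric.ball z (R / 2)) := by
    refine uniformCauchySeqOn_fderiv Metric.isOpen_ball (fun i => (hf i).mono hRU)
      (hfg.mono hRU).uniformCauchySeqOn (R := R / 4) (by positivity) fun w hw =>
      Metric.closedBall_subset_ball' ?_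
    linarith [Metric.mem_ball.1 hw]
  choose! g' hg' using fun w (hw : w ∈ Metric.ball z (R / 2)) =>
    CompleteSpace.complete (h_cauchy.cauchy_map hw)
  have h_sub : Metric.ball z (R / 2) ⊆ Metric.ball z R := Metric.ball_subset_ball (by linarith)
  exact (hasFDerivAt_of_tendstoUniformlyOn Metric.isOpen_ball
    (h_cauchy.tendstoUniformlyOn_of_tendsto hg')
    (fun i w hw => ((hf i).differentiableAt
      (Filter.mem_of_superset (Metric.isOpen_ball.mem_nhds (h_sub hw)) hRU)).hasFDerivAt)
    (fun w hw => hfg.tendsto_at (hRU (h_sub hw)))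
    (Metric.mem_ball_self (by positivity))).differentiableAt

lemma differentiableAt_tsum {ι : Type*} {f : ι → E → F} {u : ι → ℝ} (hu : Summable u)
    (hf : ∀ i, DifferentiableOn ℂ (f i) U) (hfu : ∀ i, ∀ x ∈ U, ‖f i x‖ ≤ u i) (hz : U ∈ 𝓝 z) :
    DifferentiableAt ℂ (fun x => ∑' i, f i x) z :=
  differentiableAt_of_tendstoUniformlyOn (fun _ => DifferentiableOn.fun_sum fun i _ => hf i)
    (tendstoUniformlyOn_tsum hu hfu) hz

-- Two applications of the Schwarz lemma, to `g` and to its difference quotient.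
lemma dist_dslope_deriv_le {g : ℂ → F} {c t : ℂ} (hg : DifferentiableOn ℂ g (Metric.ball c R))
    (hM : ∀ x ∈ Metric.ball c R, ‖g x‖ ≤ M) (ht : t ∈ Metric.ball c R) :
    dist (dslope g c t) (deriv g c) ≤ (2 * M / R + 2 * M / R) / R * dist t c := by
  have hR : 0 < R := Metric.nonempty_ball.1 ⟨t, ht⟩
  have hc : c ∈ Metric.ball c R := Metric.mem_ball_self hR
  have h_slope (x) (hx : x ∈ Metric.ball c R) : ‖dslope g c x‖ ≤ 2 * M / R := by
    refine Complex.norm_dslope_le_div_of_mapsTo_ball hg (fun y hy => ?_) hx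
    rw [mem_closedBall_iff_norm]
    linarith [norm_sub_le (g y) (g c), hM y hy, hM c hc]
  rw [← dslope_same]
  refine Complex.dist_le_div_mul_dist_of_mapsTo_ball
    ((Complex.differentiableOn_dslope (Metric.ball_mem_nhds c hR)).2 hg) (fun y hy => ?_) ht
  rw [mem_closedBall_iff_norm]
  exact (norm_sub_le _ _).trans (add_le_add (h_slope y hy) (h_slope c hc))

lemma eventually_add_smul_mem {s : Set E} (hs : s ∈ 𝓝 z) (v : E) :
    ∀ᶠ p : E × ℂ in 𝓝 (z, 0), p.1 + p.2 • v ∈ s := by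
  have h_cont : ContinuousAt (fun p : E × ℂ => p.1 + p.2 • v) (z, 0) := by fun_prop
  exact h_cont.eventually_mem (by simpa using hs)

lemma differentiableAt_fderiv_apply {f : E → F} (hU : IsOpen U) (hf : DifferentiableOn ℂ f U)
    (hz : z ∈ U) (v : E) : DifferentiableAt ℂ (fun w => fderiv ℂ f w v) z := by
  set M := ‖f z‖ + 1
  have h_cont : ContinuousAt f z := hf.continuousOn.continuousAt (hU.mem_nhds hz)
  have h_near : {w | w ∈ U ∧ ‖f w‖ < M} ∈ 𝓝 z :=
    Filter.inter_mem (hU.mem_nhds hz) (h_cont.norm.eventually_lt continuousAt_const (lt_add_one _))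
  obtain ⟨R, hR, h_ball⟩ := Metric.eventually_nhds_iff_ball.1 (eventually_add_smul_mem h_near v)
  have h_mem {w : E} (hw : w ∈ Metric.ball z R) {t : ℂ} (ht : t ∈ Metric.ball 0 R) :
      w + t • v ∈ U ∧ ‖f (w + t • v)‖ < M := h_ball (w, t) (by simp_all [Prod.dist_eq])
  have h_diff {w : E} (hw : w ∈ Metric.ball z R) {t : ℂ} (ht : t ∈ Metric.ball 0 R) :=
    hf.differentiableAt (hU.mem_nhds (h_mem hw ht).1)
  obtain ⟨t, -, ht, h_tendsto⟩ := exists_seq_strictAnti_tendsto' hR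
  have ht_mem (n) : (t n : ℂ) ∈ Metric.ball 0 R := by
    simpa [abs_of_pos (ht n).1] using (ht n).2
  have h_zero : (0 : ℂ) ∈ Metric.ball 0 R := Metric.mem_ball_self hR
  refine differentiableAt_of_tendstoUniformlyOn (U := Metric.ball z R) (l := Filter.atTop)
    (f := fun n w => (t n : ℂ)⁻¹ • (f (w + (t n : ℂ) • v) - f w)) (fun n w hw => ?_) ?_
    (Metric.ball_mem_nhds z hR)
  · have h_shift : DifferentiableAt ℂ (fun x => f (x + (t n : ℂ) • v)) w :=
      (h_diff hw (ht_mem n)).comp w (differentiableAt_id.add_const _)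
    have h_here : DifferentiableAt ℂ f w := by simpa using h_diff hw h_zero
    exact ((h_shift.sub h_here).const_smul _).differentiableWithinAt
  · have h_lim : Filter.Tendsto (fun n => (2 * M / R + 2 * M / R) / R * dist (t n : ℂ) 0)
        Filter.atTop (𝓝 0) := by
      simpa using (h_tendsto.abs.const_mul _)
    rw [Metric.tendstoUniformlyOn_iff]
    intro ε hε
    filter_upwards [h_lim.eventually_lt_const hε] with n hn w hw
    have h_slope := dist_dslope_deriv_le
      (fun x hx => (hasDerivAt_comp_line (h_diff hw hx)).differentiableAt.differentiableWithinAt)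
      (fun x hx => (h_mem hw hx).2.le) (ht_mem n)
    rw [(hasDerivAt_comp_line (h_diff hw h_zero)).deriv,
      dslope_of_ne _ (by exact_mod_cast (ht n).1.ne'), slope_def_module, zero_smul, sub_zero,
      add_zero, dist_comm] at h_slope
    exact h_slope.trans_lt hn

end Holomorphic

/-! ### Poincaré series -/

section PoincareSeries

variable {Γ : Subgroup SU21} {k : ℕ}

/-- The kernel `(1 - ⟨z, w⟩) ^ (-n)` of weight `n` with pole at the reflection of `w`; for `n = 3 k`
it is, up to a factor, the Bergman kernel of the ball. -/
def ballKernel (w : Ball) (n : ℕ) (z : Fin 2 → ℂ) : ℂ := (herm (lift z) (lift w.1) ^ n)⁻¹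

lemma differentiableOn_ballKernel (w : Ball) (n : ℕ) :
    DifferentiableOn ℂ (ballKernel w n) Ball := by
  have h_herm : Differentiable ℂ fun z => herm (lift z) (lift w.1) := by
    simp only [herm_apply, lift, Matrix.cons_val]
    fun_prop
  exact (h_herm.differentiableOn.pow n).inv fun z hz => pow_ne_zero n (herm_lift_ne_zero ⟨z, hz⟩ w)

lemma slash_mul (g h : SU21) (n : ℕ) (f : (Fin 2 → ℂ) → ℂ) (z : Ball) :
    slash (g * h) n f z.1 = (autFactor h z.1 ^ n)⁻¹ * slash g n f (h • z).1 := by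
  rw [slash, slash, autFactor_mul, ← coe_smul, ← coe_smul, mul_smul, mul_pow, mul_inv_rev,
    mul_smul, smul_eq_mul]

lemma norm_slash_ballKernel (g : SU21) (w z : Ball) (n : ℕ) :
    ‖slash g n (ballKernel w n) z.1‖
      = prox (g • z) w ^ n / (√(defect z.1) * √(defect w.1)) ^ n := by
  have h_aut := norm_pos_iff.2 (autFactor_ne_zero g z)
  have h_herm := norm_pos_iff.2 (herm_lift_ne_zero (g • z) w)
  have h_smul := Real.sqrt_pos.2 (defect_pos (g • z))
  have h_w := Real.sqrt_pos.2 (defect_pos w)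
  rw [slash, smul_eq_mul, ballKernel, ← coe_smul, ← sqrt_defect_smul g z, prox, ← div_pow,
    ← mul_inv, ← mul_pow,
    norm_inv, norm_pow, norm_mul, ← inv_pow]
  congr 1
  field_simp

lemma IsPicardGroup.exists_tsum_prox_pow_le (hΓ : IsPicardGroup Γ) :
    ∃ C : ℝ, 0 ≤ C ∧ ∀ n, 6 ≤ n → ∀ z w : Ball, Summable (fun γ : Γ => prox (γ • z) w ^ n) ∧
      ∑' γ : Γ, prox (γ • z) w ^ n ≤ C := by
  obtain ⟨C, hC0, hC⟩ := hΓ.exists_tsum_prox_pow_six_le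
  refine ⟨C, hC0, fun n hn z w => ?_⟩
  have h_le (γ : Γ) : prox (γ • z) w ^ n ≤ prox (γ • z) w ^ 6 :=
    pow_le_pow_of_le_one (prox_pos _ _).le (prox_le_one _ _) hn
  have h_summable : Summable fun γ : Γ => prox (γ • z) w ^ n :=
    (hC z w).1.of_nonneg_of_le (fun γ => (pow_pos (prox_pos _ _) n).le) h_le
  exact ⟨h_summable, (h_summable.tsum_le_tsum h_le (hC z w).1).trans (hC z w).2⟩

-- The identity contributes `1`; all other terms are at most `c ^ m * prox ^ 6` for some `c < 1`.
lemma IsPicardGroup.exists_tsum_prox_pow_le_one_add (hΓ : IsPicardGroup Γ) {ε : ℝ} (hε : 0 < ε) :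
    ∃ n₀ : ℕ, ∀ n, n₀ ≤ n → ∀ w : Ball, ∑' γ : Γ, prox (γ • w) w ^ n ≤ 1 + ε := by
  classical
  obtain ⟨C, hC0, hC⟩ := hΓ.exists_tsum_prox_pow_le
  obtain ⟨c, hc0, hc1, h_gap⟩ := hΓ.exists_prox_smul_le
  obtain ⟨m, hm⟩ := exists_pow_lt_of_lt_one (show 0 < ε / (C + 1) by positivity) hc1
  refine ⟨m + 6, fun n hn w => ?_⟩
  have h_term (γ : Γ) :
      prox (γ • w) w ^ n ≤ (if γ = 1 then 1 else 0) + c ^ m * prox (γ • w) w ^ 6 := by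
    have h_prox := prox_pos (γ • w) w
    split_ifs with hγ
    · linarith [pow_le_one₀ (n := n) h_prox.le (prox_le_one (γ • w) w),
        show 0 ≤ c ^ m * prox (γ • w) w ^ 6 by positivity]
    · calc prox (γ • w) w ^ n ≤ prox (γ • w) w ^ (m + 6) :=
            pow_le_pow_of_le_one h_prox.le (prox_le_one _ _) hn
        _ = prox (γ • w) w ^ m * prox (γ • w) w ^ 6 := pow_add _ _ _
        _ ≤ 0 + c ^ m * prox (γ • w) w ^ 6 := by
          rw [zero_add]
          gcongr
          exact h_gap γ hγ w
  have h_one : HasSum (fun γ : Γ => if γ = 1 then (1 : ℝ) else 0) 1 := hasSum_ite_eq 1 1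
  have h_sum := h_one.add ((hC 6 le_rfl w w).1.hasSum.mul_left (c ^ m))
  calc ∑' γ : Γ, prox (γ • w) w ^ n ≤ 1 + c ^ m * ∑' γ : Γ, prox (γ • w) w ^ 6 :=
        hasSum_le h_term (hC n (by lia) w w).1.hasSum h_sum
    _ ≤ 1 + ε / (C + 1) * C := by
        gcongr
        exact (hC 6 le_rfl w w).2
    _ ≤ 1 + ε := by
        rw [div_mul_eq_mul_div]
        gcongr
        exact div_le_of_le_mul₀ (by positivity) hε.le (by gcongr; linarith)

lemma two_mul_norm_le_norm_tsum_add_tsum_norm {ι E : Type*} [NormedAddCommGroup E]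
    [CompleteSpace E] {f : ι → E} (hf : Summable fun i => ‖f i‖) (a : ι) :
    2 * ‖f a‖ ≤ ‖∑' i, f i‖ + ∑' i, ‖f i‖ := by
  classical
  have h_ite (i) : ‖if i = a then 0 else f i‖ = if i = a then 0 else ‖f i‖ := by
    split_ifs <;> simp
  have h_summable : Summable fun i => ‖if i = a then 0 else f i‖ :=
    hf.of_nonneg_of_le (fun _ => norm_nonneg _) fun i => by split_ifs <;> simp
  have h_rest := norm_tsum_le_tsum_norm h_summable
  have h_sub := norm_sub_le (∑' i, f i) (∑' i, if i = a then 0 else f i)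
  simp_rw [h_ite] at h_rest
  rw [hf.of_norm.tsum_eq_add_tsum_ite a, add_sub_cancel_right] at h_sub
  rw [hf.of_norm.tsum_eq_add_tsum_ite a, hf.tsum_eq_add_tsum_ite a]
  linarith

/-- The Poincaré series of weight `3 k`, the average over `Γ` of the kernel with base point `w`. -/
def poincare (Γ : Subgroup SU21) (k : ℕ) (w : Ball) (z : Ball) : CanPow k :=
  (∑' γ : Γ, slash γ (3 * k) (ballKernel w (3 * k)) z.1) • stdPow k

lemma coefFun_poincare (w z : Ball) :
    coefFun k (poincare Γ k w) z = ∑' γ : Γ, slash γ (3 * k) (ballKernel w (3 * k)) z.1 := by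
  rw [coefFun, poincare, map_smul, coeff_stdPow, smul_eq_mul, mul_one]

lemma IsPicardGroup.summable_norm_slash_ballKernel (hΓ : IsPicardGroup Γ) {n : ℕ} (hn : 6 ≤ n)
    (w z : Ball) : Summable fun γ : Γ => ‖slash γ n (ballKernel w n) z.1‖ := by
  obtain ⟨C, -, hC⟩ := hΓ.exists_tsum_prox_pow_le
  simp_rw [norm_slash_ballKernel]
  exact (hC n hn z w).1.div_const _

lemma norm_slash_ballKernel_le {p z : Ball} (w : Ball) (g : SU21) (n : ℕ)
    (h_prox : 1 / 2 ≤ prox p z) (h_defect : defect p.1 / 2 ≤ defect z.1) :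
    ‖slash g n (ballKernel w n) z.1‖
      ≤ (4 * prox (g • p) w) ^ n / (√(defect p.1 / 2) * √(defect w.1)) ^ n := by
  have h_p := Real.sqrt_pos.2 (half_pos (defect_pos p))
  have h_w := Real.sqrt_pos.2 (defect_pos w)
  have h_z := prox_pos (g • z) w
  have h_gp := prox_pos (g • p) w
  have h_harnack := prox_mul_prox_le (g • z) w (g • p)
  rw [prox_smul] at h_harnack
  rw [norm_slash_ballKernel]
  gcongr
  nlinarith

lemma IsPicardGroup.differentiableOn_tsum_slash_ballKernel (hΓ : IsPicardGroup Γ) {n : ℕ}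
    (hn : 6 ≤ n) (w : Ball) :
    DifferentiableOn ℂ (fun z => ∑' γ : Γ, slash γ n (ballKernel w n) z) Ball := by
  intro p hp
  obtain ⟨C, -, hC⟩ := hΓ.exists_tsum_prox_pow_le
  set U : Set Ball := {z | 1 / 2 < prox ⟨p, hp⟩ z ∧ defect p / 2 < defect z.1}
  have hU : IsOpen U := (isOpen_lt continuous_const (continuous_prox continuous_const
    continuous_id)).inter (isOpen_lt continuous_const
      (continuous_defect.comp continuous_subtype_val))
  have hpU : (⟨p, hp⟩ : Ball) ∈ U :=
    ⟨by rw [prox_self]; norm_num, half_lt_self (defect_pos ⟨p, hp⟩)⟩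
  refine (differentiableAt_tsum (U := Subtype.val '' U)
    (u := fun γ : Γ => (4 * prox (γ • ⟨p, hp⟩) w) ^ n / (√(defect p / 2) * √(defect w.1)) ^ n) ?_
    (fun γ => (differentiableOn_slash γ.1 n (differentiableOn_ballKernel w n)).mono
      (Subtype.coe_image_subset _ _)) ?_
    ((isOpen_ball.isOpenMap_subtype_val U hU).mem_nhds ⟨_, hpU, rfl⟩)).differentiableWithinAt
  · simp_rw [mul_pow]
    exact ((hC n hn _ w).1.mul_left _).div_const _
  · rintro γ _ ⟨z, hz, rfl⟩
    exact norm_slash_ballKernel_le w γ.1 n hz.1.le hz.2.le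

lemma IsPicardGroup.poincare_mem (hΓ : IsPicardGroup Γ) (hk : 2 ≤ k) (w : Ball) :
    poincare Γ k w ∈ globalSections Γ k := by
  refine mem_globalSections.2 ⟨?_, fun β z => ?_⟩
  · refine (hΓ.differentiableOn_tsum_slash_ballKernel (n := 3 * k) (by lia) w).congr fun z hz => ?_
    rw [ext0_apply _ hz, coefFun_poincare]
  · rw [coefFun_poincare, coefFun_poincare, ← tsum_mul_left, ← (Equiv.mulRight β).tsum_eq
      fun γ : Γ => autFactor β z.1 ^ (3 * k) * slash γ (3 * k) (ballKernel w (3 * k)) z.1]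
    refine tsum_congr fun γ => ?_
    rw [Equiv.coe_mulRight, Subgroup.coe_mul, slash_mul,
      mul_inv_cancel_left₀ (pow_ne_zero _ (autFactor_ne_zero β.1 z)), Subgroup.smul_def]

lemma sqrt_defect_pow_sq (z : Ball) (n : ℕ) : (√(defect z.1) ^ n) ^ 2 = defect z.1 ^ n := by
  rw [pow_right_comm, Real.sq_sqrt (defect_pos z).le]

lemma secNorm_eq_sq (η : Ball → CanPow k) (z : Ball) :
    secNorm k η z = (√(defect z.1) ^ (3 * k) * ‖coefFun k η z‖) ^ 2 := by
  rw [secNorm, mul_pow, sqrt_defect_pow_sq]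

lemma IsPicardGroup.defect_pow_mul_secNorm_poincare_le (hΓ : IsPicardGroup Γ) (hk : 2 ≤ k)
    (w z : Ball) : defect w.1 ^ (3 * k) * secNorm k (poincare Γ k w) z
      ≤ (∑' γ : Γ, prox (γ • z) w ^ (3 * k)) ^ 2 := by
  have h_z := Real.sqrt_pos.2 (defect_pos z)
  have h_w := Real.sqrt_pos.2 (defect_pos w)
  have h_norm := norm_tsum_le_tsum_norm
    (hΓ.summable_norm_slash_ballKernel (show 6 ≤ 3 * k by lia) w z)
  simp_rw [norm_slash_ballKernel] at h_norm
  rw [tsum_div_const, ← coefFun_poincare, le_div_iff₀ (by positivity)] at h_norm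
  rw [secNorm_eq_sq, ← sqrt_defect_pow_sq w, ← mul_pow]
  gcongr
  refine le_of_eq_of_le ?_ h_norm
  rw [mul_pow]
  ring

lemma IsPicardGroup.exists_le_secNorm_poincare (hΓ : IsPicardGroup Γ) :
    ∃ k₁ : ℕ, 3 ≤ k₁ ∧ ∀ k, k₁ ≤ k → ∀ w,
      1 / 4 ≤ defect w.1 ^ (3 * k) * secNorm k (poincare Γ k w) w := by
  obtain ⟨n₀, h_tail⟩ := hΓ.exists_tsum_prox_pow_le_one_add (show (0 : ℝ) < 1 / 2 by norm_num)
  refine ⟨n₀ + 3, by lia, fun k hk w => ?_⟩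
  have h_pos : 0 < defect w.1 ^ (3 * k) := pow_pos (defect_pos w) _
  have h_norm := two_mul_norm_le_norm_tsum_add_tsum_norm
    (hΓ.summable_norm_slash_ballKernel (show 6 ≤ 3 * k by lia) w w) 1
  simp_rw [norm_slash_ballKernel] at h_norm
  rw [tsum_div_const, ← coefFun_poincare, Subgroup.coe_one, one_smul, prox_self, one_pow,
    Real.mul_self_sqrt (defect_pos w).le] at h_norm
  have h_half : 1 / 2 ≤ defect w.1 ^ (3 * k) * ‖coefFun k (poincare Γ k w) w‖ := by
    have h_sum : ∑' γ : Γ, prox (γ.1 • w) w ^ (3 * k) ≤ 3 / 2 :=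
      (h_tail (3 * k) (by lia) w).trans_eq (by norm_num)
    have h_div := h_norm.trans (add_le_add le_rfl ((div_le_div_iff_of_pos_right h_pos).2 h_sum))
    rw [← mul_one_div (3 / 2)] at h_div
    have h_le : 1 / 2 * (1 / defect w.1 ^ (3 * k)) ≤ ‖coefFun k (poincare Γ k w) w‖ := by linarith
    rwa [mul_one_div, div_le_iff₀' h_pos] at h_le
  calc (1 / 4 : ℝ) = (1 / 2) ^ 2 := by norm_num
    _ ≤ (defect w.1 ^ (3 * k) * ‖coefFun k (poincare Γ k w) w‖) ^ 2 := by gcongr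
    _ = _ := by rw [secNorm]; ring

lemma sqrt_defect_le_exp (z : Fin 2 → ℂ) : √(defect z) ≤ Real.exp ((defect z - 1) / 2) := by
  rw [Real.exp_half]
  exact Real.sqrt_le_sqrt (by linarith [Real.add_one_le_exp (defect z - 1)])

lemma integrable_exp_defect : Integrable fun z : Fin 2 → ℂ => Real.exp ((defect z - 1) / 2) := by
  have h_plane : Integrable fun z : ℂ => Real.exp (-(‖z‖ ^ 2) / 2) := by
    refine (GaussianFourier.integrable_cexp_neg_mul_sq_norm_add (b := 1 / 2) (by norm_num) 0
      (0 : ℂ)).norm.congr (.of_forall fun z => ?_)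
    simp [Complex.norm_exp, ← Complex.ofReal_pow]
    ring
  refine (Integrable.fintype_prod (𝕜 := ℝ) (ι := Fin 2) fun _ => h_plane).congr
    (.of_forall fun z => ?_)
  simp only [Fin.prod_univ_two, ← Real.exp_add, defect]
  ring_nf

lemma exp_defect_pow (k : ℕ) (z : Fin 2 → ℂ) :
    Real.exp ((defect z - 1) / 2) ^ k = Real.exp ((defect (√(k : ℝ) • z) - 1) / 2) := by
  have h_smul := one_sub_defect_smul (√(k : ℝ) : ℂ) z
  rw [Complex.coe_smul, Complex.norm_real, Real.norm_eq_abs, sq_abs,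
    Real.sq_sqrt k.cast_nonneg] at h_smul
  rw [← Real.exp_nat_mul]
  congr 1
  linarith

lemma integral_exp_defect_smul {c : ℝ} (hc : 0 < c) :
    ∫ z : Fin 2 → ℂ, Real.exp ((defect (√c • z) - 1) / 2)
      = (∫ z : Fin 2 → ℂ, Real.exp ((defect z - 1) / 2)) / c ^ 2 := by
  have h_finrank : Module.finrank ℝ (Fin 2 → ℂ) = 2 * 2 := by
    simp [Module.finrank_pi_fintype, Complex.finrank_real_complex]
  rw [Measure.integral_comp_smul volume (fun z : Fin 2 → ℂ => Real.exp ((defect z - 1) / 2)),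
    h_finrank, pow_mul, Real.sq_sqrt hc.le, abs_of_pos (by positivity), smul_eq_mul,
    inv_mul_eq_div]

lemma exists_lintegral_sqrt_defect_pow_le :
    ∃ K : ℝ, 0 < K ∧ ∀ k p : ℕ, 1 ≤ k → k ≤ p →
      ∫⁻ ζ in Ball, ENNReal.ofReal (√(defect ζ) ^ p) ≤ ENNReal.ofReal (K / k ^ 2) := by
  refine ⟨∫ z : Fin 2 → ℂ, Real.exp ((defect z - 1) / 2), integral_exp_pos integrable_exp_defect,
    fun k p hk hp => ?_⟩
  have hk0 : (0 : ℝ) < k := by exact_mod_cast hk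
  have h_pow (ζ : Fin 2 → ℂ) :
      √(defect ζ) ^ p ≤ Real.exp ((defect (√(k : ℝ) • ζ) - 1) / 2) :=
    calc √(defect ζ) ^ p ≤ √(defect ζ) ^ k :=
          pow_le_pow_of_le_one (Real.sqrt_nonneg _) (Real.sqrt_le_one.2 (defect_le_one ζ)) hp
      _ ≤ Real.exp ((defect ζ - 1) / 2) ^ k := by
          gcongr
          exact sqrt_defect_le_exp ζ
      _ = _ := exp_defect_pow k ζ
  calc ∫⁻ ζ in Ball, ENNReal.ofReal (√(defect ζ) ^ p)
      ≤ ∫⁻ ζ, ENNReal.ofReal (Real.exp ((defect (√(k : ℝ) • ζ) - 1) / 2)) :=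
        (setLIntegral_le_lintegral _ _).trans
          (lintegral_mono fun ζ => ENNReal.ofReal_le_ofReal (h_pow ζ))
    _ = ENNReal.ofReal (∫ ζ : Fin 2 → ℂ, Real.exp ((defect (√(k : ℝ) • ζ) - 1) / 2)) :=
        (ofReal_integral_eq_lintegral_ofReal
          (integrable_exp_defect.comp_smul (Real.sqrt_pos.2 hk0).ne')
          (.of_forall fun z => (Real.exp_pos _).le)).symm
    _ = _ := by rw [integral_exp_defect_smul hk0]

lemma IsPicardGroup.exists_sqNorm_poincare_le (hΓ : IsPicardGroup Γ) :
    ∃ K : ℝ, 0 < K ∧ ∀ k, 3 ≤ k → ∀ w,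
      defect w.1 ^ (3 * k) * sqNorm Γ k (poincare Γ k w) ≤ K / k ^ 2 := by
  have := countable_of_discreteTopology hΓ.discrete
  obtain ⟨C, hC0, hC⟩ := hΓ.exists_tsum_prox_pow_le
  obtain ⟨K, hK0, hK⟩ := exists_lintegral_sqrt_defect_pow_le
  refine ⟨(C + 1) * K, by positivity, fun k hk w => ?_⟩
  have h_pos := pow_pos (defect_pos w) (3 * k)
  have h_summable (z : Ball) := (hC (3 * k) (by lia) z w).1
  have h_nonneg (z : Ball) (γ : Γ) := (pow_pos (prox_pos (γ • z) w) (3 * k)).le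
  have h_point (z : Ball) : defect w.1 ^ (3 * k) * secNorm k (poincare Γ k w) z
      ≤ (C + 1) * ∑' γ : Γ, prox (γ • z) w ^ (3 * k) := by
    have h_tsum : 0 ≤ ∑' γ : Γ, prox (γ • z) w ^ (3 * k) := tsum_nonneg (h_nonneg z)
    refine (hΓ.defect_pow_mul_secNorm_poincare_le (by lia) w z).trans ?_
    rw [sq]
    gcongr
    linarith [(hC (3 * k) (by lia) z w).2]
  rw [← ENNReal.ofReal_le_ofReal_iff (by positivity), ENNReal.ofReal_mul h_pos.le,
    hΓ.ofReal_sqNorm (hΓ.poincare_mem (by lia) w), ← lintegral_const_mul' _ _ ENNReal.ofReal_ne_top]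
  calc ∫⁻ z in fundDomain Γ, ENNReal.ofReal (defect w.1 ^ (3 * k))
        * ENNReal.ofReal (secNorm k (poincare Γ k w) z) ∂hypMeasure
      ≤ ∫⁻ z in fundDomain Γ, ENNReal.ofReal (C + 1)
        * ∑' γ : Γ, ENNReal.ofReal (prox (γ • z) w ^ (3 * k)) ∂hypMeasure := by
        refine lintegral_mono fun z => ?_
        rw [← ENNReal.ofReal_mul h_pos.le, ← ENNReal.ofReal_tsum_of_nonneg (h_nonneg z)
          (h_summable z), ← ENNReal.ofReal_mul (by positivity)]
        exact ENNReal.ofReal_le_ofReal (h_point z)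
    _ = ENNReal.ofReal (C + 1) * ∫⁻ ζ, ENNReal.ofReal (prox ζ w ^ (3 * k)) ∂hypMeasure := by
        rw [lintegral_const_mul' _ _ ENNReal.ofReal_ne_top,
          hΓ.lintegral_unfold (measurable_ofReal_prox_pow _ w)]
    _ ≤ ENNReal.ofReal (C + 1) * ENNReal.ofReal (K / k ^ 2) := by
        obtain ⟨p, hp⟩ := Nat.exists_eq_add_of_le (show 6 ≤ 3 * k by lia)
        rw [hp, lintegral_prox_pow]
        gcongr
        exact hK k _ (by lia) (by lia)
    _ = _ := by rw [← ENNReal.ofReal_mul (by positivity), mul_div_assoc]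

lemma IsPicardGroup.exists_peak_section (hΓ : IsPicardGroup Γ) :
    ∃ k₁ : ℕ, 3 ≤ k₁ ∧ ∃ c : ℝ, 0 < c ∧ ∀ k, k₁ ≤ k → ∀ w, ∃ η ∈ globalSections Γ k,
      0 < secNorm k η w ∧ c * k ^ 2 * sqNorm Γ k η ≤ secNorm k η w := by
  obtain ⟨k₁, hk₁, h_lower⟩ := hΓ.exists_le_secNorm_poincare
  obtain ⟨K, hK0, h_upper⟩ := hΓ.exists_sqNorm_poincare_le
  refine ⟨k₁, hk₁, 1 / (4 * K), by positivity, fun k hk w =>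
    ⟨_, hΓ.poincare_mem (by lia) w, ?_, ?_⟩⟩
  · exact pos_of_mul_pos_right ((by norm_num : (0 : ℝ) < 1 / 4).trans_le (h_lower k hk w))
      (pow_pos (defect_pos w) _).le
  · have hk0 : (0 : ℝ) < k := by exact_mod_cast (by lia : 0 < k)
    refine le_of_mul_le_mul_left ?_ (pow_pos (defect_pos w) (3 * k))
    calc defect w.1 ^ (3 * k) * (1 / (4 * K) * k ^ 2 * sqNorm Γ k (poincare Γ k w))
        = 1 / (4 * K) * k ^ 2 * (defect w.1 ^ (3 * k) * sqNorm Γ k (poincare Γ k w)) := by ring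
      _ ≤ 1 / (4 * K) * k ^ 2 * (K / k ^ 2) := by
          gcongr
          exact h_upper k (by lia) w
      _ = 1 / 4 := by field_simp
      _ ≤ _ := h_lower k hk w

end PoincareSeries

/-! ### Orthonormal bases and the Bergman kernel on the diagonal -/

section BergmanKernel

variable {Γ : Subgroup SU21} {k : ℕ}

lemma coefFun_add (ω η : Ball → CanPow k) (z : Ball) :
    coefFun k (ω + η) z = coefFun k ω z + coefFun k η z := map_add (coeff k) _ _

lemma coefFun_smul (c : ℂ) (ω : Ball → CanPow k) (z : Ball) :
    coefFun k (c • ω) z = c * coefFun k ω z := map_smul (coeff k) _ _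

lemma coefFun_sum {ι : Type*} (s : Finset ι) (a : ι → ℂ) (ω : ι → Ball → CanPow k) (z : Ball) :
    coefFun k (∑ i ∈ s, a i • ω i) z = ∑ i ∈ s, a i * coefFun k (ω i) z := by
  rw [coefFun, Finset.sum_apply, map_sum]
  simp [coefFun]

lemma fiberInner_eq (ω η : Ball → CanPow k) (z : Ball) :
    fiberInner k z.1 (ω z) (η z)
      = (defect z.1 : ℂ) ^ (3 * k) * (coefFun k ω z * conj (coefFun k η z)) := rfl

lemma fiberInner_self (ω : Ball → CanPow k) (z : Ball) :
    fiberInner k z.1 (ω z) (ω z) = (secNorm k ω z : ℂ) := by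
  rw [fiberInner_eq, Complex.mul_conj', secNorm]
  push_cast
  rfl

lemma hypInner_self (ω : Ball → CanPow k) : hypInner Γ k ω ω = (sqNorm Γ k ω : ℂ) := by
  rw [hypInner, sqNorm, ← integral_complex_ofReal]
  simp_rw [fiberInner_self]

lemma norm_fiberInner_le (ω η : Ball → CanPow k) (z : Ball) :
    ‖fiberInner k z.1 (ω z) (η z)‖ ≤ secNorm k ω z + secNorm k η z := by
  have h_pos := pow_pos (defect_pos z) (3 * k)
  rw [fiberInner_eq, norm_mul, norm_mul, norm_pow, Complex.norm_real, Complex.norm_conj,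
    Real.norm_of_nonneg (defect_pos z).le, secNorm, secNorm, ← mul_add]
  gcongr
  linarith [two_mul_le_add_sq ‖coefFun k ω z‖ ‖coefFun k η z‖, sq_nonneg ‖coefFun k ω z‖,
    sq_nonneg ‖coefFun k η z‖]

lemma IsPicardGroup.integrableOn_fiberInner (hΓ : IsPicardGroup Γ) {ω η : Ball → CanPow k}
    (hω : ω ∈ globalSections Γ k) (hη : η ∈ globalSections Γ k) :
    IntegrableOn (fun z : Ball => fiberInner k z.1 (ω z) (η z)) (fundDomain Γ) hypMeasure := by
  obtain ⟨M, hM⟩ := hΓ.exists_secNorm_le hω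
  obtain ⟨N, hN⟩ := hΓ.exists_secNorm_le hη
  refine hΓ.integrableOn_of_bounded ?_ fun z =>
    (norm_fiberInner_le ω η z).trans (add_le_add (hM z) (hN z))
  have h_defect : Continuous fun z : Ball => (defect z.1 : ℂ) :=
    Complex.continuous_ofReal.comp (continuous_defect.comp continuous_subtype_val)
  exact (h_defect.pow _).mul
    ((continuous_coefFun hω).mul (Complex.continuous_conj.comp (continuous_coefFun hη)))

lemma conj_hypInner (ω η : Ball → CanPow k) : conj (hypInner Γ k ω η) = hypInner Γ k η ω := by
  rw [hypInner, ← integral_conj, hypInner]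
  congr 1
  ext z
  rw [fiberInner_eq, fiberInner_eq]
  simp only [map_mul, map_pow, Complex.conj_ofReal, Complex.conj_conj]
  ring

lemma IsPicardGroup.hypInner_add_right (hΓ : IsPicardGroup Γ) {ω η θ : Ball → CanPow k}
    (hω : ω ∈ globalSections Γ k) (hη : η ∈ globalSections Γ k) (hθ : θ ∈ globalSections Γ k) :
    hypInner Γ k ω (η + θ) = hypInner Γ k ω η + hypInner Γ k ω θ := by
  rw [hypInner, hypInner, hypInner, ← integral_add
    (hΓ.integrableOn_fiberInner hω hη) (hΓ.integrableOn_fiberInner hω hθ)]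
  congr 1
  ext z
  rw [fiberInner_eq, fiberInner_eq, fiberInner_eq, coefFun_add, map_add]
  ring

lemma hypInner_smul_right (c : ℂ) (ω η : Ball → CanPow k) :
    hypInner Γ k ω (c • η) = conj c * hypInner Γ k ω η := by
  rw [hypInner, hypInner, ← integral_const_mul]
  congr 1
  ext z
  rw [fiberInner_eq, fiberInner_eq, coefFun_smul, map_mul]
  ring

lemma IsPicardGroup.eq_zero_of_sqNorm_eq_zero (hΓ : IsPicardGroup Γ) (hk : 1 ≤ k)
    {ω : Ball → CanPow k} (hω : ω ∈ globalSections Γ k) (h : sqNorm Γ k ω = 0) : ω = 0 := by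
  obtain ⟨C, -, hC⟩ := hΓ.exists_secNorm_le_sqNorm
  ext z
  have h_zero : secNorm k ω z = 0 := by
    refine le_antisymm ((hC k hk ω hω z).trans_eq ?_) (secNorm_nonneg k ω z)
    rw [h, mul_zero]
  apply coeff_injective k
  rw [Pi.zero_apply, map_zero]
  change coefFun k ω z = 0
  simpa [secNorm, (defect_pos z).ne'] using h_zero

/-- The `L²` inner product on `H⁰(X_Γ, Λ^{⊗ k})`, with the arguments of `hypInner` swapped because
Mathlib's inner products are conjugate linear in the first variable. -/
@[reducible]
def IsPicardGroup.core (hΓ : IsPicardGroup Γ) (hk : 1 ≤ k) :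
    InnerProductSpace.Core ℂ (globalSections Γ k) where
  inner x y := hypInner Γ k y.1 x.1
  conj_inner_symm x y := conj_hypInner _ _
  re_inner_nonneg x := by
    rw [hypInner_self]
    exact sqNorm_nonneg
  add_left x y z := hΓ.hypInner_add_right z.2 x.2 y.2
  smul_left x y r := hypInner_smul_right r _ _
  definite x hx := by
    refine Subtype.ext (hΓ.eq_zero_of_sqNorm_eq_zero hk x.2 ?_)
    rw [hypInner_self] at hx
    exact_mod_cast hx

lemma fiberInner_sum {ι : Type*} (s : Finset ι) (a : ι → ℂ) (ω : ι → Ball → CanPow k) (z : Ball) :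
    fiberInner k z.1 ((∑ i ∈ s, a i • ω i) z) ((∑ i ∈ s, a i • ω i) z)
      = ∑ i ∈ s, ∑ j ∈ s, a i * conj (a j) * fiberInner k z.1 (ω i z) (ω j z) := by
  rw [fiberInner_eq, coefFun_sum, map_sum, Finset.sum_mul_sum, Finset.mul_sum]
  refine Finset.sum_congr rfl fun i _ => ?_
  rw [Finset.mul_sum]
  refine Finset.sum_congr rfl fun j _ => ?_
  rw [fiberInner_eq, map_mul]
  ring

lemma IsPicardGroup.hypInner_sum (hΓ : IsPicardGroup Γ) {ι : Type*} (s : Finset ι) (a : ι → ℂ)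
    {ω : ι → Ball → CanPow k} (h_mem : ∀ i, ω i ∈ globalSections Γ k) :
    hypInner Γ k (∑ i ∈ s, a i • ω i) (∑ i ∈ s, a i • ω i)
      = ∑ i ∈ s, ∑ j ∈ s, a i * conj (a j) * hypInner Γ k (ω i) (ω j) := by
  have h_int (i j) := (hΓ.integrableOn_fiberInner (h_mem i) (h_mem j)).const_mul (a i * conj (a j))
  simp_rw [hypInner, fiberInner_sum]
  rw [integral_finsetSum _ fun i _ => integrable_finsetSum _ fun j _ => h_int i j]
  refine Finset.sum_congr rfl fun i _ => ?_
  rw [integral_finsetSum _ fun j _ => h_int i j]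
  exact Finset.sum_congr rfl fun j _ => integral_const_mul _ _

lemma IsPicardGroup.sqNorm_sum (hΓ : IsPicardGroup Γ) {d : ℕ} {ω : Fin d → Ball → CanPow k}
    (h_mem : ∀ i, ω i ∈ globalSections Γ k)
    (h_orth : ∀ i j, hypInner Γ k (ω i) (ω j) = if i = j then 1 else 0) (a : Fin d → ℂ) :
    sqNorm Γ k (∑ i, a i • ω i) = ∑ i, ‖a i‖ ^ 2 := by
  have h_sum := hΓ.hypInner_sum Finset.univ a h_mem
  rw [hypInner_self] at h_sum
  simp only [h_orth, mul_ite, mul_one, mul_zero, Finset.sum_ite_eq, Finset.mem_univ, if_true,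
    Complex.mul_conj'] at h_sum
  exact_mod_cast h_sum

lemma bergmanKernel_self {d : ℕ} (ω : Fin d → Ball → CanPow k) (z : Ball) :
    bergmanKernel k ω z z = ((∑ j, ‖coefFun k (ω j) z‖ ^ 2 : ℝ) : ℂ) := by
  rw [bergmanKernel]
  push_cast
  exact Finset.sum_congr rfl fun j _ => Complex.mul_conj' _

lemma bergmanNorm_eq_mul {d : ℕ} (ω : Fin d → Ball → CanPow k) (z : Ball) :
    bergmanNorm k ω z = defect z.1 ^ (3 * k) * ∑ j, ‖coefFun k (ω j) z‖ ^ 2 := by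
  rw [bergmanNorm, bergmanKernel_self, Complex.norm_real,
    Real.norm_of_nonneg (Finset.sum_nonneg fun j _ => sq_nonneg _)]

lemma bergmanNorm_eq_sum {d : ℕ} (ω : Fin d → Ball → CanPow k) (z : Ball) :
    bergmanNorm k ω z = ∑ j, secNorm k (ω j) z := by
  rw [bergmanNorm_eq_mul, Finset.mul_sum]
  rfl

-- With `S = ∑ ‖fᵢ z‖ ^ 2`, the section `∑ conj (fᵢ z) • ωᵢ` has squared norm `S` and value `S` at
-- `z`, so the pointwise bound for sections bounds `S ^ 2` by a multiple of `S`.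
lemma IsPicardGroup.exists_bergmanNorm_le (hΓ : IsPicardGroup Γ) :
    ∃ C : ℝ, 0 < C ∧ ∀ k : ℕ, 1 ≤ k → ∀ (d : ℕ) (ω : Fin d → Ball → CanPow k),
      (∀ i, ω i ∈ globalSections Γ k) →
      (∀ i j, hypInner Γ k (ω i) (ω j) = if i = j then 1 else 0) →
      ∀ z, bergmanNorm k ω z ≤ C * k ^ 2 := by
  obtain ⟨C, hC0, hC⟩ := hΓ.exists_secNorm_le_sqNorm
  refine ⟨C, hC0, fun k hk d ω h_mem h_orth z => ?_⟩
  have h_bound := hC k hk (∑ i, conj (coefFun k (ω i) z) • ω i)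
    (Submodule.sum_mem _ fun i _ => Submodule.smul_mem _ _ (h_mem i)) z
  rw [hΓ.sqNorm_sum h_mem h_orth] at h_bound
  simp only [Complex.norm_conj, secNorm, coefFun_sum, Complex.conj_mul'] at h_bound
  rw [bergmanNorm_eq_mul]
  set S := ∑ i, ‖coefFun k (ω i) z‖ ^ 2
  have hS0 : 0 ≤ S := Finset.sum_nonneg fun i _ => sq_nonneg _
  have hS : ‖∑ i, (‖coefFun k (ω i) z‖ : ℂ) ^ 2‖ = S := by
    exact_mod_cast Complex.norm_of_nonneg hS0
  rcases hS0.eq_or_lt with h_zero | h_pos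
  · rw [← h_zero, mul_zero]
    positivity
  · rw [hS] at h_bound
    exact le_of_mul_le_mul_right (by linarith) h_pos

lemma IsPicardGroup.exists_card_le (hΓ : IsPicardGroup Γ) (hk : 1 ≤ k) :
    ∃ N : ℕ, ∀ (d : ℕ) (ω : Fin d → Ball → CanPow k), (∀ i, ω i ∈ globalSections Γ k) →
      (∀ i j, hypInner Γ k (ω i) (ω j) = if i = j then 1 else 0) → d ≤ N := by
  obtain ⟨C, -, hC⟩ := hΓ.exists_bergmanNorm_le
  refine ⟨⌈C * k ^ 2 * hypMeasure.real (fundDomain Γ)⌉₊, fun d ω h_mem h_orth => ?_⟩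
  have h_one (i) : sqNorm Γ k (ω i) = 1 := by
    have h_self := h_orth i i
    rw [hypInner_self, if_pos rfl] at h_self
    exact_mod_cast h_self
  have h_int (i) := hΓ.integrableOn_secNorm (h_mem i)
  rw [← Nat.cast_le (α := ℝ)]
  calc (d : ℝ) = ∑ i, sqNorm Γ k (ω i) := by simp [h_one]
    _ = ∫ z in fundDomain Γ, ∑ i, secNorm k (ω i) z ∂hypMeasure :=
        (integral_finsetSum _ fun i _ => h_int i).symm
    _ ≤ ∫ _ in fundDomain Γ, C * k ^ 2 ∂hypMeasure := by
        refine integral_mono (integrable_finsetSum _ fun i _ => h_int i)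
          (integrableOn_const hΓ.measure_fundDomain_lt_top.ne) fun z => ?_
        rw [← bergmanNorm_eq_sum]
        exact hC k hk d ω h_mem h_orth z
    _ = C * k ^ 2 * hypMeasure.real (fundDomain Γ) := by
        rw [setIntegral_const, smul_eq_mul, mul_comm]
    _ ≤ _ := Nat.le_ceil _

lemma finiteDimensional_of_orthonormal_card_le {𝕜 E : Type*} [RCLike 𝕜] [NormedAddCommGroup E]
    [InnerProductSpace 𝕜 E] {N : ℕ}
    (h : ∀ (d : ℕ) (b : Fin d → E), Orthonormal 𝕜 b → d ≤ N) : FiniteDimensional 𝕜 E := by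
  by_contra h_inf
  have h_basis := Module.Free.chooseBasis 𝕜 E
  have : Infinite (Module.Free.ChooseBasisIndex 𝕜 E) :=
    not_finite_iff_infinite.1 fun _ => h_inf (Module.Finite.of_basis h_basis)
  let e : Fin (N + 1) ↪ Module.Free.ChooseBasisIndex 𝕜 E :=
    Fin.valEmbedding.trans (Infinite.natEmbedding _)
  exact Nat.not_succ_le_self N (h _ _ (InnerProductSpace.gramSchmidtNormed_orthonormal
    (h_basis.linearIndependent.comp e e.injective)))

lemma IsPicardGroup.exists_isOrthonormalBasis (hΓ : IsPicardGroup Γ) (hk : 1 ≤ k) :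
    ∃ (d : ℕ) (ω : Fin d → Ball → CanPow k), IsOrthonormalBasis Γ k ω := by
  let : NormedAddCommGroup (globalSections Γ k) := (hΓ.core hk).toNormedAddCommGroup
  let : InnerProductSpace ℂ (globalSections Γ k) := .ofCore (hΓ.core hk).toCore
  have h_orth {d : ℕ} {b : Fin d → globalSections Γ k} (hb : Orthonormal ℂ b) (i j : Fin d) :
      hypInner Γ k (b i).1 (b j).1 = if i = j then 1 else 0 := by
    simp_rw [eq_comm (a := i)]
    exact orthonormal_iff_ite.1 hb j i
  obtain ⟨N, hN⟩ := hΓ.exists_card_le hk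
  have : FiniteDimensional ℂ (globalSections Γ k) :=
    finiteDimensional_of_orthonormal_card_le fun d b hb => hN d _ (fun i => (b i).2) (h_orth hb)
  let b := stdOrthonormalBasis ℂ (globalSections Γ k)
  refine ⟨_, fun i => (b i).1, ?_, h_orth b.orthonormal⟩
  have h_span := congrArg (Submodule.map (globalSections Γ k).subtype) b.toBasis.span_eq
  rwa [Submodule.map_span, Submodule.map_top, Submodule.range_subtype, ← Set.range_comp,
    b.coe_toBasis] at h_span

lemma IsOrthonormalBasis.mem {d : ℕ} {ω : Fin d → Ball → CanPow k}
    (h : IsOrthonormalBasis Γ k ω) (i : Fin d) : ω i ∈ globalSections Γ k := by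
  rw [← h.span_eq]
  exact Submodule.subset_span ⟨i, rfl⟩

lemma IsOrthonormalBasis.secNorm_le (hΓ : IsPicardGroup Γ) {d : ℕ} {ω : Fin d → Ball → CanPow k}
    (h : IsOrthonormalBasis Γ k ω) {η : Ball → CanPow k} (hη : η ∈ globalSections Γ k) (z : Ball) :
    secNorm k η z ≤ sqNorm Γ k η * bergmanNorm k ω z := by
  rw [← h.span_eq] at hη
  obtain ⟨a, rfl⟩ := (Submodule.mem_span_range_iff_exists_fun ℂ).1 hη
  rw [hΓ.sqNorm_sum h.mem h.orthonormal, bergmanNorm_eq_mul, secNorm, coefFun_sum, mul_left_comm]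
  refine mul_le_mul_of_nonneg_left ?_ (pow_pos (defect_pos z) _).le
  calc ‖∑ i, a i * coefFun k (ω i) z‖ ^ 2 ≤ (∑ i, ‖a i‖ * ‖coefFun k (ω i) z‖) ^ 2 := by
        gcongr
        exact (norm_sum_le _ _).trans_eq (by simp_rw [norm_mul])
    _ ≤ _ := Finset.sum_mul_sq_le_sq_mul_sq _ _ _

lemma IsPicardGroup.exists_le_bergmanNorm (hΓ : IsPicardGroup Γ) :
    ∃ k₁ : ℕ, 3 ≤ k₁ ∧ ∃ c : ℝ, 0 < c ∧ ∀ k, k₁ ≤ k → ∀ (d : ℕ) (ω : Fin d → Ball → CanPow k),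
      IsOrthonormalBasis Γ k ω → ∀ z, c * k ^ 2 ≤ bergmanNorm k ω z := by
  obtain ⟨k₁, hk₁, c, hc, h_peak⟩ := hΓ.exists_peak_section
  refine ⟨k₁, hk₁, c, hc, fun k hk d ω hω z => ?_⟩
  obtain ⟨η, hη, h_pos, h_le⟩ := h_peak k hk z
  have h_bessel := hω.secNorm_le hΓ hη z
  have h_sqNorm : 0 < sqNorm Γ k η :=
    sqNorm_nonneg.lt_of_ne fun h => by linarith [h ▸ h_bessel]
  exact le_of_mul_le_mul_left (by linarith) h_sqNorm

end BergmanKernel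

/-! ### Wedge products -/

lemma wedge_apply {m n : ℕ} (α : Form m) (β : Form n) (v : Fin (m + n) → Fin 2 → ℂ) :
    ((m.factorial * n.factorial : ℕ) : ℂ) * wedge α β v
      = ∑ σ : Equiv.Perm (Fin (m + n)), ((Equiv.Perm.sign σ : ℤ) : ℂ)
        * (α (fun i => v (σ (Fin.castAdd n i))) * β (fun j => v (σ (Fin.natAdd m j)))) := by
  have h_alt := congrArg (fun f => LinearMap.mul' ℝ ℂ (f (v ∘ finSumFinEquiv)))
    (MultilinearMap.domCoprod_alternization_eq α β)
  simp only [MultilinearMap.alternatization_apply, map_sum, AlternatingMap.smul_apply, map_nsmul,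
    Fintype.card_fin] at h_alt
  rw [nsmul_eq_mul] at h_alt
  refine h_alt.symm.trans ?_
  rw [← (Equiv.permCongr finSumFinEquiv).sum_comp]
  refine Finset.sum_congr rfl fun σ _ => ?_
  rw [Equiv.Perm.sign_permCongr, Units.smul_def, map_zsmul, zsmul_eq_mul]
  congr 1
  simp [MultilinearMap.domCoprod_apply, Function.comp_def]

lemma sum_perm_succ {n : ℕ} {M : Type*} [AddCommMonoid M] (F : Equiv.Perm (Fin (n + 1)) → M) :
    ∑ σ, F σ = ∑ p, ∑ τ, F (Equiv.Perm.decomposeFin.symm (p, τ)) := by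
  rw [← Equiv.Perm.decomposeFin.symm.sum_comp, Fintype.sum_prod_type]

lemma sum_sign_mul_perm_two (G : Fin 2 → Fin 2 → ℂ) :
    ∑ σ : Equiv.Perm (Fin 2), ((Equiv.Perm.sign σ : ℤ) : ℂ) * G (σ 0) (σ 1) = G 0 1 - G 1 0 := by
  simp [sum_perm_succ, sub_eq_add_neg]

lemma sum_sign_mul_perm_four (G : Fin 4 → Fin 4 → Fin 4 → Fin 4 → ℂ) :
    ∑ σ : Equiv.Perm (Fin 4), ((Equiv.Perm.sign σ : ℤ) : ℂ) * G (σ 0) (σ 1) (σ 2) (σ 3) =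
      (G 0 1 2 3 - G 0 1 3 2 - G 0 2 1 3 + G 0 2 3 1 + G 0 3 1 2 - G 0 3 2 1)
      - (G 1 0 2 3 - G 1 0 3 2 - G 1 2 0 3 + G 1 2 3 0 + G 1 3 0 2 - G 1 3 2 0)
      + (G 2 0 1 3 - G 2 0 3 1 - G 2 1 0 3 + G 2 1 3 0 + G 2 3 0 1 - G 2 3 1 0)
      - (G 3 0 1 2 - G 3 0 2 1 - G 3 1 0 2 + G 3 1 2 0 + G 3 2 0 1 - G 3 2 1 0) := by
  have h_two : (2 : Fin 4) = Fin.succ 1 := rfl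
  have h_three : (3 : Fin 4) = Fin.succ 2 := rfl
  simp_rw [sum_perm_succ (n := 3), sum_perm_succ (n := 2), sum_perm_succ (n := 1),
    Fintype.sum_unique]
  simp only [Fin.sum_univ_succ, Fin.sum_univ_zero, Equiv.Perm.decomposeFin.symm_sign, h_two,
    h_three, ← Fin.succ_zero_eq_one, ← Fin.succ_one_eq_two,
    Equiv.Perm.decomposeFin_symm_apply_succ, Equiv.Perm.decomposeFin_symm_apply_zero]
  simp [Equiv.swap_apply_def]
  ring

lemma wedge_one_one (α β : Form 1) (u v : Fin 2 → ℂ) :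
    wedge α β ![u, v] = α ![u] * β ![v] - α ![v] * β ![u] := by
  have h_perm (σ : Equiv.Perm (Fin (1 + 1))) :
      α (fun i => ![u, v] (σ (Fin.castAdd 1 i))) * β (fun j => ![u, v] (σ (Fin.natAdd 1 j))) =
        α ![![u, v] (σ 0)] * β ![![u, v] (σ 1)] := by
    congr 2 <;> ext i <;> fin_cases i <;> rfl
  have h_wedge := wedge_apply α β ![u, v]
  simp_rw [h_perm] at h_wedge
  rw [Nat.factorial_one, mul_one, Nat.cast_one, one_mul] at h_wedge
  exact h_wedge.trans
    (sum_sign_mul_perm_two fun a b => α ![![u, v] a] * β ![![u, v] b])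

lemma Form.swap (μ : Form 2) (x y : Fin 2 → ℂ) : μ ![y, x] = - μ ![x, y] := by
  rw [← μ.map_swap ![x, y] (show (0 : Fin 2) ≠ 1 by decide)]
  congr 1
  ext i
  fin_cases i <;> rfl

lemma wedge_self_two (μ : Form 2) (v : Fin 4 → Fin 2 → ℂ) :
    wedge μ μ v = 2 * (μ ![v 0, v 1] * μ ![v 2, v 3] - μ ![v 0, v 2] * μ ![v 1, v 3]
      + μ ![v 0, v 3] * μ ![v 1, v 2]) := by
  have h_perm (σ : Equiv.Perm (Fin (2 + 2))) :
      μ (fun i => v (σ (Fin.castAdd 2 i))) * μ (fun j => v (σ (Fin.natAdd 2 j)))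
        = μ ![v (σ 0), v (σ 1)] * μ ![v (σ 2), v (σ 3)] := by
    congr 2 <;> ext i <;> fin_cases i <;> rfl
  have h_wedge := wedge_apply μ μ v
  simp_rw [h_perm] at h_wedge
  rw [sum_sign_mul_perm_four fun a b c d => μ ![v a, v b] * μ ![v c, v d],
    μ.swap (v 0) (v 1), μ.swap (v 0) (v 2), μ.swap (v 0) (v 3), μ.swap (v 1) (v 2),
    μ.swap (v 1) (v 3), μ.swap (v 2) (v 3), Nat.factorial_two] at h_wedge
  push_cast at h_wedge
  linear_combination h_wedge / 4

/-- The `(1,1)`-form `∑ hᵢⱼ dzᵢ ∧ d\bar zⱼ`; `ddbar φ` is `form11` of the complex Hessian of `φ`. -/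
def form11 (h : Matrix (Fin 2) (Fin 2) ℂ) : Form 2 := ∑ i, ∑ j, h i j • wedge (dz i) (dzbar j)

lemma form11_apply (h : Matrix (Fin 2) (Fin 2) ℂ) (u v : Fin 2 → ℂ) :
    form11 h ![u, v] = ∑ i, ∑ j, h i j * (u i * conj (v j) - v i * conj (u j)) := by
  have h_wedge (i j) :
      wedge (dz i) (dzbar j) ![u, v] = u i * conj (v j) - v i * conj (u j) :=
    wedge_one_one (dz i) (dzbar j) u v
  simp only [form11, Fin.sum_univ_two, AlternatingMap.add_apply, AlternatingMap.smul_apply,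
    h_wedge, smul_eq_mul]

/-- The real frame `∂/∂x₁, ∂/∂y₁, ∂/∂x₂, ∂/∂y₂`, on which `4`-forms are compared. -/
def realFrame : Fin 4 → Fin 2 → ℂ :=
  ![Pi.single 0 1, Pi.single 0 Complex.I, Pi.single 1 1, Pi.single 1 Complex.I]

lemma volForm_form11_realFrame (c : ℂ) (h : Matrix (Fin 2) (Fin 2) ℂ) :
    volForm (c • form11 h) realFrame = -4 * c ^ 2 * h.det := by
  have h_vol : volForm (c • form11 h) realFrame
      = (1 / 2 : ℂ) * wedge (c • form11 h) (c • form11 h) realFrame := rfl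
  rw [h_vol, wedge_self_two]
  simp only [AlternatingMap.smul_apply, form11_apply, Fin.sum_univ_two, smul_eq_mul,
    Matrix.det_fin_two]
  simp [realFrame]
  linear_combination c ^ 2 *
    (4 * h 0 0 * h 1 1 - 2 * h 0 1 * h 1 0 - h 0 1 ^ 2 - h 1 0 ^ 2) * Complex.I_sq

lemma linearIndependent_realFrame : LinearIndependent ℝ realFrame := by
  rw [Fintype.linearIndependent_iff]
  intro g hg i
  have h_re (j) := congrArg Complex.re (congrFun hg j)
  have h_im (j) := congrArg Complex.im (congrFun hg j)
  simp only [Fin.sum_univ_four, realFrame, Fin.forall_fin_two] at h_re h_im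
  fin_cases i
  · simpa using h_re.1
  · simpa using h_im.1
  · simpa using h_re.2
  · simpa using h_im.2

lemma Form.ext_realFrame {α β : Form 4} (h : α realFrame = β realFrame) : α = β := by
  have h_card : Fintype.card (Fin 4) = Module.finrank ℝ (Fin 2 → ℂ) := by
    simp [Module.finrank_pi_fintype, Complex.finrank_real_complex]
  refine Module.Basis.ext_alternating
    (basisOfLinearIndependentOfCardEqFinrank linearIndependent_realFrame h_card) fun v hv => ?_
  obtain ⟨σ, rfl⟩ : ∃ σ : Equiv.Perm (Fin 4), v = σ :=
    ⟨Equiv.ofBijective v (Finite.injective_iff_bijective.1 hv), rfl⟩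
  rw [coe_basisOfLinearIndependentOfCardEqFinrank]
  exact (α.map_perm realFrame σ).trans ((congrArg _ h).trans (β.map_perm realFrame σ).symm)

/-- The complex Hessian `∂²φ / ∂zᵢ∂\bar zⱼ`, the coefficient matrix of `ddbar φ`. -/
def hess (φ : (Fin 2 → ℂ) → ℂ) (z : Fin 2 → ℂ) : Matrix (Fin 2) (Fin 2) ℂ :=
  Matrix.of fun i j => wirt i (wirtBar j φ) z

lemma ddbar_eq (φ : (Fin 2 → ℂ) → ℂ) (z : Fin 2 → ℂ) : ddbar φ z = form11 (hess φ z) := rfl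

lemma volForm_eq_smul {φ ψ : (Fin 2 → ℂ) → ℂ} {z : Fin 2 → ℂ} {c d : ℂ} {r : ℝ}
    (h : c ^ 2 * (hess φ z).det = r * (d ^ 2 * (hess ψ z).det)) :
    volForm (c • ddbar φ z) = r • volForm (d • ddbar ψ z) := by
  refine Form.ext_realFrame ?_
  rw [AlternatingMap.smul_apply, ddbar_eq, ddbar_eq, volForm_form11_realFrame,
    volForm_form11_realFrame, Complex.real_smul]
  linear_combination (-4) * h

/-! ### Wirtinger calculus -/

section HasWirt

variable {E : Type*} [NormedAddCommGroup E] [NormedSpace ℂ E]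

/-- The real derivative of `φ` at `z` is `v ↦ a v + conj (b v)` with `a`, `b` complex linear: `a` is
`∂φ` and `b` is the conjugate of `\bar∂φ`, which keeps both complex linear. -/
def HasWirt (φ : E → ℂ) (a b : E →L[ℂ] ℂ) (z : E) : Prop :=
  ∃ D : E →L[ℝ] ℂ, HasFDerivAt φ D z ∧ ∀ v, D v = a v + conj (b v)

variable {φ ψ : E → ℂ} {a b a' b' : E →L[ℂ] ℂ} {z : E}

lemma HasWirt.congr (h : HasWirt φ a b z) (h_eq : ψ =ᶠ[𝓝 z] φ) : HasWirt ψ a b z := by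
  obtain ⟨D, hD, h⟩ := h
  exact ⟨D, hD.congr_of_eventuallyEq h_eq, h⟩

lemma HasWirt.of_hasFDerivAt (h : HasFDerivAt φ a z) : HasWirt φ a 0 z :=
  ⟨a.restrictScalars ℝ, h.restrictScalars ℝ, fun v => by simp⟩

lemma HasWirt.conj (h : HasWirt φ a b z) : HasWirt (fun w => conj (φ w)) b a z := by
  obtain ⟨D, hD, h⟩ := h
  refine ⟨Complex.conjCLE.toContinuousLinearMap.comp D,
    Complex.conjCLE.toContinuousLinearMap.hasFDerivAt.comp z hD, fun v => ?_⟩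
  simp [h, add_comm]

lemma HasWirt.add (h : HasWirt φ a b z) (h' : HasWirt ψ a' b' z) :
    HasWirt (fun w => φ w + ψ w) (a + a') (b + b') z := by
  obtain ⟨D, hD, h⟩ := h
  obtain ⟨D', hD', h'⟩ := h'
  refine ⟨D + D', hD.add hD', fun v => ?_⟩
  simp only [add_apply, h, h', map_add]
  ring

lemma HasWirt.mul (h : HasWirt φ a b z) (h' : HasWirt ψ a' b' z) :
    HasWirt (fun w => φ w * ψ w) (φ z • a' + ψ z • a)
      (starRingEnd ℂ (φ z) • b' + starRingEnd ℂ (ψ z) • b) z := by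
  obtain ⟨D, hD, h⟩ := h
  obtain ⟨D', hD', h'⟩ := h'
  refine ⟨_, hD.mul hD', fun v => ?_⟩
  simp [h, h']
  ring

lemma HasWirt.comp_hasDerivAt {g : ℂ → ℂ} {g' : ℂ} (h : HasWirt φ a b z)
    (hg : HasDerivAt g g' (φ z)) :
    HasWirt (fun w => g (φ w)) (g' • a) (starRingEnd ℂ g' • b) z := by
  obtain ⟨D, hD, h⟩ := h
  refine ⟨_, (hg.hasFDerivAt.restrictScalars ℝ).comp z hD, fun v => ?_⟩
  simp [h]
  ring

lemma HasWirt.const_mul (c : ℂ) (h : HasWirt φ a b z) :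
    HasWirt (fun w => c * φ w) (c • a) (starRingEnd ℂ c • b) z :=
  h.comp_hasDerivAt (hasDerivAt_const_mul c)

lemma HasWirt.sum {ι : Type*} (s : Finset ι) {φ : ι → E → ℂ} {a b : ι → E →L[ℂ] ℂ}
    (h : ∀ i ∈ s, HasWirt (φ i) (a i) (b i) z) :
    HasWirt (fun w => ∑ i ∈ s, φ i w) (∑ i ∈ s, a i) (∑ i ∈ s, b i) z := by
  choose! D hD h using h
  refine ⟨∑ i ∈ s, D i, .fun_sum hD, fun v => ?_⟩
  simp only [sum_apply, map_sum]
  rw [Finset.sum_congr rfl fun i hi => h i hi v, Finset.sum_add_distrib]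

end HasWirt

section Wirt

variable {φ : (Fin 2 → ℂ) → ℂ} {a b : (Fin 2 → ℂ) →L[ℂ] ℂ} {z : Fin 2 → ℂ}

lemma single_I (i : Fin 2) : (Pi.single i Complex.I : Fin 2 → ℂ) = Complex.I • Pi.single i 1 := by
  rw [← Pi.single_smul, smul_eq_mul, mul_one]

lemma HasWirt.wirt_eq (h : HasWirt φ a b z) (i : Fin 2) : wirt i φ z = a (Pi.single i 1) := by
  obtain ⟨D, hD, h⟩ := h
  rw [wirt, hD.fderiv, h, h, single_I, map_smul, map_smul, smul_eq_mul, smul_eq_mul, map_mul,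
    Complex.conj_I]
  linear_combination ((-a (Pi.single i 1) + conj (b (Pi.single i 1))) / 2) * Complex.I_mul_I

lemma HasWirt.wirtBar_eq (h : HasWirt φ a b z) (i : Fin 2) :
    wirtBar i φ z = conj (b (Pi.single i 1)) := by
  obtain ⟨D, hD, h⟩ := h
  rw [wirtBar, hD.fderiv, h, h, single_I, map_smul, map_smul, smul_eq_mul, smul_eq_mul, map_mul,
    Complex.conj_I]
  linear_combination ((a (Pi.single i 1) - conj (b (Pi.single i 1))) / 2) * Complex.I_mul_I

end Wirt

/-- `φ` has complex Hessian `M` at `z`: near `z` it is differentiable with `∂φ/∂\bar zⱼ = ψⱼ`, and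
`∂ψⱼ/∂zᵢ = Mᵢⱼ` at `z`. -/
def HasHess (φ : (Fin 2 → ℂ) → ℂ) (M : Matrix (Fin 2) (Fin 2) ℂ) (z : Fin 2 → ℂ) : Prop :=
  ∃ ψ : Fin 2 → (Fin 2 → ℂ) → ℂ,
    (∀ᶠ w in 𝓝 z, ∃ a b, HasWirt φ a b w ∧ ∀ j, conj (b (Pi.single j 1)) = ψ j w) ∧
    ∀ j, ∃ a b, HasWirt (ψ j) a b z ∧ ∀ i, a (Pi.single i 1) = M i j

section HasHess

variable {φ φ' : (Fin 2 → ℂ) → ℂ} {M M' : Matrix (Fin 2) (Fin 2) ℂ} {z : Fin 2 → ℂ}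

lemma HasHess.hess_eq (h : HasHess φ M z) : hess φ z = M := by
  obtain ⟨ψ, h_first, h_second⟩ := h
  ext i j
  obtain ⟨a, b, h_wirt, ha⟩ := h_second j
  have h_eq : wirtBar j φ =ᶠ[𝓝 z] ψ j := by
    filter_upwards [h_first] with w ⟨a, b, hw, hb⟩
    rw [hw.wirtBar_eq, hb]
  rw [← ha]
  exact (h_wirt.congr h_eq).wirt_eq i

lemma HasHess.congr (h : HasHess φ M z) (h_eq : φ' =ᶠ[𝓝 z] φ) : HasHess φ' M z := by
  obtain ⟨ψ, h_first, h_second⟩ := h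
  refine ⟨ψ, ?_, h_second⟩
  filter_upwards [h_first, h_eq.eventuallyEq_nhds] with w ⟨a, b, hw, hb⟩ hw_eq
  exact ⟨a, b, hw.congr hw_eq, hb⟩

lemma HasHess.add (h : HasHess φ M z) (h' : HasHess φ' M' z) :
    HasHess (fun w => φ w + φ' w) (M + M') z := by
  obtain ⟨ψ, h_first, h_second⟩ := h
  obtain ⟨ψ', h_first', h_second'⟩ := h'
  refine ⟨fun j w => ψ j w + ψ' j w, ?_, fun j => ?_⟩
  · filter_upwards [h_first, h_first'] with w ⟨a, b, hw, hb⟩ ⟨a', b', hw', hb'⟩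
    exact ⟨_, _, hw.add hw', fun j => by simp [← hb, ← hb']⟩
  · obtain ⟨a, b, hw, ha⟩ := h_second j
    obtain ⟨a', b', hw', ha'⟩ := h_second' j
    exact ⟨_, _, hw.add hw', fun i => by simp [ha, ha']⟩

lemma HasHess.const_mul (c : ℂ) (h : HasHess φ M z) : HasHess (fun w => c * φ w) (c • M) z := by
  obtain ⟨ψ, h_first, h_second⟩ := h
  refine ⟨fun j w => c * ψ j w, ?_, fun j => ?_⟩
  · filter_upwards [h_first] with w ⟨a, b, hw, hb⟩
    exact ⟨_, _, hw.const_mul c, fun j => by simp [← hb]⟩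
  · obtain ⟨a, b, hw, ha⟩ := h_second j
    exact ⟨_, _, hw.const_mul c, fun i => by simp [ha]⟩

end HasHess

/-! ### The complex Hessian of the logarithm of a Hermitian form -/

section FubiniStudy

variable {ι κ : Type*} [Fintype ι] (ε : ι → ℝ)

/-- The coefficients of the Fubini–Study form of `diagHerm ε`, the complex Hessian of the logarithm
of `diagHerm ε x x`, at the point `x` and on the tangent vectors `p i`. -/
def fubiniStudy (x : ι → ℂ) (p : κ → ι → ℂ) : Matrix κ κ ℂ :=
  Matrix.of fun i j => diagHerm ε (p i) (p j) / diagHerm ε x x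
    - diagHerm ε (p i) x * diagHerm ε x (p j) / diagHerm ε x x ^ 2

lemma fubiniStudy_smul_add {x : ι → ℂ} (hx : diagHerm ε x x ≠ 0) {u : ℂ} (hu : u ≠ 0)
    (p : κ → ι → ℂ) (c : κ → ℂ) :
    fubiniStudy ε (u • x) (fun i => u • p i + c i • x) = fubiniStudy ε x p := by
  have hu' : conj u ≠ 0 := (map_ne_zero _).2 hu
  ext i j
  simp only [fubiniStudy, Matrix.of_apply, diagHerm_add_left, diagHerm_add_right,
    diagHerm_smul_left, diagHerm_smul_right]
  field_simp
  ring

lemma diagHerm_sum_left {s : Finset κ} (p : κ → ι → ℂ) (y : ι → ℂ) :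
    diagHerm ε (∑ l ∈ s, p l) y = ∑ l ∈ s, diagHerm ε (p l) y := by
  simp only [diagHerm, Finset.sum_apply, Finset.sum_mul, Finset.mul_sum]
  exact Finset.sum_comm

lemma diagHerm_sum_right {s : Finset κ} (x : ι → ℂ) (p : κ → ι → ℂ) :
    diagHerm ε x (∑ l ∈ s, p l) = ∑ l ∈ s, diagHerm ε x (p l) := by
  simp only [← conj_diagHerm ε _ x, diagHerm_sum_left, map_sum]

lemma fubiniStudy_sum_smul [Fintype κ] (x : ι → ℂ) (p : κ → ι → ℂ) (A : Matrix κ κ ℂ) :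
    fubiniStudy ε x (fun i => ∑ l, A l i • p l)
      = A.transpose * fubiniStudy ε x p * A.map (starRingEnd ℂ) := by
  ext i j
  simp only [fubiniStudy, Matrix.of_apply, diagHerm_sum_left, diagHerm_sum_right,
    diagHerm_smul_left, diagHerm_smul_right, Matrix.mul_apply, Matrix.transpose_apply,
    Matrix.map_apply, mul_sub, sub_mul, Finset.sum_sub_distrib, Finset.sum_div, Finset.sum_mul,
    Finset.mul_sum]
  congr 1
  · exact Finset.sum_congr rfl fun l _ => Finset.sum_congr rfl fun m _ => by ring
  · exact Finset.sum_congr rfl fun l _ => Finset.sum_congr rfl fun m _ => by ring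

lemma isHermitian_fubiniStudy (x : ι → ℂ) (p : κ → ι → ℂ) : (fubiniStudy ε x p).IsHermitian := by
  ext i j
  simp only [fubiniStudy, Matrix.conjTranspose_apply, Matrix.of_apply, Complex.star_def, map_sub,
    map_div₀, map_mul, map_pow, conj_diagHerm]
  ring

/-- The linear functional `x ↦ diagHerm ε x y`. -/
def diagHermLeft (y : ι → ℂ) : (ι → ℂ) →L[ℂ] ℂ :=
  ∑ m, ((ε m : ℂ) * conj (y m)) • ContinuousLinearMap.proj m

lemma diagHermLeft_apply (x y : ι → ℂ) : diagHermLeft ε y x = diagHerm ε x y := by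
  simp only [diagHermLeft, diagHerm, sum_apply, smul_apply, ContinuousLinearMap.proj_apply,
    smul_eq_mul]
  exact Finset.sum_congr rfl fun m _ => by ring

lemma hasWirt_diagHerm {E : Type*} [NormedAddCommGroup E] [NormedSpace ℂ E] {F G : E → ι → ℂ}
    {F' G' : E →L[ℂ] ι → ℂ} {z : E} (hF : HasFDerivAt F F' z) (hG : HasFDerivAt G G' z) :
    HasWirt (fun w => diagHerm ε (F w) (G w)) ((diagHermLeft ε (G z)).comp F')
      ((diagHermLeft ε (F z)).comp G') z := by
  have h_term (m) := ((HasWirt.of_hasFDerivAt (hasFDerivAt_pi'.1 hF m)).mul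
    (HasWirt.of_hasFDerivAt (hasFDerivAt_pi'.1 hG m)).conj).const_mul (ε m : ℂ)
  convert HasWirt.sum Finset.univ fun m _ => h_term m using 1 <;>
  · ext v
    simp [diagHerm, diagHermLeft, mul_assoc]

end FubiniStudy

section LogHess

variable {ι : Type*} [Fintype ι] (ε : ι → ℝ) {F : (Fin 2 → ℂ) → ι → ℂ} {z : Fin 2 → ℂ}

/-- The complex Hessian of the logarithm of `diagHerm ε (F z) (F z)` for holomorphic `F`. -/
def logHess (F : (Fin 2 → ℂ) → ι → ℂ) (z : Fin 2 → ℂ) : Matrix (Fin 2) (Fin 2) ℂ :=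
  fubiniStudy ε (F z) fun i => fderiv ℂ F z (Pi.single i 1)

lemma hasHess_log_diagHerm {U : Set (Fin 2 → ℂ)} (hU : IsOpen U) (hF : DifferentiableOn ℂ F U)
    (h_pos : ∀ w ∈ U, 0 < ∑ m, ε m * ‖F w m‖ ^ 2) (hz : z ∈ U) :
    HasHess (fun w => ((Real.log (∑ m, ε m * ‖F w m‖ ^ 2) : ℝ) : ℂ)) (logHess ε F z) z := by
  have h_ne (w) (hw : w ∈ U) : diagHerm ε (F w) (F w) ≠ 0 := by
    rw [diagHerm_self]
    exact_mod_cast (h_pos w hw).ne'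
  have h_deriv (w) (hw : w ∈ U) := (hF.differentiableAt (hU.mem_nhds hw)).hasFDerivAt
  have h_log (w) (hw : w ∈ U) : Complex.log (diagHerm ε (F w) (F w))
      = ((Real.log (∑ m, ε m * ‖F w m‖ ^ 2) : ℝ) : ℂ) := by
    rw [diagHerm_self, Complex.ofReal_log (h_pos w hw).le]
  refine ⟨fun j w => diagHerm ε (F w) (fderiv ℂ F w (Pi.single j 1))
    * (diagHerm ε (F w) (F w))⁻¹, ?_, fun j => ?_⟩
  · filter_upwards [hU.mem_nhds hz] with w hw
    have h_slit : diagHerm ε (F w) (F w) ∈ Complex.slitPlane := by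
      rw [diagHerm_self]
      exact Complex.ofReal_mem_slitPlane.2 (h_pos w hw)
    refine ⟨_, _, ((hasWirt_diagHerm ε (h_deriv w hw) (h_deriv w hw)).comp_hasDerivAt
      (Complex.hasDerivAt_log h_slit)).congr ?_, fun j => ?_⟩
    · filter_upwards [hU.mem_nhds hw] with x hx
      exact (h_log x hx).symm
    · rw [smul_apply, ContinuousLinearMap.comp_apply, diagHermLeft_apply, smul_eq_mul, map_mul,
        Complex.conj_conj, conj_diagHerm, mul_comm]
  · have h_deriv' := (differentiableAt_fderiv_apply hU hF hz (Pi.single j 1)).hasFDerivAt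
    refine ⟨_, _, (hasWirt_diagHerm ε (h_deriv z hz) h_deriv').mul
      ((hasWirt_diagHerm ε (h_deriv z hz) (h_deriv z hz)).comp_hasDerivAt
        (hasDerivAt_inv (h_ne z hz))), fun i => ?_⟩
    have := h_ne z hz
    simp only [add_apply, smul_apply, ContinuousLinearMap.comp_apply, diagHermLeft_apply,
      smul_eq_mul, logHess, fubiniStudy, Matrix.of_apply]
    field_simp
    ring

lemma logHess_smul_comp {φ : (Fin 2 → ℂ) → Fin 2 → ℂ} {φ' : (Fin 2 → ℂ) →L[ℂ] Fin 2 → ℂ}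
    {u : (Fin 2 → ℂ) → ℂ} (hφ : HasFDerivAt φ φ' z) (hF : DifferentiableAt ℂ F (φ z))
    (hu : DifferentiableAt ℂ u z) (hu0 : u z ≠ 0) (hx : diagHerm ε (F (φ z)) (F (φ z)) ≠ 0) :
    logHess ε (fun w => u w • F (φ w)) z
      = (LinearMap.toMatrix' φ'.toLinearMap).transpose * logHess ε F (φ z)
        * (LinearMap.toMatrix' φ'.toLinearMap).map (starRingEnd ℂ) := by
  rw [logHess, logHess, ← fubiniStudy_sum_smul,
    ← fubiniStudy_smul_add ε hx hu0 _ fun i => fderiv ℂ u z (Pi.single i 1)]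
  congr 1
  ext1 i
  have h_deriv := hu.hasFDerivAt.smul (hF.hasFDerivAt.comp z hφ)
  have h_single : φ' (Pi.single i 1) = ∑ l, φ' (Pi.single i 1) l • Pi.single l (1 : ℂ) :=
    pi_eq_sum_univ' _
  rw [show (fun w => u w • F (φ w)) = u • (F ∘ φ) from rfl, h_deriv.fderiv]
  simp only [add_apply, smul_apply, ContinuousLinearMap.comp_apply,
    ContinuousLinearMap.smulRight_apply, LinearMap.toMatrix'_apply, ContinuousLinearMap.coe_coe]
  rw [h_single, map_sum]
  simp

lemma logHess_mulVec {B : Matrix ι ι ℂ}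
    (hB : ∀ x y, diagHerm ε (B.mulVec x) (B.mulVec y) = diagHerm ε x y)
    (hF : DifferentiableAt ℂ F z) : logHess ε (fun w => B.mulVec (F w)) z = logHess ε F z := by
  have h_deriv : fderiv ℂ (fun w => B.mulVec (F w)) z
      = (LinearMap.toContinuousLinearMap B.mulVecLin).comp (fderiv ℂ F z) :=
    ((LinearMap.toContinuousLinearMap B.mulVecLin).hasFDerivAt.comp z hF.hasFDerivAt).fderiv
  ext i j
  simp [logHess, fubiniStudy, h_deriv, hB]

lemma logHess_congr {G : (Fin 2 → ℂ) → ι → ℂ} (h : F =ᶠ[𝓝 z] G) :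
    logHess ε F z = logHess ε G z := by
  rw [logHess, logHess, h.fderiv_eq, h.eq_of_nhds]

end LogHess

/-! ### Invariance of the complex Hessians under the action -/

section Invariance

/-- The complex Jacobian matrix of the action of `g`. -/
def jacobian (g : SU21) (z : Fin 2 → ℂ) : Matrix (Fin 2) (Fin 2) ℂ :=
  LinearMap.toMatrix' (moebiusDeriv g z).toLinearMap

lemma logHess_slash {ι : Type*} [Fintype ι] {ε : ι → ℝ} {F : (Fin 2 → ℂ) → ι → ℂ} (g : SU21)
    (n : ℕ) (hF : DifferentiableOn ℂ F Ball) {z : Ball}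
    (hx : diagHerm ε (F (g • z).1) (F (g • z).1) ≠ 0) :
    logHess ε (slash g n F) z.1 = (jacobian g z.1).transpose * logHess ε F (g • z).1
      * (jacobian g z.1).map (starRingEnd ℂ) :=
  have h_aut := pow_ne_zero n (autFactor_ne_zero g z)
  logHess_smul_comp ε (hasFDerivAt_moebius g z.2)
    (hF.differentiableAt (isOpen_ball.mem_nhds (g • z).2))
    (((differentiable_autFactor g z.1).pow n).inv h_aut) (inv_ne_zero h_aut) hx

lemma hasFDerivAt_lift (z : Fin 2 → ℂ) :
    HasFDerivAt lift (ContinuousLinearMap.pi (rowForm 1)) z := by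
  refine hasFDerivAt_pi'.2 fun m => ?_
  have h_row := hasFDerivAt_mulVec_lift 1 m z
  simp only [mat_one, Matrix.one_mulVec] at h_row
  exact h_row

/-- The complex Hessian of `log (1 - |z|²)`. -/
def defectHess (z : Fin 2 → ℂ) : Matrix (Fin 2) (Fin 2) ℂ := logHess hermSign lift z

lemma sum_hermSign_mul_norm_lift (z : Fin 2 → ℂ) :
    ∑ m, hermSign m * ‖lift z m‖ ^ 2 = defect z := by
  have h_self := diagHerm_self hermSign (lift z)
  rw [← herm, herm_lift_self] at h_self
  exact_mod_cast h_self.symm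

lemma hasHess_log_defect {z : Fin 2 → ℂ} (hz : z ∈ Ball) :
    HasHess (fun w => ((Real.log (defect w) : ℝ) : ℂ)) (defectHess z) z := by
  simp_rw [← sum_hermSign_mul_norm_lift]
  refine hasHess_log_diagHerm _ isOpen_ball
    (fun w _ => (hasFDerivAt_lift w).differentiableAt.differentiableWithinAt) (fun w hw => ?_) hz
  rw [sum_hermSign_mul_norm_lift]
  exact defect_pos ⟨w, hw⟩

lemma defectHess_eq_jacobian (g : SU21) (z : Ball) :
    defectHess z.1 = (jacobian g z.1).transpose * defectHess (g • z).1
      * (jacobian g z.1).map (starRingEnd ℂ) := by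
  have h_lift : (fun w => (mat g).mulVec (lift w))
      =ᶠ[𝓝 z.1] fun w => autFactor g w • lift (moebius (mat g) w) := by
    filter_upwards [isOpen_ball.mem_nhds z.2] with w hw
    exact mulVec_lift g ⟨w, hw⟩
  rw [defectHess, ← logHess_mulVec hermSign (herm_mulVec g) (hasFDerivAt_lift _).differentiableAt,
    logHess_congr _ h_lift]
  exact logHess_smul_comp _ (hasFDerivAt_moebius g z.2) (hasFDerivAt_lift _).differentiableAt
    (differentiable_autFactor g _) (autFactor_ne_zero g z) (herm_lift_ne_zero (g • z) (g • z))

lemma defectHess_origin : defectHess origin.1 = -1 := by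
  rw [defectHess, logHess, (hasFDerivAt_lift _).fderiv, lift_origin]
  have h_herm : diagHerm hermSign = herm := rfl
  ext i j
  simp only [fubiniStudy, Matrix.of_apply, h_herm, herm_apply]
  fin_cases i <;> fin_cases j <;> simp [rowForm_apply, mat_one]

end Invariance

/-! ### The Bergman metric -/

section MatrixBounds

lemma ofReal_re_det {n : Type*} [Fintype n] [DecidableEq n] {N : Matrix n n ℂ}
    (hN : N.IsHermitian) : (N.det.re : ℂ) = N.det := by
  rw [← Complex.conj_eq_iff_re, ← Complex.star_def, ← Matrix.det_conjTranspose, hN.eq]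

lemma abs_re_det_le {N : Matrix (Fin 2) (Fin 2) ℂ} {B : ℝ} (hN : ∀ i j, ‖N i j‖ ≤ B) :
    |N.det.re| ≤ 2 * B ^ 2 := by
  have hB : 0 ≤ B := (norm_nonneg _).trans (hN 0 0)
  calc |N.det.re| ≤ ‖N 0 0 * N 1 1 - N 0 1 * N 1 0‖ := by
        rw [← Matrix.det_fin_two]
        exact Complex.abs_re_le_norm _
    _ ≤ ‖N 0 0‖ * ‖N 1 1‖ + ‖N 0 1‖ * ‖N 1 0‖ := by
        rw [← norm_mul, ← norm_mul]
        exact norm_sub_le _ _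
    _ ≤ B * B + B * B := by gcongr <;> apply hN
    _ = 2 * B ^ 2 := by ring

lemma norm_diagHerm_one_le {ι : Type*} [Fintype ι] (x y : ι → ℂ) :
    ‖diagHerm (fun _ => 1) x y‖ ≤ ‖WithLp.toLp 2 x‖ * ‖WithLp.toLp 2 y‖ := by
  have h_inner : diagHerm (fun _ => 1) x y = inner ℂ (WithLp.toLp 2 y) (WithLp.toLp 2 x) := by
    simp [diagHerm, PiLp.inner_apply]
  rw [h_inner, mul_comm]
  exact norm_inner_le_norm _ _

lemma diagHerm_one_self {ι : Type*} [Fintype ι] (x : ι → ℂ) :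
    diagHerm (fun _ => 1) x x = ((‖WithLp.toLp 2 x‖ ^ 2 : ℝ) : ℂ) := by
  simp_rw [diagHerm_self, one_mul, EuclideanSpace.norm_sq_eq]

lemma norm_fubiniStudy_one_le {ι κ : Type*} [Fintype ι] {x : ι → ℂ} {p : κ → ι → ℂ} {s P : ℝ}
    (hs : 0 < s) (hx : s ≤ ‖WithLp.toLp 2 x‖ ^ 2) (hp : ∀ i, ‖WithLp.toLp 2 (p i)‖ ^ 2 ≤ P)
    (i j : κ) : ‖fubiniStudy (fun _ => 1) x p i j‖ ≤ 2 * P / s := by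
  set X := ‖WithLp.toLp 2 x‖
  have hX : 0 < X ^ 2 := hs.trans_le hx
  have hP : 0 ≤ P := (sq_nonneg _).trans (hp i)
  have h_pp : ‖WithLp.toLp 2 (p i)‖ * ‖WithLp.toLp 2 (p j)‖ ≤ P := by
    linarith [hp i, hp j, two_mul_le_add_sq ‖WithLp.toLp 2 (p i)‖ ‖WithLp.toLp 2 (p j)‖]
  have h_pipj := (norm_diagHerm_one_le (p i) (p j)).trans h_pp
  have h_pix := norm_diagHerm_one_le (p i) x
  have h_xpj := norm_diagHerm_one_le x (p j)
  rw [fubiniStudy, Matrix.of_apply, diagHerm_one_self]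
  calc _ ≤ ‖diagHerm (fun _ => 1) (p i) (p j)‖ / X ^ 2 + ‖diagHerm (fun _ => 1) (p i) x‖
          * ‖diagHerm (fun _ => 1) x (p j)‖ / (X ^ 2) ^ 2 := by
        refine (norm_sub_le _ _).trans_eq ?_
        rw [norm_div, norm_div, norm_mul, norm_pow, Complex.norm_real, Real.norm_of_nonneg hX.le]
    _ ≤ P / X ^ 2 + (‖WithLp.toLp 2 (p i)‖ * X) * (X * ‖WithLp.toLp 2 (p j)‖) / (X ^ 2) ^ 2 := by
        gcongr
    _ = (P + ‖WithLp.toLp 2 (p i)‖ * ‖WithLp.toLp 2 (p j)‖) / X ^ 2 := by field_simp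
    _ ≤ (P + P) / s := by gcongr
    _ = 2 * P / s := by rw [two_mul]

end MatrixBounds

section CauchyEstimate

lemma defect_smul_single (t : ℂ) (i : Fin 2) : defect (t • Pi.single i 1) = 1 - ‖t‖ ^ 2 := by
  fin_cases i <;> simp [defect]

/- On the disc of squared radius `1 / (2 * k)` the weight `defect ^ (3 * k)` is at least `1 / 8`, so
this is Cauchy's estimate there. -/
lemma norm_fderiv_single_sq_le {V : Type*} [NormedAddCommGroup V] [NormedSpace ℂ V]
    {f : (Fin 2 → ℂ) → V} (hf : DifferentiableOn ℂ f Ball) {k : ℕ} (hk : 1 ≤ k) {M : ℝ}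
    (hM : ∀ z : Ball, defect z.1 ^ (3 * k) * ‖f z.1‖ ^ 2 ≤ M) (i : Fin 2) :
    ‖fderiv ℂ f 0 (Pi.single i 1)‖ ^ 2 ≤ 16 * M * k := by
  have hk' : (1 : ℝ) ≤ k := by exact_mod_cast hk
  have h_sq : √(1 / 2 / k : ℝ) ^ 2 = 1 / 2 / k := Real.sq_sqrt (by positivity)
  have h_lt : (1 / 2 / k : ℝ) < 1 := by
    rw [div_lt_one (by positivity)]
    linarith
  have h_defect (t : ℂ) : defect (0 + t • Pi.single i 1) = 1 - ‖t‖ ^ 2 := by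
    rw [zero_add, defect_smul_single]
  have h_mem (t : ℂ) (ht : ‖t‖ ≤ √(1 / 2 / k)) : (0 : Fin 2 → ℂ) + t • Pi.single i 1 ∈ Ball := by
    rw [mem_ball_iff, h_defect]
    linarith [pow_le_pow_left₀ (norm_nonneg t) ht 2]
  have h_weight : (1 / 8 : ℝ) ≤ (1 - 1 / 2 / k) ^ (3 * k) := by
    rw [mul_comm, pow_mul]
    calc (1 / 8 : ℝ) = (1 - 1 / 2) ^ 3 := by norm_num
      _ ≤ ((1 - 1 / 2 / k) ^ k) ^ 3 := pow_le_pow_left₀ (by norm_num)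
          (one_sub_le_one_sub_div_pow (by norm_num) (by norm_num) hk) 3
  have h_bound (t : ℂ) (ht : ‖t‖ = √(1 / 2 / k)) : ‖f (0 + t • Pi.single i 1)‖ ≤ √(8 * M) := by
    have h_eq : defect (0 + t • Pi.single i 1) = 1 - 1 / 2 / k := by rw [h_defect, ht, h_sq]
    rw [← h_eq] at h_weight
    have h_val := hM ⟨_, h_mem t ht.le⟩
    refine Real.le_sqrt_of_sq_le ?_
    linarith [mul_le_mul_of_nonneg_right h_weight (sq_nonneg ‖f (0 + t • Pi.single i 1)‖)]
  have hM0 : 0 ≤ M :=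
    (mul_nonneg (pow_pos (defect_pos origin) _).le (sq_nonneg _)).trans (hM origin)
  calc ‖fderiv ℂ f 0 (Pi.single i 1)‖ ^ 2 ≤ (√(8 * M) / √(1 / 2 / k)) ^ 2 :=
        pow_le_pow_left₀ (norm_nonneg _)
          (norm_fderiv_apply_le isOpen_ball hf (Real.sqrt_pos.2 (by positivity)) h_mem h_bound) 2
    _ = 16 * M * k := by
        rw [div_pow, h_sq, Real.sq_sqrt (by positivity)]
        field_simp
        ring

end CauchyEstimate

section BergmanMetric

variable {k d : ℕ} {ω : Fin d → Ball → CanPow k}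

/-- The vector of coefficient functions of a family of sections, extended by zero off the ball. -/
def coefVec (k : ℕ) (ω : Fin d → Ball → CanPow k) (w : Fin 2 → ℂ) : Fin d → ℂ :=
  fun j => ext0 (coefFun k (ω j)) w

lemma differentiableOn_coefVec {Γ : Subgroup SU21} (hω : ∀ j, ω j ∈ globalSections Γ k) :
    DifferentiableOn ℂ (coefVec k ω) Ball :=
  differentiableOn_pi.2 fun j => (mem_globalSections.1 (hω j)).1

lemma bergmanNorm_smul (g : SU21) (z : Ball) : bergmanNorm k ω (g • z)
    = defect z.1 ^ (3 * k) * ‖WithLp.toLp 2 (slash g (3 * k) (coefVec k ω) z.1)‖ ^ 2 := by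
  simp_rw [bergmanNorm_eq_sum, secNorm_smul_eq_slash, ← Finset.mul_sum, EuclideanSpace.norm_sq_eq]
  rfl

lemma bergmanNorm_smul_origin (g : SU21) :
    bergmanNorm k ω (g • origin) = ‖WithLp.toLp 2 (slash g (3 * k) (coefVec k ω) 0)‖ ^ 2 := by
  rw [bergmanNorm_smul, defect_origin, one_pow, one_mul, origin]

lemma bergmanNorm_eq_coefVec (z : Ball) :
    bergmanNorm k ω z = defect z.1 ^ (3 * k) * ∑ j, 1 * ‖coefVec k ω z.1 j‖ ^ 2 := by
  simp_rw [bergmanNorm_eq_mul, coefVec, ext0_apply _ z.2, one_mul]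

lemma sum_norm_coefVec_pos {z : Ball} (h : 0 < bergmanNorm k ω z) :
    0 < ∑ j, 1 * ‖coefVec k ω z.1 j‖ ^ 2 := by
  rw [bergmanNorm_eq_coefVec] at h
  exact pos_of_mul_pos_right h (pow_pos (defect_pos z) _).le

lemma hasHess_log_bergmanNorm (hω : DifferentiableOn ℂ (coefVec k ω) Ball)
    (h_pos : ∀ z, 0 < bergmanNorm k ω z) (z : Ball) :
    HasHess (ext0 fun w => ((Real.log (bergmanNorm k ω w) : ℝ) : ℂ))
      (logHess (fun _ => 1) (coefVec k ω) z.1 + (3 * k : ℂ) • defectHess z.1) z.1 := by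
  have h_pos' (w) (hw : w ∈ Ball) : 0 < ∑ j, 1 * ‖coefVec k ω w j‖ ^ 2 :=
    sum_norm_coefVec_pos (z := ⟨w, hw⟩) (h_pos _)
  refine ((hasHess_log_diagHerm (fun _ => 1) isOpen_ball hω h_pos' z.2).add
    ((hasHess_log_defect z.2).const_mul (3 * k : ℂ))).congr ?_
  filter_upwards [isOpen_ball.mem_nhds z.2] with w hw
  rw [ext0_apply _ hw, bergmanNorm_eq_coefVec, Real.log_mul
    (pow_pos (defect_pos ⟨w, hw⟩) _).ne' (h_pos' w hw).ne', Real.log_pow]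
  push_cast
  ring

/-- The complex Hessian of the logarithm of the Bergman kernel at `g • origin`, in the coordinates
in which `g` moves that point to the origin. -/
def centredHess (k : ℕ) (ω : Fin d → Ball → CanPow k) (g : SU21) : Matrix (Fin 2) (Fin 2) ℂ :=
  logHess (fun _ => 1) (slash g (3 * k) (coefVec k ω)) 0 - (3 * k : ℂ) • 1

lemma isHermitian_centredHess (g : SU21) : (centredHess k ω g).IsHermitian := by
  refine (isHermitian_fubiniStudy _ _ _).sub ?_
  simp [Matrix.IsHermitian, Matrix.conjTranspose_smul]

lemma det_hess_eq_mul (hω : DifferentiableOn ℂ (coefVec k ω) Ball)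
    (h_pos : ∀ z, 0 < bergmanNorm k ω z) (g : SU21) :
    (hess (ext0 fun w => ((Real.log (bergmanNorm k ω w) : ℝ) : ℂ)) (g • origin).1).det
      = (centredHess k ω g).det
        * (hess (fun w => ((Real.log (defect w) : ℝ) : ℂ)) (g • origin).1).det := by
  rw [(hasHess_log_bergmanNorm hω h_pos _).hess_eq, (hasHess_log_defect (g • origin).2).hess_eq]
  have h_ne : diagHerm (fun _ => 1) (coefVec k ω (g • origin).1) (coefVec k ω (g • origin).1)
      ≠ 0 := by
    rw [diagHerm_self]
    exact_mod_cast (sum_norm_coefVec_pos (h_pos _)).ne'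
  have h_defect := defectHess_eq_jacobian g origin
  have h_slash := logHess_slash g (3 * k) hω h_ne
  set D := defectHess (g • origin).1
  set M := logHess (fun _ => 1) (coefVec k ω) (g • origin).1
  set A := jacobian g origin.1
  rw [defectHess_origin] at h_defect
  have h_total : A.transpose * (M + (3 * k : ℂ) • D) * A.map (starRingEnd ℂ)
      = centredHess k ω g := by
    rw [Matrix.mul_add, Matrix.add_mul, ← h_slash, Matrix.mul_smul, Matrix.smul_mul, ← h_defect,
      smul_neg, ← sub_eq_add_neg]
    rfl
  have h_det : A.transpose.det * D.det * (A.map (starRingEnd ℂ)).det = 1 := by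
    rw [← Matrix.det_mul, ← Matrix.det_mul, ← h_defect, Matrix.det_neg, Matrix.det_one]
    norm_num
  rw [← h_total, Matrix.det_mul, Matrix.det_mul]
  linear_combination -(M + (3 * k : ℂ) • D).det * h_det

lemma volForm_bergmanMetric (hω : DifferentiableOn ℂ (coefVec k ω) Ball)
    (h_pos : ∀ z, 0 < bergmanNorm k ω z) (g : SU21) :
    volForm (bergmanMetric k ω (g • origin))
      = ((centredHess k ω g).det.re / Real.pi ^ 2) • volForm (hypMetric (g • origin)) := by
  refine volForm_eq_smul ?_
  have h_pi : (Real.pi : ℂ) ≠ 0 := by exact_mod_cast Real.pi_ne_zero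
  rw [det_hess_eq_mul hω h_pos]
  push_cast
  rw [ofReal_re_det (isHermitian_centredHess g)]
  field_simp

lemma norm_fderiv_slash_sq_le (hk : 1 ≤ k) (hω : DifferentiableOn ℂ (coefVec k ω) Ball) {M : ℝ}
    (h_le : ∀ z, bergmanNorm k ω z ≤ M) (g : SU21) (i : Fin 2) :
    ‖WithLp.toLp 2 (fderiv ℂ (slash g (3 * k) (coefVec k ω)) 0 (Pi.single i 1))‖ ^ 2
      ≤ 16 * M * k := by
  set e := (PiLp.continuousLinearEquiv 2 ℂ fun _ : Fin d => ℂ).symm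
  have h_slash := differentiableOn_slash g (3 * k) hω
  have h_cauchy := norm_fderiv_single_sq_le (e.differentiable.comp_differentiableOn h_slash) hk
    (fun z => (bergmanNorm_smul g z).ge.trans (h_le _)) i
  rwa [e.comp_fderiv] at h_cauchy

lemma norm_centredHess_le (hk : 1 ≤ k) (hω : DifferentiableOn ℂ (coefVec k ω) Ball) {c C : ℝ}
    (hc : 0 < c) (h_ge : ∀ z, c * k ^ 2 ≤ bergmanNorm k ω z)
    (h_le : ∀ z, bergmanNorm k ω z ≤ C * k ^ 2) (g : SU21) (i j : Fin 2) :
    ‖centredHess k ω g i j‖ ≤ (32 * C / c + 3) * k := by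
  have : (0 : ℝ) < k := by exact_mod_cast hk
  have h_one : ‖((3 * k : ℂ) • (1 : Matrix (Fin 2) (Fin 2) ℂ)) i j‖ ≤ 3 * k := by
    rw [Matrix.smul_apply, Matrix.one_apply]
    split_ifs <;> simp
  calc ‖centredHess k ω g i j‖ ≤ 2 * (16 * (C * k ^ 2) * k) / (c * k ^ 2) + 3 * k :=
        (norm_sub_le _ _).trans (add_le_add (norm_fubiniStudy_one_le (by positivity)
          ((h_ge _).trans_eq (bergmanNorm_smul_origin g))
          (norm_fderiv_slash_sq_le hk hω h_le g) i j) h_one)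
    _ = (32 * C / c + 3) * k := by
        field_simp
        ring

lemma exists_volForm_bergmanMetric_eq (hk : 1 ≤ k) (hω : DifferentiableOn ℂ (coefVec k ω) Ball)
    {c C : ℝ} (hc : 0 < c) (h_ge : ∀ z, c * k ^ 2 ≤ bergmanNorm k ω z)
    (h_le : ∀ z, bergmanNorm k ω z ≤ C * k ^ 2) (z : Ball) :
    ∃ r : ℝ, volForm (bergmanMetric k ω z) = r • volForm (hypMetric z) ∧
      |r| ≤ 2 * (32 * C / c + 3) ^ 2 * k ^ 2 := by
  have : (0 : ℝ) < k := by exact_mod_cast hk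
  obtain ⟨g, rfl⟩ := exists_smul_eq origin z
  refine ⟨_, volForm_bergmanMetric hω (fun z => lt_of_lt_of_le (by positivity) (h_ge z)) g, ?_⟩
  have h_pi : 1 ≤ Real.pi ^ 2 := one_le_pow₀ (by linarith [Real.pi_gt_three])
  rw [abs_div, abs_of_pos (by positivity : (0 : ℝ) < Real.pi ^ 2), mul_assoc, ← mul_pow]
  exact (div_le_self (abs_nonneg _) h_pi).trans
    (abs_re_det_le (norm_centredHess_le hk hω hc h_ge h_le g))

end BergmanMetric

lemma natCast_sq_le_rpow (n : ℕ) {s : ℝ} (hs : 2 ≤ s) : (n : ℝ) ^ 2 ≤ (n : ℝ) ^ s := by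
  obtain rfl | hn := n.eq_zero_or_pos
  · simp [Real.zero_rpow (by linarith : s ≠ 0)]
  · rw [← Real.rpow_two]
    exact Real.rpow_le_rpow_of_exponent_le (by exact_mod_cast hn) hs

end PicardBergman

end

open PicardBergman in
theorem theorem2_general (Γ : Subgroup SU21) (hΓ : IsPicardGroup Γ) :
    ∃ (k₀ : ℕ) (C : ℝ), 0 < C ∧ ∀ k : ℕ, k₀ ≤ k →
      (∃ (d : ℕ) (ω : Fin d → Ball → CanPow k), IsOrthonormalBasis Γ k ω) ∧
      ∀ (d : ℕ) (ω : Fin d → Ball → CanPow k), IsOrthonormalBasis Γ k ω → ∀ z : Ball,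
        0 < bergmanNorm k ω z ∧ ∃ r : ℝ,
          volForm (bergmanMetric k ω z) = r • volForm (hypMetric z) ∧ |r| ≤ C * (k : ℝ) ^ 2 := by
  obtain ⟨k₀, hk₀, c, hc, h_ge⟩ := hΓ.exists_le_bergmanNorm
  obtain ⟨C, hC, h_le⟩ := hΓ.exists_bergmanNorm_le
  refine ⟨k₀, 2 * (32 * C / c + 3) ^ 2, by positivity, fun k hk => ?_⟩
  have hk_one : 1 ≤ k := by lia
  refine ⟨hΓ.exists_isOrthonormalBasis hk_one, fun d ω hω z => ⟨?_, ?_⟩⟩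
  · exact lt_of_lt_of_le (by positivity) (h_ge k hk d ω hω z)
  · exact exists_volForm_bergmanMetric_eq hk_one (differentiableOn_coefVec hω.mem) hc
      (h_ge k hk d ω hω) (h_le k hk_one d ω hω.mem hω.orthonormal) z

open PicardBergman in
theorem theorem2 (Γ : Subgroup SU21) (hΓ : IsPicardGroup Γ) :
    ∃ k₀ : ℕ,
      (∀ k : ℕ, k₀ ≤ k →
        (∃ (d : ℕ) (ω : Fin d → Ball → CanPow k), IsOrthonormalBasis Γ k ω) ∧
        ∀ (d : ℕ) (ω : Fin d → Ball → CanPow k), IsOrthonormalBasis Γ k ω →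
          ∀ z : Ball, 0 < bergmanNorm k ω z) ∧
      ∀ ε : ℝ, 0 < ε → ∃ C : ℝ, ∀ k : ℕ, k₀ ≤ k →
        ∀ (d : ℕ) (ω : Fin d → Ball → CanPow k), IsOrthonormalBasis Γ k ω →
          ∀ z : Ball, ∃ r : ℝ,
            volForm (bergmanMetric k ω z) = r • volForm (hypMetric z) ∧
            |r| ≤ C * (k : ℝ) ^ (4 + ε) := by
  obtain ⟨k₀, C, hC, h⟩ := theorem2_general Γ hΓ
  refine ⟨k₀, fun k hk => ⟨(h k hk).1, fun d ω hω z => ((h k hk).2 d ω hω z).1⟩,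
    fun ε hε => ⟨C, fun k hk d ω hω z => ?_⟩⟩
  obtain ⟨-, r, h_eq, h_le⟩ := (h k hk).2 d ω hω z
  exact ⟨r, h_eq, h_le.trans (mul_le_mul_of_nonneg_left (natCast_sq_le_rpow k (by linarith)) hC.le)⟩
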